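/- **Notation.** For $0\le n\le 8$ let $M_n=\mathbb{CP}^2\# n\overline{\mathbb{CP}^2}$, and let $H_2(M_n,\mathbb Z)=\mathbb Z^{1,n}$ have basis $H,E_1,\dots,E_n$ and intersection form $Q$ given by $Q(H,H)=1$, $Q(E_i,E_j)=-\delta_{ij}$, $Q(H,E_i)=0$. The topological mapping class group $\mathrm{Mod}(M_n)=\pi_0(\mathrm{Homeo}^+(M_n))$ is identified, via its action on $H_2$, with the isometry group $O(1,n)(\mathbb Z)=\mathrm{Aut}(H_2(M_n,\mathbb Z),Q)$. Let $\mathrm{Mod}^+(M_n)=O^+(1,n)(\mathbb Z)$ be the subgroup preserving each of the two sheets of $\{v\in H_2(M_n,\mathbb R):Q(v,v)=1\}$. An element $g\in \mathrm{Mod}(M_n)$ is *reducible* if there are a del Pezzo manifold $M$ (that is, $M=\mathbb{CP}^1\times\mathbb{CP}^1$ or $M=M_m$ with $0\le m\le 8$), an integer $k>0$ and an isometry $\iota: H_2(M,\mathbb Z)\oplus H_2(\#k\overline{\mathbb{CP}^2},\mathbb Z)\to H_2(M_n,\mathbb Z)$ (for the intersection forms) such that $g=\iota\,(a\oplus b)\,\iota^{-1}$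 for some isometries $a$ of $H_2(M,\mathbb Z)$ and $b$ of $H_2(\#k\overline{\mathbb{CP}^2},\mathbb Z)$; otherwise $g$ is *irreducible*. Let $K=-3H+\sum_i E_i$, let the Weyl group $W_n\le \mathrm{Mod}(M_n)$ be the stabilizer of $K$, and let $\mathbb E_n=\{v: Q(v,K)=0\}$. For $3\le n\le 8$ the simple reflections of $W_n$ are the reflections $x\mapsto x-\frac{2Q(x,v)}{Q(v,v)}v$ in the vectors $v=H-E_1-E_2-E_3,\ E_1-E_2,\ \dots,\ E_{n-1}-E_n$; a *Coxeter element* of $W_n$ is a product of all the simple reflections, each taken once, in any order, and $h_n$ denotes the order of a Coxeter element. Let $r\in W_8$ be the element with matrix (columns are the images of $H,E_1,\dots,E_8$) $$r=\begin{pmatrix} 3&1&1&0&0&0&1&1&2\\ -1&-1&0&0&0&0&0&0&-1\\ -1&0&-1&0&0&0&0&0&-1\\ -2&-1&-1&0&0&0&-1&-1&-1\\ -1&0&0&0&0&0&0&-1&-1\\ -1&0&0&0&0&0&-1&0&-1\\ 0&0&0&1&0&0&0&0&0\\ 0&0&0&0&1&0&0&0&0\\ 0&0&0&0&0&1&0&0&0\end{pmatrix}.$$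 **Theorem 6.3 (with its companion, Theorem 6.2).** 1. Let $3\le n\le 7$. An element $w\in\mathrm{Mod}^+(M_n)$ is irreducible of order $h_n$ if and only if $w$ is conjugate in $\mathrm{Mod}^+(M_n)$ to a Coxeter element of $W_n$. 2. $h_8=30$, and an element $w\in \mathrm{Mod}^+(M_8)$ is irreducible of order $30$ if and only if $w$ is conjugate in $\mathrm{Mod}(M_8)$ to a Coxeter element of $W_8$ or to $r$. 3. The characteristic polynomial of $r$ acting on $\mathbb E_8$ is $(t+1)^2(t^2-t+1)(t^4-t^3+t^2-t+1)$. -/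

import Mathlib

namespace DelPezzo

/-! ### Lattices -/

/-- The form `⟨1⟩ ⊕ n⟨-1⟩` on `R^(n+1)`, i.e. `x₀y₀ - x₁y₁ - ... - xₙyₙ`. -/
def lorentzForm (R : Type) [CommRing R] (n : ℕ) : LinearMap.BilinForm R (Fin (n + 1) → R) :=
  LinearMap.mk₂ R (fun x y => x 0 * y 0 - ∑ i : Fin n, x i.succ * y i.succ)
    (by intro x x' y; simp only [Pi.add_apply, add_mul, Finset.sum_add_distrib]; ring)
    (by intro c x y; simp only [Pi.smul_apply, smul_eq_mul, mul_sub, Finset.mul_sum, mul_assoc])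
    (by intro x y y'; simp only [Pi.add_apply, mul_add, Finset.sum_add_distrib]; ring)
    (by
      intro c x y
      simp only [Pi.smul_apply, smul_eq_mul, mul_sub, Finset.mul_sum, mul_left_comm])

/-- The form `k⟨-1⟩` on `ℤ^k`: the intersection form of the connected sum of `k` copies of
the complex projective plane with reversed orientation. -/
def negForm (k : ℕ) : LinearMap.BilinForm ℤ (Fin k → ℤ) :=
  LinearMap.mk₂ ℤ (fun x y => - ∑ i : Fin k, x i * y i)
    (by intro x x' y; simp only [Pi.add_apply, add_mul, Finset.sum_add_distrib]; ring)
    (by intro c x y; simp only [Pi.smul_apply, smul_eq_mul, mul_neg, Finset.mul_sum, mul_assoc])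
    (by intro x y y'; simp only [Pi.add_apply, mul_add, Finset.sum_add_distrib]; ring)
    (by
      intro c x y
      simp only [Pi.smul_apply, smul_eq_mul, mul_neg, Finset.mul_sum, mul_left_comm])

/-- The hyperbolic plane: the intersection form of `ℂP¹ × ℂP¹`. -/
def hyperbolicPlane : LinearMap.BilinForm ℤ (Fin 2 → ℤ) :=
  LinearMap.mk₂ ℤ (fun x y => x 0 * y 1 + x 1 * y 0)
    (by intro x x' y; simp only [Pi.add_apply]; ring)
    (by intro c x y; simp only [Pi.smul_apply, smul_eq_mul]; ring)
    (by intro x y y'; simp only [Pi.add_apply]; ring)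
    (by intro c x y; simp only [Pi.smul_apply, smul_eq_mul]; ring)

/-- The orthogonal direct sum of two bilinear forms. -/
def sumForm {V W : Type} [AddCommMonoid V] [Module ℤ V] [AddCommMonoid W] [Module ℤ W]
    (B : LinearMap.BilinForm ℤ V) (C : LinearMap.BilinForm ℤ W) :
    LinearMap.BilinForm ℤ (V × W) :=
  B.comp (LinearMap.fst ℤ V W) (LinearMap.fst ℤ V W) +
    C.comp (LinearMap.snd ℤ V W) (LinearMap.snd ℤ V W)

/-- The group `Aut(V, B)` of linear automorphisms of `V` preserving `B`. -/
def autGroup {V : Type} [AddCommGroup V] [Module ℤ V] (B : LinearMap.BilinForm ℤ V) :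
    Subgroup (V ≃ₗ[ℤ] V) where
  carrier := {g | ∀ x y, B (g x) (g y) = B x y}
  mul_mem' {g h} hg hh x y := (hg (h x) (h y)).trans (hh x y)
  one_mem' _ _ := rfl
  inv_mem' {g} hg x y := by
    have h := hg (g⁻¹ x) (g⁻¹ y)
    have e : ∀ z, g (g⁻¹ z) = z := fun z => g.apply_symm_apply z
    rw [e, e] at h
    exact h.symm

/-! ### Del Pezzo manifolds and their mapping class groups -/

/-- The diffeomorphism types of del Pezzo surfaces: `M_m = ℂP² # m(-ℂP²)` for `0 ≤ m ≤ 8`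
(`M_0 = ℂP²`), and `ℂP¹ × ℂP¹`. -/
inductive Manifold : Type
  | blowup (m : ℕ) (hm : m ≤ 8)
  | quadric

/-- The second Betti number. -/
def Manifold.b₂ : Manifold → ℕ
  | blowup m _ => m + 1
  | quadric => 2

/-- The intersection form on `H₂(M, ℤ) = ℤ^(b₂ M)`. -/
def Manifold.form : (M : Manifold) → LinearMap.BilinForm ℤ (Fin M.b₂ → ℤ)
  | blowup m _ => lorentzForm ℤ m
  | quadric => hyperbolicPlane

/-- `H₂(M_n, ℤ) = ℤ^{1,n}`, with the basis `H, E₁, ..., E_n` given by the standard basis. -/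
abbrev H₂ (n : ℕ) : Type := Fin (n + 1) → ℤ

/-- `Mod(M_n)`, identified with `O(1,n)(ℤ) = Aut(H₂(M_n, ℤ), Q)` by its action on `H₂`. -/
abbrev ModGroup (n : ℕ) : Type := autGroup (lorentzForm ℤ n)

/-- One of the two sheets of the hyperboloid `{v ∈ H₂(M_n, ℝ) : Q(v,v) = 1}`. -/
def upperSheet (n : ℕ) : Set (Fin (n + 1) → ℝ) := {v | lorentzForm ℝ n v v = 1 ∧ 0 < v 0}

/-- The other sheet of the hyperboloid. -/
def lowerSheet (n : ℕ) : Set (Fin (n + 1) → ℝ) := {v | lorentzForm ℝ n v v = 1 ∧ v 0 < 0}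

/-- The real-linear extension to `H₂(M_n, ℝ)` of an endomorphism of `H₂(M_n, ℤ)`. -/
def realExtension {n : ℕ} (g : H₂ n →ₗ[ℤ] H₂ n) : (Fin (n + 1) → ℝ) →ₗ[ℝ] (Fin (n + 1) → ℝ) :=
  Matrix.toLin' ((LinearMap.toMatrix' g).map (Int.castRingHom ℝ))

theorem realExtension_one {n : ℕ} :
    realExtension (LinearMap.id : H₂ n →ₗ[ℤ] H₂ n) = LinearMap.id := by
  simp [realExtension, LinearMap.toMatrix'_id]

theorem realExtension_comp {n : ℕ} (g h : H₂ n →ₗ[ℤ] H₂ n) :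
    realExtension (g ∘ₗ h) = realExtension g ∘ₗ realExtension h := by
  simp only [realExtension, LinearMap.toMatrix'_comp, Matrix.map_mul, Matrix.toLin'_mul]

/-- `g` preserves each of the two sheets of the hyperboloid. -/
def PreservesSheets {n : ℕ} (g : ModGroup n) : Prop :=
  realExtension (g : H₂ n ≃ₗ[ℤ] H₂ n).toLinearMap '' upperSheet n = upperSheet n ∧
    realExtension (g : H₂ n ≃ₗ[ℤ] H₂ n).toLinearMap '' lowerSheet n = lowerSheet n

/-- `Mod⁺(M_n) = O⁺(1,n)(ℤ)`, as a subgroup of `Mod(M_n)`. -/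
def ModPlus (n : ℕ) : Subgroup (ModGroup n) where
  carrier := {g | PreservesSheets g}
  mul_mem' {g h} hg hh := by
    have e : realExtension ((g * h : ModGroup n) : H₂ n ≃ₗ[ℤ] H₂ n).toLinearMap =
        realExtension (g : H₂ n ≃ₗ[ℤ] H₂ n).toLinearMap ∘ₗ
          realExtension (h : H₂ n ≃ₗ[ℤ] H₂ n).toLinearMap := by
      rw [← realExtension_comp]; rfl
    refine ⟨?_, ?_⟩
    · rw [e, LinearMap.coe_comp, Set.image_comp, hh.1, hg.1]
    · rw [e, LinearMap.coe_comp, Set.image_comp, hh.2, hg.2]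
  one_mem' := by
    have e : realExtension ((1 : ModGroup n) : H₂ n ≃ₗ[ℤ] H₂ n).toLinearMap = LinearMap.id :=
      realExtension_one
    refine ⟨?_, ?_⟩ <;> rw [e, LinearMap.id_coe, Set.image_id]
  inv_mem' {g} hg := by
    have e : realExtension ((g⁻¹ : ModGroup n) : H₂ n ≃ₗ[ℤ] H₂ n).toLinearMap ∘ₗ
        realExtension (g : H₂ n ≃ₗ[ℤ] H₂ n).toLinearMap = LinearMap.id := by
      rw [← realExtension_comp, ← realExtension_one]
      congr 1
      ext1 x
      exact LinearMap.ext fun y => by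
        simp [LinearMap.comp_apply]
    refine ⟨?_, ?_⟩
    · conv_lhs => rw [← hg.1]
      rw [← Set.image_comp, ← LinearMap.coe_comp, e]; simp
    · conv_lhs => rw [← hg.2]
      rw [← Set.image_comp, ← LinearMap.coe_comp, e]; simp

/-- A mapping class `g` of `M_n` is reducible if for some del Pezzo manifold `M`, some `k > 0` and
some isometry `ι : H₂(M) ⊕ H₂(#k(-ℂP²)) ≅ H₂(M_n)`, it lies in the image of the
induced inclusion `Aut(H₂(M)) × Aut(H₂(#k(-ℂP²))) → Aut(H₂(M_n))`, `(a, b) ↦ ι (a ⊕ b) ι⁻¹`. -/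
def IsReducible {n : ℕ} (g : ModGroup n) : Prop :=
  ∃ (M : Manifold) (k : ℕ), 0 < k ∧
    ∃ ι : (sumForm M.form (negForm k)).IsometryEquiv (lorentzForm ℤ n),
      ∃ a ∈ autGroup M.form, ∃ b ∈ autGroup (negForm k),
        (g : H₂ n ≃ₗ[ℤ] H₂ n) =
          (ι.toLinearEquiv.symm.trans (a.prodCongr b)).trans ι.toLinearEquiv

/-- A mapping class is irreducible if it is not reducible. -/
def IsIrreducible {n : ℕ} (g : ModGroup n) : Prop := ¬ IsReducible g

/-! ### The Weyl group and its Coxeter elements -/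

/-- The hyperplane class `H`. -/
def hyp (n : ℕ) : H₂ n := Pi.single 0 1

/-- The exceptional classes; with the indexing from `0`, `exc i` is `E_(i+1)`. -/
def exc {n : ℕ} (i : Fin n) : H₂ n := Pi.single i.succ 1

/-- The canonical class `K = -3H + E₁ + ... + E_n`. -/
def canonicalClass (n : ℕ) : H₂ n := (-3 : ℤ) • hyp n + ∑ i : Fin n, exc i

/-- The Weyl group `W_n`: the stabilizer of the canonical class in `Mod(M_n)`. -/
def weylGroup (n : ℕ) : Subgroup (ModGroup n) where
  carrier := {g | (g : H₂ n ≃ₗ[ℤ] H₂ n) (canonicalClass n) = canonicalClass n}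
  mul_mem' {g h} hg hh := by
    change (g : H₂ n ≃ₗ[ℤ] H₂ n) ((h : H₂ n ≃ₗ[ℤ] H₂ n) (canonicalClass n)) = canonicalClass n
    exact (congrArg _ hh).trans hg
  one_mem' := rfl
  inv_mem' {g} hg := by
    change (g : H₂ n ≃ₗ[ℤ] H₂ n).symm (canonicalClass n) = canonicalClass n
    rw [LinearEquiv.symm_apply_eq]
    exact hg.symm

/-- The lattice `𝔼_n`: the orthogonal complement of the canonical class. -/
def rootLattice (n : ℕ) : Submodule ℤ (H₂ n) :=
  LinearMap.ker ((lorentzForm ℤ n).flip (canonicalClass n))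

theorem mem_rootLattice {n : ℕ} {v : H₂ n} :
    v ∈ rootLattice n ↔ lorentzForm ℤ n v (canonicalClass n) = 0 := Iff.rfl

/-- The action of an element of the Weyl group on `𝔼_n`. -/
def rootLatticeAction {n : ℕ} (g : weylGroup n) : rootLattice n →ₗ[ℤ] rootLattice n :=
  ((g : ModGroup n) : H₂ n ≃ₗ[ℤ] H₂ n).toLinearMap.restrict (p := rootLattice n)
    (q := rootLattice n) (by
      intro v hv
      rw [mem_rootLattice] at hv ⊢
      have h1 := (g : ModGroup n).2 v (canonicalClass n)
      have h2 : ((g : ModGroup n) : H₂ n ≃ₗ[ℤ] H₂ n) (canonicalClass n) = canonicalClass n := g.2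
      rw [h2, hv] at h1
      exact h1)

theorem lorentzForm_comm {n : ℕ} (x y : H₂ n) :
    lorentzForm ℤ n x y = lorentzForm ℤ n y x := by
  simp [lorentzForm, mul_comm]

/-- The reflection `x ↦ x - (2 Q(x,v) / Q(v,v)) v` in a vector `v` with `Q(v,v) = ±1, ±2`
(the integers dividing `2`, so that `2 / Q(v,v)` is an exact division). -/
def reflection {n : ℕ} (v : H₂ n) (hv : lorentzForm ℤ n v v ∣ 2) : ModGroup n :=
  ⟨Module.reflection (x := v)
      (f := (2 / lorentzForm ℤ n v v) • (lorentzForm ℤ n).flip v)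
      (by simpa using Int.ediv_mul_cancel hv), by
    intro x y
    have h := Int.ediv_mul_cancel hv
    have hf : ∀ z, (lorentzForm ℤ n).flip v z = lorentzForm ℤ n z v := fun _ => rfl
    simp only [Module.reflection_apply, LinearMap.smul_apply, hf, map_sub,
      map_smul, LinearMap.sub_apply, smul_eq_mul]
    rw [lorentzForm_comm v y]
    linear_combination (2 / lorentzForm ℤ n v v) * lorentzForm ℤ n x v * lorentzForm ℤ n y v * h⟩

/-- The simple roots `H - E₁ - E₂ - E₃` (index `0`) and `E_i - E_(i+1)` (index `1 ≤ i ≤ n-1`). -/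
def simpleRoot {n : ℕ} (hn : 3 ≤ n) (i : Fin n) : H₂ n :=
  if (i : ℕ) = 0 then
    hyp n - exc (⟨0, by omega⟩ : Fin n) - exc (⟨1, by omega⟩ : Fin n) -
      exc (⟨2, by omega⟩ : Fin n)
  else exc (⟨(i : ℕ) - 1, by omega⟩ : Fin n) - exc i

theorem lorentzForm_exc_exc {n : ℕ} (i j : Fin n) :
    lorentzForm ℤ n (exc i) (exc j) = if i = j then -1 else 0 := by
  by_cases h : i = j
  · subst h
    simp [lorentzForm, exc, Pi.single_apply]
  · simp [lorentzForm, exc, Pi.single_apply, h, Ne.symm h]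

theorem simpleRoot_sq {n : ℕ} (hn : 3 ≤ n) (i : Fin n) :
    lorentzForm ℤ n (simpleRoot hn i) (simpleRoot hn i) = -2 := by
  have hh : lorentzForm ℤ n (hyp n) (hyp n) = 1 := by
    simp [lorentzForm, hyp]
  have he : ∀ j : Fin n, lorentzForm ℤ n (hyp n) (exc j) = 0 := by
    intro j; simp [lorentzForm, hyp, exc, Pi.single_apply]
  have he' : ∀ j : Fin n, lorentzForm ℤ n (exc j) (hyp n) = 0 := by
    intro j; rw [lorentzForm_comm, he]
  unfold simpleRoot
  split_ifs with h
  · simp [map_sub, LinearMap.sub_apply, hh, he, he', lorentzForm_exc_exc]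
  · have h1 : (⟨(i : ℕ) - 1, by omega⟩ : Fin n) ≠ i := by
      intro e; have := congrArg Fin.val e; simp at this; omega
    simp [map_sub, LinearMap.sub_apply, lorentzForm_exc_exc, h1, h1.symm]

/-- The simple reflections. -/
def simpleReflection {n : ℕ} (hn : 3 ≤ n) (i : Fin n) : ModGroup n :=
  reflection (simpleRoot hn i) (by rw [simpleRoot_sq]; norm_num)

/-- A Coxeter element of `W_n`: a product of all simple reflections, each once, in some order. -/
def IsCoxeterElement {n : ℕ} (hn : 3 ≤ n) (c : ModGroup n) : Prop :=
  ∃ σ : Equiv.Perm (Fin n), c = (List.ofFn fun i => simpleReflection hn (σ i)).prod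

/-- The Coxeter number `h_n`: the order of a Coxeter element of `W_n`. -/
noncomputable def coxeterNumber {n : ℕ} (hn : 3 ≤ n) : ℕ :=
  orderOf (List.ofFn (simpleReflection hn)).prod

/-! ### The element `r` of `W_8` -/

/-- The matrix of `r` in the basis `H, E₁, ..., E₈` (columns are images of basis vectors). -/
def rMatrix : Matrix (Fin 9) (Fin 9) ℤ :=
  !![ 3,  1,  1, 0, 0, 0,  1,  1,  2;
     -1, -1,  0, 0, 0, 0,  0,  0, -1;
     -1,  0, -1, 0, 0, 0,  0,  0, -1;
     -2, -1, -1, 0, 0, 0, -1, -1, -1;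
     -1,  0,  0, 0, 0, 0,  0, -1, -1;
     -1,  0,  0, 0, 0, 0, -1,  0, -1;
      0,  0,  0, 1, 0, 0,  0,  0,  0;
      0,  0,  0, 0, 1, 0,  0,  0,  0;
      0,  0,  0, 0, 0, 1,  0,  0,  0]

/-- The inverse of `rMatrix`. -/
def rInvMatrix : Matrix (Fin 9) (Fin 9) ℤ :=
  !![ 3,  1,  1,  2,  1,  1, 0, 0, 0;
     -1, -1,  0, -1,  0,  0, 0, 0, 0;
     -1,  0, -1, -1,  0,  0, 0, 0, 0;
      0,  0,  0,  0,  0,  0, 1, 0, 0;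
      0,  0,  0,  0,  0,  0, 0, 1, 0;
      0,  0,  0,  0,  0,  0, 0, 0, 1;
     -1,  0,  0, -1,  0, -1, 0, 0, 0;
     -1,  0,  0, -1, -1,  0, 0, 0, 0;
     -2, -1, -1, -1, -1, -1, 0, 0, 0]

set_option maxRecDepth 100000 in
theorem rMatrix_mul_rInvMatrix : rMatrix * rInvMatrix = 1 := by decide

set_option maxRecDepth 100000 in
theorem rInvMatrix_mul_rMatrix : rInvMatrix * rMatrix = 1 := by decide

/-- `r` as a linear automorphism of `H₂(M_8, ℤ)`. -/
def rEquiv : H₂ 8 ≃ₗ[ℤ] H₂ 8 :=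
  Matrix.toLin'OfInv rInvMatrix_mul_rMatrix rMatrix_mul_rInvMatrix

theorem rEquiv_apply (x : H₂ 8) : rEquiv x = rMatrix.mulVec x := rfl

theorem rEquiv_mem : rEquiv ∈ autGroup (lorentzForm ℤ 8) := by
  intro x y
  rw [rEquiv_apply, rEquiv_apply]
  simp [lorentzForm, rMatrix, dotProduct, Fin.sum_univ_succ]
  ring

set_option maxRecDepth 100000 in
theorem rEquiv_canonicalClass : rEquiv (canonicalClass 8) = canonicalClass 8 := by
  rw [rEquiv_apply]
  decide

/-- The element `r` of `W_8`. -/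
def r : weylGroup 8 := ⟨⟨rEquiv, rEquiv_mem⟩, rEquiv_canonicalClass⟩

end DelPezzo

namespace DelPezzo

-- Reduction to W_n. An element w of finite order in Mod⁺ fixes a forward vector v, the sum of the
-- orbit of H. Mod⁺ contains the reflections in the simple roots and in E_n, so after conjugation v
-- lies in the chamber they bound. If v lies on the wall of E_n, it comes from a smaller blowup or
-- from ℂP¹ × ℂP¹, where its orthogonal complement has no class of square −1; every isometry fixing
-- v then respects the splitting, and w is reducible (`isReducible_of_isDominant`). Off that wall,
-- −K is the only forward characteristic vector of square 9 − n whose pairing with v is Q(−K, v), so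
-- w fixes K (`IsCharacteristic.eq_of_pairing_eq`, `exists_conj_mem_weylGroup`).
--
-- Elliptic elements, those fixing no nonzero vector of K^⊥. An elliptic element of W_n of finite
-- order is irreducible, by a parity argument on the orbit of an exceptional summand
-- (`IsElliptic.isIrreducible`). This gives the converse directions: Coxeter elements are all
-- conjugate because the Dynkin diagram is a forest, and one of them, like r, is elliptic by
-- computation. Conversely, an irreducible non-elliptic element fixes, up to conjugacy, the conic
-- class H − E₁ and acts as a signed permutation of the n − 1 singular fibres. Its order cannot then
-- be h_n, except that n = 6 needs an extra argument: there a fixed line contradicts irreducibility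
-- (`isElliptic_of_orderOf_eq`).
--
-- Elliptic elements of order h_n. Two elements are conjugate as soon as suitable bases have the
-- same Gram matrix and the same pairings with their images (`exists_conj_of_basis`); for a cyclic
-- vector x only the sequence Q(x, w^k x) matters. When n ≤ 7, x is a line. Projecting its orbit to
-- the negative definite K^⊥ gives a positive semidefinite Toeplitz sequence with few possible
-- values, symmetric and of sum zero over a period. A finite search leaves a short list, realized by
-- the Coxeter element except for one sequence that would need too large a rank
-- (`exists_conj_coxeterElement`).
--
-- When n = 8, x comes from a root. The cyclotomic factors of the minimal polynomial leave seven
-- annihilators on K^⊥, and the search discards five. For Φ₃₀ every surviving sequence is realized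
-- by the Coxeter element. For Φ₂Φ₆Φ₁₀ the orbit of a root spans only a sublattice of rank 7; it is
-- completed by a primitive vector z orthogonal to it and a vector v with Q(v, z) = −1.
-- Discriminants leave few possibilities for their pairings, and each leads to r
-- (`exists_orbit_completion`, `exists_conj_r_of_ten`).

local notation "Q" => lorentzForm ℤ _

/-! ### The Lorentzian form -/

theorem lorentzForm_apply {R : Type} [CommRing R] {n : ℕ} (x y : Fin (n + 1) → R) :
    lorentzForm R n x y = x 0 * y 0 - ∑ i : Fin n, x i.succ * y i.succ := rfl

section Ordered

variable {R : Type} [CommRing R] [LinearOrder R] [IsStrictOrderedRing R] {n : ℕ}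

/-- Vectors of positive square are either forward or backward; two forward vectors pair
positively. -/
theorem lorentzForm_pos {x y : Fin (n + 1) → R} (hx : 0 < lorentzForm R n x x) (hx0 : 0 < x 0)
    (hy : 0 < lorentzForm R n y y) (hy0 : 0 < y 0) : 0 < lorentzForm R n x y := by
  rw [lorentzForm_apply] at *
  have cs := Finset.sum_mul_sq_le_sq_mul_sq Finset.univ (fun i : Fin n => x i.succ)
    (fun i : Fin n => y i.succ)
  simp only [← pow_two] at hx hy
  set A := ∑ i : Fin n, x i.succ ^ 2
  set B := ∑ i : Fin n, y i.succ ^ 2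
  have hA : 0 ≤ A := Finset.sum_nonneg fun i _ => sq_nonneg _
  have hB : 0 ≤ B := Finset.sum_nonneg fun i _ => sq_nonneg _
  have h : (∑ i : Fin n, x i.succ * y i.succ) ^ 2 < (x 0 * y 0) ^ 2 := by
    have h1 : A * B ≤ A * y 0 ^ 2 := mul_le_mul_of_nonneg_left (by linarith) hA
    have h2 : A * y 0 ^ 2 < x 0 ^ 2 * y 0 ^ 2 :=
      mul_lt_mul_of_pos_right (by linarith) (by positivity)
    rw [mul_pow]; linarith
  have := lt_of_abs_lt (abs_lt_of_sq_lt_sq h (mul_pos hx0 hy0).le)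
  linarith

/-- The orthogonal complement of a vector of positive square is negative definite. -/
theorem lorentzForm_neg_of_orthogonal {x v : Fin (n + 1) → R} (hv : 0 < lorentzForm R n v v)
    (h : lorentzForm R n x v = 0) (hx : x ≠ 0) : lorentzForm R n x x < 0 := by
  rw [lorentzForm_apply] at *
  have cs := Finset.sum_mul_sq_le_sq_mul_sq Finset.univ (fun i : Fin n => x i.succ)
    (fun i : Fin n => v i.succ)
  simp only [← pow_two] at hv ⊢
  have h' : ∑ i : Fin n, x i.succ * v i.succ = x 0 * v 0 := by linarith
  rw [h', mul_pow] at cs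
  set A := ∑ i : Fin n, x i.succ ^ 2 with hAdef
  set B := ∑ i : Fin n, v i.succ ^ 2
  have hA : 0 ≤ A := Finset.sum_nonneg fun i _ => sq_nonneg _
  have hB : 0 ≤ B := Finset.sum_nonneg fun i _ => sq_nonneg _
  have hv0 : 0 < v 0 ^ 2 := by linarith
  rcases hA.eq_or_lt with h0 | h0
  · exfalso
    apply hx
    rw [← h0, zero_mul] at cs
    have hx0 : x 0 = 0 := by
      by_contra hne
      have : 0 < x 0 ^ 2 := by positivity
      nlinarith
    have hxi : ∀ i : Fin n, x i.succ = 0 := by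
      intro i
      have := (Finset.sum_eq_zero_iff_of_nonneg (fun i _ => sq_nonneg (x (Fin.succ i)))).1
        (hAdef ▸ h0.symm) i (Finset.mem_univ _)
      exact pow_eq_zero_iff (two_ne_zero) |>.1 this
    ext i
    refine Fin.cases hx0 (fun i => hxi i) i
  · have h1 : A * B < A * v 0 ^ 2 := mul_lt_mul_of_pos_left (by linarith) h0
    have h2 : x 0 ^ 2 * v 0 ^ 2 < A * v 0 ^ 2 := by linarith
    have := lt_of_mul_lt_mul_right h2 hv0.le
    linarith

end Ordered

theorem lorentzForm_nonpos_of_orthogonal {n : ℕ} {x v : H₂ n} (hv : 0 < Q v v) (h : Q x v = 0) :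
    Q x x ≤ 0 := by
  by_cases hx : x = 0
  · simp [hx]
  · exact (lorentzForm_neg_of_orthogonal hv h hx).le

/-- A lattice vector in the open forward cone. -/
def IsForward {n : ℕ} (v : H₂ n) : Prop := 0 < Q v v ∧ 0 < v 0

theorem IsForward.pos {n : ℕ} {x y : H₂ n} (hx : IsForward x) (hy : IsForward y) : 0 < Q x y :=
  lorentzForm_pos hx.1 hx.2 hy.1 hy.2

theorem IsForward.of_pos {n : ℕ} {x y : H₂ n} (hx : IsForward x) (hy : 0 < Q y y)
    (h : 0 < Q x y) : IsForward y := by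
  refine ⟨hy, ?_⟩
  by_contra hn
  rcases (not_lt.1 hn).eq_or_lt with h0 | h0
  · rw [lorentzForm_apply, h0] at hy
    have : 0 ≤ ∑ i : Fin n, y i.succ * y i.succ :=
      Finset.sum_nonneg fun i _ => mul_self_nonneg _
    linarith
  · have hy' : IsForward (-y) := ⟨by simpa using hy, by simpa using h0⟩
    have := hx.pos hy'
    rw [map_neg] at this
    linarith

theorem IsForward.add {n : ℕ} {x y : H₂ n} (hx : IsForward x) (hy : IsForward y) :
    IsForward (x + y) := by
  refine ⟨?_, add_pos hx.2 hy.2⟩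
  have h1 := hx.pos hy
  have h2 := hy.pos hx
  have h3 := hx.1
  have h4 := hy.1
  simp only [map_add, LinearMap.add_apply]
  linarith

theorem IsForward.sum {n : ℕ} {ι : Type} (s : Finset ι) (hs : s.Nonempty) {f : ι → H₂ n}
    (hf : ∀ i ∈ s, IsForward (f i)) : IsForward (∑ i ∈ s, f i) := by
  induction hs using Finset.Nonempty.cons_induction with
  | singleton a => simpa using hf a
  | cons a s ha hs ih =>
    rw [Finset.sum_cons]
    exact (hf a (Finset.mem_cons_self _ _)).add
      (ih fun i hi => hf i (Finset.mem_cons_of_mem hi))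

/-! ### The action of the mapping class group -/

theorem smul_def {n : ℕ} (g : ModGroup n) (x : H₂ n) : g • x = (g : H₂ n ≃ₗ[ℤ] H₂ n) x := rfl

theorem lorentzForm_smul_smul {n : ℕ} (g : ModGroup n) (x y : H₂ n) : Q (g • x) (g • y) = Q x y :=
  g.2 x y

theorem lorentzForm_smul_left {n : ℕ} (g : ModGroup n) (x y : H₂ n) :
    Q (g • x) y = Q x (g⁻¹ • y) := by
  rw [← lorentzForm_smul_smul g x, smul_inv_smul]

theorem ModGroup.ext {n : ℕ} {g h : ModGroup n} (e : ∀ x : H₂ n, g • x = h • x) : g = h :=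
  Subtype.ext (LinearEquiv.ext e)

theorem smul_zsmul' {n : ℕ} (g : ModGroup n) (c : ℤ) (x : H₂ n) : g • (c • x) = c • (g • x) :=
  smul_comm g c x

theorem smul_sum' {n : ℕ} {ι : Type} (g : ModGroup n) (s : Finset ι) (f : ι → H₂ n) :
    g • (∑ i ∈ s, f i) = ∑ i ∈ s, g • f i :=
  Finset.smul_sum

theorem realExtension_cast {n : ℕ} (g : H₂ n →ₗ[ℤ] H₂ n) (x : H₂ n) :
    realExtension g (fun i => (x i : ℝ)) = fun i => (g x i : ℝ) := by
  ext i
  have h : g x i = ∑ j, LinearMap.toMatrix' g i j * x j := by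
    conv_lhs => rw [← LinearMap.toMatrix'_mulVec g x]
    rfl
  rw [h]
  simp [realExtension, Matrix.toLin'_apply, Matrix.mulVec, dotProduct]

theorem lorentzForm_realExtension {n : ℕ} (g : ModGroup n) (x y : Fin (n + 1) → ℝ) :
    lorentzForm ℝ n (realExtension (g : H₂ n ≃ₗ[ℤ] H₂ n).toLinearMap x)
      (realExtension (g : H₂ n ≃ₗ[ℤ] H₂ n).toLinearMap y) = lorentzForm ℝ n x y := by
  have key : (lorentzForm ℝ n).compl₁₂ (realExtension (g : H₂ n ≃ₗ[ℤ] H₂ n).toLinearMap)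
      (realExtension (g : H₂ n ≃ₗ[ℤ] H₂ n).toLinearMap) = lorentzForm ℝ n := by
    apply LinearMap.ext_basis (Pi.basisFun ℝ (Fin (n + 1))) (Pi.basisFun ℝ (Fin (n + 1)))
    intro i j
    have hs : ∀ i : Fin (n + 1), (Pi.single i 1 : Fin (n + 1) → ℝ) =
        fun k => (((Pi.single i 1 : H₂ n) k : ℤ) : ℝ) := by
      intro i; ext k; by_cases h : k = i
      · subst h; simp
      · simp [h]
    have hc : ∀ x y : H₂ n, lorentzForm ℝ n (fun i => (x i : ℝ)) (fun i => (y i : ℝ)) =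
        ((lorentzForm ℤ n x y : ℤ) : ℝ) := by
      intro x y; simp [lorentzForm_apply]
    rw [LinearMap.compl₁₂_apply, Pi.basisFun_apply, Pi.basisFun_apply, hs i, hs j,
      realExtension_cast, realExtension_cast, hc, hc]
    exact congrArg _ (g.2 _ _)
  exact congrArg (fun f => f x y) key

theorem IsForward.hyp (n : ℕ) : IsForward (hyp n) := by
  constructor <;> simp [lorentzForm_apply, DelPezzo.hyp]

/-- An isometry moving one forward vector to a forward vector preserves the sheets. -/
theorem mem_modPlus_of_isForward {n : ℕ} {g : ModGroup n} {x : H₂ n} (hx : IsForward x)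
    (hgx : IsForward (g • x)) : g ∈ ModPlus n := by
  have hc : ∀ x : H₂ n, lorentzForm ℝ n (fun i => (x i : ℝ)) (fun i => (x i : ℝ)) =
      ((lorentzForm ℤ n x x : ℤ) : ℝ) := by
    intro x; simp [lorentzForm_apply]
  have step : ∀ (g : ModGroup n) (x : H₂ n), IsForward x → IsForward (g • x) →
      ∀ v, v ∈ upperSheet n →
        realExtension (g : H₂ n ≃ₗ[ℤ] H₂ n).toLinearMap v ∈ upperSheet n := by
    intro g x hx hgx v hv
    have h1 : lorentzForm ℝ n (realExtension (g : H₂ n ≃ₗ[ℤ] H₂ n).toLinearMap v)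
        (realExtension (g : H₂ n ≃ₗ[ℤ] H₂ n).toLinearMap v) = 1 := by
      rw [lorentzForm_realExtension]; exact hv.1
    refine ⟨h1, ?_⟩
    have hx1 : 0 < lorentzForm ℝ n (fun i => (x i : ℝ)) (fun i => (x i : ℝ)) := by
      rw [hc]; exact_mod_cast hx.1
    have hgx1 : 0 < lorentzForm ℝ n (fun i => ((g • x) i : ℝ)) (fun i => ((g • x) i : ℝ)) := by
      rw [hc]; exact_mod_cast hgx.1
    have hp : 0 < lorentzForm ℝ n v (fun i => (x i : ℝ)) :=
      lorentzForm_pos (by rw [hv.1]; exact one_pos) hv.2 hx1 (by exact_mod_cast hx.2)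
    rw [← lorentzForm_realExtension g, realExtension_cast] at hp
    by_contra hn
    rcases (not_lt.1 hn).eq_or_lt with h0 | h0
    · rw [lorentzForm_apply, h0] at h1
      have : 0 ≤ ∑ i : Fin n, (realExtension (g : H₂ n ≃ₗ[ℤ] H₂ n).toLinearMap v) i.succ *
          (realExtension (g : H₂ n ≃ₗ[ℤ] H₂ n).toLinearMap v) i.succ :=
        Finset.sum_nonneg fun i _ => mul_self_nonneg _
      linarith
    · have := lorentzForm_pos (x := -(realExtension (g : H₂ n ≃ₗ[ℤ] H₂ n).toLinearMap v))
        (y := fun i => ((g • x) i : ℝ)) (by simp [h1]) (by simpa using h0) hgx1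
        (by exact_mod_cast hgx.2)
      rw [map_neg, LinearMap.neg_apply] at this
      change 0 < lorentzForm ℝ n _ (fun i => ((g • x) i : ℝ)) at hp
      linarith
  have hinv : ∀ v, realExtension (g : H₂ n ≃ₗ[ℤ] H₂ n).toLinearMap
      (realExtension ((g⁻¹ : ModGroup n) : H₂ n ≃ₗ[ℤ] H₂ n).toLinearMap v) = v := by
    intro v
    have e : realExtension (g : H₂ n ≃ₗ[ℤ] H₂ n).toLinearMap ∘ₗ
        realExtension ((g⁻¹ : ModGroup n) : H₂ n ≃ₗ[ℤ] H₂ n).toLinearMap = LinearMap.id := by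
      rw [← realExtension_comp, ← realExtension_one]
      congr 1
      ext1 i
      exact LinearMap.ext fun y => by simp [LinearMap.comp_apply]
    exact congrArg (fun f => f v) e
  have s1 := step g x hx hgx
  have s2 := step g⁻¹ (g • x) hgx (by rwa [inv_smul_smul])
  have hlow : ∀ v, v ∈ lowerSheet n ↔ -v ∈ upperSheet n := by
    intro v; simp [lowerSheet, upperSheet]
  refine ⟨?_, ?_⟩
  · ext v
    constructor
    · rintro ⟨u, hu, rfl⟩; exact s1 u hu
    · intro hv; exact ⟨_, s2 v hv, hinv v⟩
  · ext v
    constructor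
    · rintro ⟨u, hu, rfl⟩
      rw [hlow] at hu ⊢
      rw [← map_neg]; exact s1 _ hu
    · intro hv
      refine ⟨_, ?_, hinv v⟩
      rw [hlow] at hv ⊢
      rw [← map_neg]; exact s2 _ hv

/-- `ModPlus` is defined by real vectors of square 1, but testing it on H suffices: a positive
pairing with the forward vector g H detects the forward cone. -/
theorem IsForward.smul {n : ℕ} {g : ModGroup n} (hg : g ∈ ModPlus n) {x : H₂ n}
    (hx : IsForward x) : IsForward (g • x) := by
  have hH : IsForward (g • DelPezzo.hyp n) := by
    have h1 : (fun i => ((DelPezzo.hyp n i : ℤ) : ℝ)) ∈ upperSheet n := by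
      constructor <;> simp [lorentzForm_apply, DelPezzo.hyp]
    have h2 : realExtension (g : H₂ n ≃ₗ[ℤ] H₂ n).toLinearMap
        (fun i => ((DelPezzo.hyp n i : ℤ) : ℝ)) ∈ upperSheet n := by
      rw [← hg.1]; exact ⟨_, h1, rfl⟩
    rw [realExtension_cast] at h2
    refine ⟨?_, Int.cast_pos (R := ℝ).1 h2.2⟩
    rw [lorentzForm_smul_smul]; exact (IsForward.hyp n).1
  apply hH.of_pos
  · rw [lorentzForm_smul_smul]; exact hx.1
  · rw [lorentzForm_smul_smul]; exact (IsForward.hyp n).pos hx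

/-! ### Reflections -/

theorem reflection_smul {n : ℕ} (v : H₂ n) (hv : Q v v ∣ 2) (x : H₂ n) :
    reflection v hv • x = x - ((2 / Q v v) * Q x v) • v := by
  rw [smul_def]
  simp only [reflection, Module.reflection_apply]
  simp

theorem reflection_mem_modPlus {n : ℕ} (v : H₂ n) (hv : Q v v ∣ 2) (h : Q v v < 0) :
    reflection v hv ∈ ModPlus n := by
  refine mem_modPlus_of_isForward (IsForward.hyp n) ((IsForward.hyp n).of_pos ?_ ?_)
  · rw [lorentzForm_smul_smul]; exact (IsForward.hyp n).1
  · rw [reflection_smul, map_sub, map_smul, smul_eq_mul]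
    have h1 : Q (hyp n) (hyp n) = 1 := by simp [lorentzForm_apply, hyp]
    have h2 : 2 / Q v v ≤ 0 := Int.ediv_nonpos_of_nonneg_of_nonpos (by norm_num) h.le
    rw [h1]
    nlinarith [sq_nonneg (Q (hyp n) v)]

theorem lorentzForm_exc {n : ℕ} (x : H₂ n) (i : Fin n) : Q x (exc i) = - x i.succ := by
  rw [lorentzForm_apply, Finset.sum_eq_single i]
  · simp [exc]
  · intro j _ hj; simp [exc, hj]
  · simp

theorem lorentzForm_hyp {n : ℕ} (x : H₂ n) : Q x (hyp n) = x 0 := by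
  simp [lorentzForm_apply, hyp]

theorem canonicalClass_zero (n : ℕ) : canonicalClass n 0 = -3 := by
  simp [canonicalClass, hyp, exc]

theorem canonicalClass_succ {n : ℕ} (i : Fin n) : canonicalClass n i.succ = 1 := by
  simp only [canonicalClass, hyp, exc, Pi.add_apply, Pi.smul_apply, Finset.sum_apply]
  rw [Finset.sum_eq_single i]
  · simp
  · intro j _ hj; simp [hj.symm]
  · simp

theorem lorentzForm_canonicalClass {n : ℕ} (x : H₂ n) :
    Q x (canonicalClass n) = -3 * x 0 - ∑ i : Fin n, x i.succ := by
  rw [lorentzForm_apply]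
  simp only [canonicalClass_zero, canonicalClass_succ]
  simp [mul_comm]

theorem canonicalClass_sq (n : ℕ) : Q (canonicalClass n) (canonicalClass n) = 9 - n := by
  rw [lorentzForm_canonicalClass]; simp [canonicalClass_zero, canonicalClass_succ]

theorem isForward_neg_canonicalClass {n : ℕ} (hn : n ≤ 8) : IsForward (-canonicalClass n) := by
  constructor
  · simp only [map_neg, LinearMap.neg_apply, neg_neg, canonicalClass_sq]; lia
  · simp [canonicalClass_zero]

/-- The canonical class is characteristic. -/
theorem even_sq_add_canonicalClass {n : ℕ} (x : H₂ n) : Even (Q x x + Q x (canonicalClass n)) := by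
  rw [lorentzForm_canonicalClass, lorentzForm_apply]
  have h1 : Even (∑ i : Fin n, (x i.succ * x i.succ + x i.succ)) :=
    Finset.even_sum _ fun i _ => by
      have := Int.even_mul_succ_self (x i.succ); rwa [mul_add, mul_one] at this
  have h2 : Even (x 0 * x 0 - 3 * x 0) := by
    have := Int.even_mul_pred_self (x 0)
    have h : x 0 * x 0 - 3 * x 0 = x 0 * (x 0 - 1) - 2 * x 0 := by ring
    rw [h]; exact this.sub (even_two_mul _)
  rw [Finset.sum_add_distrib] at h1
  have h := h2.sub h1
  rw [show x 0 * x 0 - ∑ i : Fin n, x i.succ * x i.succ + (-3 * x 0 - ∑ i : Fin n, x i.succ) =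
    x 0 * x 0 - 3 * x 0 - (∑ i : Fin n, x i.succ * x i.succ + ∑ i : Fin n, x i.succ) by ring]
  exact h

theorem weylGroup_le_modPlus {n : ℕ} (hn : n ≤ 8) : weylGroup n ≤ ModPlus n := by
  intro g hg
  refine mem_modPlus_of_isForward (isForward_neg_canonicalClass hn) ?_
  have : g • (-canonicalClass n) = -canonicalClass n := by rw [smul_neg]; exact congrArg _ hg
  rw [this]; exact isForward_neg_canonicalClass hn

theorem mem_weylGroup {n : ℕ} {g : ModGroup n} :
    g ∈ weylGroup n ↔ g • canonicalClass n = canonicalClass n := Iff.rfl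

theorem lorentzForm_simpleRoot {n : ℕ} (hn : 3 ≤ n) (x : H₂ n) (i : Fin n) :
    Q x (simpleRoot hn i) = if (i : ℕ) = 0 then
      x 0 + x (⟨0, by omega⟩ : Fin n).succ + x (⟨1, by omega⟩ : Fin n).succ +
        x (⟨2, by omega⟩ : Fin n).succ
      else x i.succ - x (⟨(i : ℕ) - 1, by omega⟩ : Fin n).succ := by
  unfold simpleRoot
  split_ifs with h
  · simp only [map_sub, lorentzForm_exc, lorentzForm_hyp]; ring
  · simp only [map_sub, lorentzForm_exc]; ring

theorem simpleRoot_canonicalClass {n : ℕ} (hn : 3 ≤ n) (i : Fin n) :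
    Q (simpleRoot hn i) (canonicalClass n) = 0 := by
  rw [lorentzForm_comm, lorentzForm_simpleRoot]
  split_ifs <;> simp only [canonicalClass_zero, canonicalClass_succ] <;> norm_num

theorem simpleReflection_smul {n : ℕ} (hn : 3 ≤ n) (i : Fin n) (x : H₂ n) :
    simpleReflection hn i • x = x + Q x (simpleRoot hn i) • simpleRoot hn i := by
  rw [simpleReflection, reflection_smul, simpleRoot_sq]
  norm_num [sub_eq_add_neg, ← neg_smul]

theorem simpleReflection_mem_weylGroup {n : ℕ} (hn : 3 ≤ n) (i : Fin n) :
    simpleReflection hn i ∈ weylGroup n := by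
  rw [mem_weylGroup, simpleReflection_smul, lorentzForm_comm, simpleRoot_canonicalClass]
  simp

/-! ### Reduction to the fundamental chamber -/

/-- The pairing with ρ takes positive integer values on the G-orbit of v, so it has a minimum. If g
v paired negatively with such an α, the reflection in α would lower it. -/
theorem exists_minimal_pairing {n : ℕ} {G : Subgroup (ModGroup n)} (hG : G ≤ ModPlus n)
    {v ρ : H₂ n} (hv : IsForward v) (hρ : IsForward ρ) :
    ∃ g ∈ G, ∀ (α : H₂ n) (hα : Q α α ∣ 2), Q α α < 0 → reflection α hα ∈ G → 0 < Q ρ α →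
      0 ≤ Q (g • v) α := by
  have hpos : ∀ g ∈ G, 0 < Q (g • v) ρ := fun g hg => (hv.smul (hG hg)).pos hρ
  let S : Set ℕ := {m | ∃ g ∈ G, Q (g • v) ρ = m}
  have hS : S.Nonempty := ⟨(Q ((1 : ModGroup n) • v) ρ).toNat, 1, G.one_mem, by
    rw [Int.toNat_of_nonneg (hpos 1 G.one_mem).le]⟩
  obtain ⟨g, hg, hm⟩ := Nat.sInf_mem hS
  refine ⟨g, hg, fun α hα hneg hr hρα => ?_⟩
  by_contra hlt
  rw [not_le] at hlt
  have hmem := G.mul_mem hr hg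
  have h2 : (Q ((reflection α hα * g) • v) ρ).toNat ∈ S :=
    ⟨_, hmem, by rw [Int.toNat_of_nonneg (hpos _ hmem).le]⟩
  have h3 := Nat.sInf_le h2
  have h4 : Q ((reflection α hα * g) • v) ρ < Q (g • v) ρ := by
    rw [mul_smul, reflection_smul, LinearMap.map_sub₂, LinearMap.map_smul₂, smul_eq_mul,
      lorentzForm_comm α ρ]
    have h5 : 2 / Q α α < 0 := by
      have := Int.ediv_mul_cancel hα
      by_contra hh
      nlinarith
    have := mul_pos (mul_pos_of_neg_of_neg h5 hlt) hρα
    linarith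
  have := hpos _ hmem
  omega

/-- A vector in the interior of the fundamental chamber. -/
def chamberVector (n : ℕ) : H₂ n := Fin.cons (3 * n + 1) fun i : Fin n => (i : ℤ) - n

theorem isForward_chamberVector {n : ℕ} (hn : n ≤ 8) : IsForward (chamberVector n) := by
  constructor
  · rw [lorentzForm_apply]
    interval_cases n <;> simp [chamberVector, Fin.sum_univ_succ]
  · simp only [chamberVector, Fin.cons_zero]; positivity

theorem chamberVector_simpleRoot {n : ℕ} (hn : 3 ≤ n) (i : Fin n) :
    0 < Q (chamberVector n) (simpleRoot hn i) := by
  rw [lorentzForm_simpleRoot]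
  split_ifs with h
  · simp only [chamberVector, Fin.cons_zero, Fin.cons_succ]; linarith
  · simp only [chamberVector, Fin.cons_succ]; lia

/-- `v` pairs nonnegatively with the simple roots. -/
def IsDominant {n : ℕ} (hn : 3 ≤ n) (v : H₂ n) : Prop := ∀ i, 0 ≤ Q v (simpleRoot hn i)

theorem exists_weylGroup_isDominant {n : ℕ} (hn : 3 ≤ n) (hn8 : n ≤ 8) {v : H₂ n}
    (hv : IsForward v) : ∃ g ∈ weylGroup n, IsDominant hn (g • v) := by
  obtain ⟨g, hg, h⟩ := exists_minimal_pairing (weylGroup_le_modPlus hn8) hv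
    (isForward_chamberVector hn8)
  exact ⟨g, hg, fun i => h _ (by rw [simpleRoot_sq]; norm_num) (by rw [simpleRoot_sq]; norm_num)
    (simpleReflection_mem_weylGroup hn i) (chamberVector_simpleRoot hn i)⟩

/-- With all of Mod⁺ available the chamber acquires the further wall E_n, whose reflection does not
fix K. -/
theorem exists_modPlus_isDominant {n : ℕ} (hn : 3 ≤ n) (hn8 : n ≤ 8) {v : H₂ n}
    (hv : IsForward v) : ∃ g ∈ ModPlus n, IsDominant hn (g • v) ∧
      0 ≤ Q (g • v) (exc (⟨n - 1, by omega⟩ : Fin n)) := by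
  obtain ⟨g, hg, h⟩ := exists_minimal_pairing le_rfl hv (isForward_chamberVector hn8)
  refine ⟨g, hg, fun i => h _ (by rw [simpleRoot_sq]; norm_num) (by rw [simpleRoot_sq]; norm_num)
    (reflection_mem_modPlus _ _ (by rw [simpleRoot_sq]; norm_num))
      (chamberVector_simpleRoot hn i), h _ ?_ ?_ (reflection_mem_modPlus _ _ ?_) ?_⟩
  · rw [lorentzForm_exc_exc]; norm_num
  · rw [lorentzForm_exc_exc]; norm_num
  · rw [lorentzForm_exc_exc]; norm_num
  · rw [lorentzForm_exc]; simp only [chamberVector, Fin.cons_succ]; lia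

theorem IsDominant.antitone {n : ℕ} {hn : 3 ≤ n} {v : H₂ n} (hv : IsDominant hn v) {i j : Fin n}
    (h : i ≤ j) : v i.succ ≤ v j.succ := by
  have step : ∀ (m : ℕ) (h : m + 1 < n),
      v (⟨m, by omega⟩ : Fin n).succ ≤ v (⟨m + 1, h⟩ : Fin n).succ := by
    intro m h
    have := hv ⟨m + 1, h⟩
    rw [lorentzForm_simpleRoot, if_neg (by simp)] at this
    simpa using this
  have aux : ∀ (a b : ℕ) (hab : a ≤ b) (hb : b < n),
      v (⟨a, by omega⟩ : Fin n).succ ≤ v (⟨b, hb⟩ : Fin n).succ := by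
    intro a b hab
    induction b, hab using Nat.le_induction with
    | base => exact fun _ => le_rfl
    | succ b _ ih => exact fun hb => (ih (by omega)).trans (step b hb)
  exact aux i j h j.2

theorem IsDominant.cremona {n : ℕ} {hn : 3 ≤ n} {v : H₂ n} (hv : IsDominant hn v) :
    0 ≤ v 0 + v (⟨0, by omega⟩ : Fin n).succ + v (⟨1, by omega⟩ : Fin n).succ +
        v (⟨2, by omega⟩ : Fin n).succ := by
  have := hv ⟨0, by omega⟩
  rwa [lorentzForm_simpleRoot, if_pos rfl] at this

/-! ### Characteristic vectors of square `9 - n` -/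

/-- The forward characteristic vectors of square `9 - n`. -/
structure IsCharacteristic {n : ℕ} (u : H₂ n) : Prop where
  odd : ∀ i, Odd (u i)
  sq : Q u u = 9 - n
  pos : 0 < u 0

namespace IsCharacteristic

variable {n : ℕ} {u : H₂ n}

/-- An odd coordinate has square at least 1, so the coordinates outside s account for at least n −
|s|. -/
theorem sum_sq_le (hu : IsCharacteristic u) (s : Finset (Fin n)) :
    ∑ i ∈ s, u i.succ ^ 2 ≤ u 0 ^ 2 - 9 + s.card := by
  classical
  have hsq := hu.sq
  rw [lorentzForm_apply] at hsq
  simp only [← pow_two] at hsq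
  have h1 := Finset.sum_add_sum_compl s fun i : Fin n => u i.succ ^ 2
  have h2 : (sᶜ.card : ℤ) ≤ ∑ i ∈ sᶜ, u i.succ ^ 2 := by
    have : ∑ i ∈ sᶜ, (1 : ℤ) ≤ ∑ i ∈ sᶜ, u i.succ ^ 2 := Finset.sum_le_sum fun i _ => by
      have h : u i.succ ≠ 0 := fun h0 => by have := hu.odd i.succ; rw [h0] at this; simp at this
      have : 0 < u i.succ ^ 2 := by positivity
      linarith
    simpa using this
  have h3 : (s.card : ℤ) + sᶜ.card = n := by
    have := Finset.card_add_card_compl s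
    rw [Fintype.card_fin] at this
    exact_mod_cast this
  linarith

theorem three_le (hu : IsCharacteristic u) : 3 ≤ u 0 := by
  have h := hu.sum_sq_le ∅
  simp only [Finset.sum_empty, Finset.card_empty] at h
  have := hu.pos
  push_cast at h
  nlinarith

/-- Cauchy-Schwarz bounds the pairing of u with 3H − ∑_{i ∈ s} Eᵢ below by the pairing of −K with
that class. In the same way `three_le`, `fibre` and `conic` compare u with −K on H, H − Eᵢ and 2H −
Eᵢ − Eⱼ. -/
theorem cubic (hu : IsCharacteristic u) (s : Finset (Fin n)) (hs : s.card ≤ 9) :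
    9 - (s.card : ℤ) ≤ 3 * u 0 + ∑ i ∈ s, u i.succ := by
  have h := hu.sum_sq_le s
  have h3 := hu.three_le
  have cs := sq_sum_le_card_mul_sum_sq (s := s) (f := fun i => u i.succ)
  set S := ∑ i ∈ s, u i.succ
  set T := ∑ i ∈ s, u i.succ ^ 2
  have hc : (s.card : ℤ) ≤ 9 := by exact_mod_cast hs
  set c : ℤ := (s.card : ℤ)
  have hc0 : 0 ≤ c := Int.natCast_nonneg _
  by_contra hlt
  have h4 : 0 ≤ 3 * u 0 - (9 - c) := by linarith
  have h5 : 3 * u 0 - (9 - c) < -S := by linarith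
  have h6 : (3 * u 0 - (9 - c)) ^ 2 < S ^ 2 := by
    have := pow_lt_pow_left₀ h5 h4 two_ne_zero
    rwa [neg_sq] at this
  have h7 := mul_le_mul_of_nonneg_left h hc0
  -- (3u₀ − (9 − c))² − c(u₀² − 9 + c) = (9 − c)(u₀ − 3)².
  nlinarith [mul_nonneg (sub_nonneg.2 hc) (sq_nonneg (u 0 - 3))]

theorem fibre (hu : IsCharacteristic u) (i : Fin n) : 2 ≤ u 0 + u i.succ := by
  have h := hu.sum_sq_le {i}
  simp only [Finset.sum_singleton, Finset.card_singleton] at h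
  have h3 := hu.three_le
  obtain ⟨a, ha⟩ := hu.odd 0
  obtain ⟨b, hb⟩ := hu.odd i.succ
  by_contra hlt
  have : u i.succ ≤ - u 0 := by omega
  push_cast at h
  nlinarith

theorem conic (hu : IsCharacteristic u) {i j : Fin n} (hij : i ≠ j) :
    4 ≤ 2 * u 0 + u i.succ + u j.succ := by
  have h := hu.sum_sq_le {i, j}
  rw [Finset.sum_pair hij, Finset.card_pair hij] at h
  push_cast at h
  have h3 := hu.three_le
  obtain ⟨a, ha⟩ := hu.odd 0
  -- u₀ is odd and at least 3, hence not strictly between 3 and 5.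
  have h5 : 0 ≤ (u 0 - 3) * (u 0 - 5) := by
    rcases (by omega : u 0 = 3 ∨ 5 ≤ u 0) with h0 | h0
    · rw [h0]; norm_num
    · exact mul_nonneg (by linarith) (by linarith)
  by_contra hlt
  have h6 : (2 * u 0 - 4) ^ 2 < (u i.succ + u j.succ) ^ 2 := by
    have := pow_lt_pow_left₀ (by linarith : 2 * u 0 - 4 < -(u i.succ + u j.succ))
      (by linarith) two_ne_zero
    rwa [neg_sq] at this
  nlinarith [sq_nonneg (u i.succ - u j.succ)]

/-- Among the forward characteristic vectors of square `9 - n`, the anticanonical class is the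
only one minimising the pairing with a dominant vector off the last wall. -/
theorem eq_of_pairing_eq (hu : IsCharacteristic u) (hn : 3 ≤ n) (hn8 : n ≤ 8) {v : H₂ n}
    (hv : IsDominant hn v) (hlast : 0 < Q v (exc (⟨n - 1, by omega⟩ : Fin n)))
    (huv : Q u v = Q (-canonicalClass n) v) : u = -canonicalClass n := by
  -- The classes H, H − E₁, 2H − E₁ − E₂, 3H − E₁ − ⋯ − E_m for 3 ≤ m < n, and −K form the basis
  -- dual to the simple roots together with E_n. Expanding v in it makes Q(u + K, v) a nonnegative
  -- combination of the slacks in the bounds on u. Its value is 0 and −K has positive coefficient,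
  -- so the bound for −K is attained.
  have key : 3 * u 0 + ∑ i : Fin n, u i.succ ≤ 9 - n := by
    have h0 := hu.three_le
    have h1 := hu.fibre ⟨0, by omega⟩
    have h2 := hu.conic (i := ⟨0, by omega⟩) (j := ⟨1, by omega⟩)
      (by simp)
    have hT : ∀ m : ℕ, m ≤ n → (9 : ℤ) - m ≤
        3 * u 0 + ∑ i : Fin n, if (i : ℕ) < m then u i.succ else 0 := by
      intro m hm
      have h := hu.cubic (Finset.univ.filter fun i : Fin n => (i : ℕ) < m)
        ((Finset.card_le_univ _).trans (by simp; omega))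
      rwa [Fin.card_filter_val_lt, min_eq_right hm, Finset.sum_filter] at h
    rw [lorentzForm_exc] at hlast
    by_contra hlt
    rw [not_le] at hlt
    have hl := mul_pos hlast (sub_pos.2 hlt)
    simp only [lorentzForm_apply, Pi.neg_apply, canonicalClass_zero, canonicalClass_succ] at huv
    interval_cases n
    · have c0 := mul_nonneg (hv 0) (sub_nonneg.2 h0)
      have c1 := mul_nonneg (hv 1) (sub_nonneg.2 h1)
      have c2 := mul_nonneg (hv 2) (sub_nonneg.2 h2)
      clear hT h0 h1 h2 hv
      simp [lorentzForm_simpleRoot, Fin.sum_univ_succ] at *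
      linarith
    · have c0 := mul_nonneg (hv 0) (sub_nonneg.2 h0)
      have c1 := mul_nonneg (hv 1) (sub_nonneg.2 h1)
      have c2 := mul_nonneg (hv 2) (sub_nonneg.2 h2)
      have c3 := mul_nonneg (hv 3) (sub_nonneg.2 (hT 3 (by norm_num)))
      clear hT h0 h1 h2 hv
      simp [lorentzForm_simpleRoot, Fin.sum_univ_succ] at *
      linarith
    · have c0 := mul_nonneg (hv 0) (sub_nonneg.2 h0)
      have c1 := mul_nonneg (hv 1) (sub_nonneg.2 h1)
      have c2 := mul_nonneg (hv 2) (sub_nonneg.2 h2)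
      have c3 := mul_nonneg (hv 3) (sub_nonneg.2 (hT 3 (by norm_num)))
      have c4 := mul_nonneg (hv 4) (sub_nonneg.2 (hT 4 (by norm_num)))
      clear hT h0 h1 h2 hv
      simp [lorentzForm_simpleRoot, Fin.sum_univ_succ] at *
      linarith
    · have c0 := mul_nonneg (hv 0) (sub_nonneg.2 h0)
      have c1 := mul_nonneg (hv 1) (sub_nonneg.2 h1)
      have c2 := mul_nonneg (hv 2) (sub_nonneg.2 h2)
      have c3 := mul_nonneg (hv 3) (sub_nonneg.2 (hT 3 (by norm_num)))
      have c4 := mul_nonneg (hv 4) (sub_nonneg.2 (hT 4 (by norm_num)))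
      have c5 := mul_nonneg (hv 5) (sub_nonneg.2 (hT 5 (by norm_num)))
      clear hT h0 h1 h2 hv
      simp [lorentzForm_simpleRoot, Fin.sum_univ_succ] at *
      linarith
    · have c0 := mul_nonneg (hv 0) (sub_nonneg.2 h0)
      have c1 := mul_nonneg (hv 1) (sub_nonneg.2 h1)
      have c2 := mul_nonneg (hv 2) (sub_nonneg.2 h2)
      have c3 := mul_nonneg (hv 3) (sub_nonneg.2 (hT 3 (by norm_num)))
      have c4 := mul_nonneg (hv 4) (sub_nonneg.2 (hT 4 (by norm_num)))
      have c5 := mul_nonneg (hv 5) (sub_nonneg.2 (hT 5 (by norm_num)))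
      have c6 := mul_nonneg (hv 6) (sub_nonneg.2 (hT 6 (by norm_num)))
      clear hT h0 h1 h2 hv
      simp [lorentzForm_simpleRoot, Fin.sum_univ_succ] at *
      linarith
    · have c0 := mul_nonneg (hv 0) (sub_nonneg.2 h0)
      have c1 := mul_nonneg (hv 1) (sub_nonneg.2 h1)
      have c2 := mul_nonneg (hv 2) (sub_nonneg.2 h2)
      have c3 := mul_nonneg (hv 3) (sub_nonneg.2 (hT 3 (by norm_num)))
      have c4 := mul_nonneg (hv 4) (sub_nonneg.2 (hT 4 (by norm_num)))
      have c5 := mul_nonneg (hv 5) (sub_nonneg.2 (hT 5 (by norm_num)))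
      have c6 := mul_nonneg (hv 6) (sub_nonneg.2 (hT 6 (by norm_num)))
      have c7 := mul_nonneg (hv 7) (sub_nonneg.2 (hT 7 (by norm_num)))
      clear hT h0 h1 h2 hv
      simp [lorentzForm_simpleRoot, Fin.sum_univ_succ] at *
      linarith
  have hK : 0 < Q (-canonicalClass n) (-canonicalClass n) :=
    (isForward_neg_canonicalClass hn8).1
  by_contra hne
  have h1 : Q u (canonicalClass n) = -(9 - n) := by
    apply le_antisymm
    · have h := hu.cubic Finset.univ (by simp; omega)
      rw [Finset.card_univ, Fintype.card_fin] at h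
      rw [lorentzForm_canonicalClass]; linarith
    · rw [lorentzForm_canonicalClass]; linarith
  -- u + K is orthogonal to K and has square 0.
  have := lorentzForm_neg_of_orthogonal (x := u + canonicalClass n) hK (by
    simp only [map_add, map_neg, LinearMap.add_apply, h1, canonicalClass_sq]; ring)
    (fun h => hne (eq_neg_of_add_eq_zero_left h))
  simp only [map_add, LinearMap.add_apply, h1, canonicalClass_sq, hu.sq,
    lorentzForm_comm (canonicalClass n) u] at this
  linarith

end IsCharacteristic

/-! ### Reducible classes -/

theorem negForm_apply {k : ℕ} (x y : Fin k → ℤ) : negForm k x y = -∑ i, x i * y i := rfl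

theorem sumForm_apply {V W : Type} [AddCommGroup V] [Module ℤ V] [AddCommGroup W] [Module ℤ W]
    (B : LinearMap.BilinForm ℤ V) (C : LinearMap.BilinForm ℤ W) (x y : V × W) :
    sumForm B C x y = B x.1 y.1 + C x.2 y.2 := rfl

theorem negForm_nonpos {k : ℕ} (x : Fin k → ℤ) : negForm k x x ≤ 0 := by
  rw [negForm_apply, neg_nonpos]
  exact Finset.sum_nonneg fun i _ => mul_self_nonneg _

theorem eq_zero_of_negForm_eq_zero {k : ℕ} {x : Fin k → ℤ} (h : negForm k x x = 0) : x = 0 := by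
  rw [negForm_apply, neg_eq_zero] at h
  ext i
  have := (Finset.sum_eq_zero_iff_of_nonneg (fun i _ => mul_self_nonneg (x i))).1 h i
    (Finset.mem_univ _)
  exact mul_self_eq_zero.1 this

section Block

variable {m k : ℕ} {B : LinearMap.BilinForm ℤ (Fin m → ℤ)}

/-- An isometry `T` of `ℤ^m ⊕ ℤ^k` fixing `(v, 0)` preserves the second summand, if `v^⊥ ⊆ ℤ^m` is
negative definite without vectors of square `-1`. -/
theorem fst_eq_zero_of_fixed {v : Fin m → ℤ} (hneg : ∀ x, x ≠ 0 → B x v = 0 → B x x < 0)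
    (hno : ∀ x, B x v = 0 → B x x ≠ -1)
    (T : (sumForm B (negForm k)).IsometryEquiv (sumForm B (negForm k)))
    (hv : T (v, 0) = (v, 0)) (y : Fin k → ℤ) : (T (0, y)).1 = 0 := by
  -- The square −1 of the image is a sum of two nonpositive integers, to which a nonzero first
  -- component would contribute at most −2.
  have hb : ∀ i, (T (0, Pi.single i 1)).1 = 0 := by
    intro i
    have h1 := T.map_app (v, 0) (0, Pi.single i 1)
    have h2 := T.map_app (0, Pi.single i 1) (0, Pi.single i 1)
    rw [hv] at h1
    simp only [sumForm_apply, map_zero, LinearMap.zero_apply, add_zero, zero_add] at h1 h2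
    have h3 : negForm k (Pi.single i 1) (Pi.single i 1) = -1 := by
      simp [negForm_apply, Pi.single_apply]
    rw [h3] at h2
    by_contra hne
    have h4 := hneg _ hne h1
    have h5 := hno _ h1
    have h6 := negForm_nonpos (T (0, Pi.single i 1)).2
    omega
  have h : (LinearMap.fst ℤ (Fin m → ℤ) (Fin k → ℤ)) ∘ₗ T.toLinearEquiv.toLinearMap ∘ₗ
      (LinearMap.inr ℤ (Fin m → ℤ) (Fin k → ℤ)) = 0 := by
    apply LinearMap.pi_ext'
    intro i
    ext
    simpa using congrFun (hb i) _
  exact congrArg (fun f => f y) h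

/-- The inverse isometry preserves the second summand, so y = (T (x, 0)).2 satisfies ⟨y, y⟩ =
⟨T⁻¹(0, y), (x, 0)⟩ = 0. -/
theorem snd_eq_zero_of_fixed {v : Fin m → ℤ} (hneg : ∀ x, x ≠ 0 → B x v = 0 → B x x < 0)
    (hno : ∀ x, B x v = 0 → B x x ≠ -1)
    (T : (sumForm B (negForm k)).IsometryEquiv (sumForm B (negForm k)))
    (hv : T (v, 0) = (v, 0)) (x : Fin m → ℤ) : (T (x, 0)).2 = 0 := by
  have hinv : ∀ z, T (T.symm z) = z := T.toLinearEquiv.apply_symm_apply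
  have hv' : T.symm (v, 0) = (v, 0) := by
    apply T.toLinearEquiv.injective
    exact (hinv _).trans hv.symm
  apply eq_zero_of_negForm_eq_zero
  have h1 := T.map_app (T.symm (0, (T (x, 0)).2)) (x, 0)
  have h2 := fst_eq_zero_of_fixed hneg hno T.symm hv' (T (x, 0)).2
  rw [hinv] at h1
  simp only [sumForm_apply, map_zero, LinearMap.zero_apply, add_zero, zero_add, h2] at h1
  exact h1

end Block

/-- The criterion behind every proof of reducibility below. Transported by ι, g fixes (v, 0), and
the two preceding lemmas make it and its inverse block diagonal. -/
theorem isReducible_of_fixed (M : Manifold) {n k : ℕ} (hk : 0 < k)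
    (ι : (sumForm M.form (negForm k)).IsometryEquiv (lorentzForm ℤ n)) {v : Fin M.b₂ → ℤ}
    (hneg : ∀ x, x ≠ 0 → M.form x v = 0 → M.form x x < 0)
    (hno : ∀ x, M.form x v = 0 → M.form x x ≠ -1) {g : ModGroup n}
    (hg : g • ι (v, 0) = ι (v, 0)) : IsReducible g := by
  let γ : (lorentzForm ℤ n).IsometryEquiv (lorentzForm ℤ n) := ⟨g, g.2⟩
  let T := (ι.trans γ).trans ι.symm
  have hTι : ∀ x, ι (T x) = g • ι x := fun x => ι.toLinearEquiv.apply_symm_apply _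
  have hinv : ∀ z, T (T.symm z) = z := T.toLinearEquiv.apply_symm_apply
  have hinv' : ∀ z, T.symm (T z) = z := T.toLinearEquiv.symm_apply_apply
  have hv : T (v, 0) = (v, 0) := by
    apply ι.toLinearEquiv.injective
    exact (hTι _).trans hg
  have hv' : T.symm (v, 0) = (v, 0) := by
    apply T.toLinearEquiv.injective
    exact (hinv _).trans hv.symm
  have f1 := fst_eq_zero_of_fixed hneg hno T hv
  have f2 := snd_eq_zero_of_fixed hneg hno T hv
  have f1' := fst_eq_zero_of_fixed hneg hno T.symm hv'
  have f2' := snd_eq_zero_of_fixed hneg hno T.symm hv'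
  have e1 : ∀ x, T (x, 0) = ((T (x, 0)).1, 0) := fun x => Prod.ext rfl (f2 x)
  have e2 : ∀ y, T (0, y) = (0, (T (0, y)).2) := fun y => Prod.ext (f1 y) rfl
  have e1' : ∀ x, T.symm (x, 0) = ((T.symm (x, 0)).1, 0) := fun x => Prod.ext rfl (f2' x)
  have e2' : ∀ y, T.symm (0, y) = (0, (T.symm (0, y)).2) := fun y => Prod.ext (f1' y) rfl
  let a : (Fin M.b₂ → ℤ) ≃ₗ[ℤ] (Fin M.b₂ → ℤ) := LinearEquiv.ofLinearMap
    (LinearMap.fst ℤ _ _ ∘ₗ T.toLinearEquiv.toLinearMap ∘ₗ LinearMap.inl ℤ _ _)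
    (LinearMap.fst ℤ _ _ ∘ₗ T.symm.toLinearEquiv.toLinearMap ∘ₗ LinearMap.inl ℤ _ _)
    (LinearMap.ext fun x => by
      change (T ((T.symm (x, 0)).1, 0)).1 = x
      rw [← e1', hinv])
    (LinearMap.ext fun x => by
      change (T.symm ((T (x, 0)).1, 0)).1 = x
      rw [← e1, hinv'])
  let b : (Fin k → ℤ) ≃ₗ[ℤ] (Fin k → ℤ) := LinearEquiv.ofLinearMap
    (LinearMap.snd ℤ _ _ ∘ₗ T.toLinearEquiv.toLinearMap ∘ₗ LinearMap.inr ℤ _ _)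
    (LinearMap.snd ℤ _ _ ∘ₗ T.symm.toLinearEquiv.toLinearMap ∘ₗ LinearMap.inr ℤ _ _)
    (LinearMap.ext fun x => by
      change (T (0, (T.symm (0, x)).2)).2 = x
      rw [← e2', hinv])
    (LinearMap.ext fun x => by
      change (T.symm (0, (T (0, x)).2)).2 = x
      rw [← e2, hinv'])
  refine ⟨M, k, hk, ι, a, ?_, b, ?_, ?_⟩
  · intro x y
    have h := T.map_app (y, 0) (x, 0)
    rw [e1 x, e1 y] at h
    simp only [sumForm_apply, map_zero, add_zero] at h
    exact h
  · intro x y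
    have h := T.map_app (0, y) (0, x)
    rw [e2 x, e2 y] at h
    simp only [sumForm_apply, map_zero, zero_add] at h
    exact h
  · apply LinearEquiv.ext
    intro x
    have h : T (ι.symm x) = a.prodCongr b (ι.symm x) := by
      obtain ⟨p, q⟩ := ι.symm x
      have : ((p, q) : (Fin M.b₂ → ℤ) × (Fin k → ℤ)) = (p, 0) + (0, q) := by simp
      rw [this, map_add, e1, e2, map_add]
      simp only [LinearEquiv.prodCongr_apply, map_zero]
      rfl
    change (g : H₂ n ≃ₗ[ℤ] H₂ n) x = ι (a.prodCongr b (ι.symm x))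
    rw [← h, hTι]
    exact congrArg _ (ι.toLinearEquiv.apply_symm_apply x).symm

/-! ### Standard decompositions -/

/-- The splitting of the last `k` exceptional classes of `M_(j+k)`. -/
def blowupIsometry (j k : ℕ) :
    (sumForm (lorentzForm ℤ j) (negForm k)).IsometryEquiv (lorentzForm ℤ (j + k)) where
  toFun p := Fin.cons (p.1 0) (Fin.append (fun i => p.1 i.succ) p.2)
  map_add' p q := by
    ext i
    refine Fin.cases rfl (fun i => ?_) i
    refine Fin.addCases (fun i => ?_) (fun i => ?_) i <;> simp
  map_smul' c p := by
    ext i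
    refine Fin.cases rfl (fun i => ?_) i
    refine Fin.addCases (fun i => ?_) (fun i => ?_) i <;> simp
  invFun x := (Fin.cons (x 0) fun i => x (Fin.castAdd k i).succ, fun i => x (Fin.natAdd j i).succ)
  left_inv p := by
    refine Prod.ext (funext fun i => ?_) (funext fun i => ?_)
    · refine Fin.cases rfl (fun i => ?_) i; simp
    · simp
  right_inv x := by
    ext i
    refine Fin.cases rfl (fun i => ?_) i
    refine Fin.addCases (fun i => ?_) (fun i => ?_) i <;> simp
  map_app' p q := by
    simp [lorentzForm_apply, sumForm_apply, negForm_apply, Fin.sum_univ_add]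
    ring

/-- The splitting of `H - E₁ - E₂` and of the last `k` exceptional classes of `M_(2+k)`. -/
def quadricIsometry (k : ℕ) :
    (sumForm hyperbolicPlane (negForm (k + 1))).IsometryEquiv (lorentzForm ℤ (2 + k)) where
  -- The isotropic basis of the hyperbolic plane goes to the rulings H − E₁ and H − E₂.
  toFun p := Fin.cons (p.1 0 + p.1 1 + p.2 0)
    (Fin.append ![-p.1 0 - p.2 0, -p.1 1 - p.2 0] (fun i => p.2 i.succ))
  map_add' p q := by
    ext i
    refine Fin.cases ?_ (fun i => ?_) i
    · simp; ring
    refine Fin.addCases (fun i => ?_) (fun i => ?_) i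
    · fin_cases i <;> simp <;> ring
    · simp
  map_smul' c p := by
    ext i
    refine Fin.cases ?_ (fun i => ?_) i
    · simp; ring
    refine Fin.addCases (fun i => ?_) (fun i => ?_) i
    · fin_cases i <;> simp <;> ring
    · simp
  invFun x := (![x 0 + x (Fin.castAdd k (1 : Fin 2)).succ,
      x 0 + x (Fin.castAdd k (0 : Fin 2)).succ],
    Fin.cons (-(x 0 + x (Fin.castAdd k (0 : Fin 2)).succ + x (Fin.castAdd k (1 : Fin 2)).succ))
      fun i => x (Fin.natAdd 2 i).succ)
  left_inv p := by
    refine Prod.ext (funext fun i => ?_) (funext fun i => ?_)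
    · fin_cases i <;> simp [Fin.append_left]
    · refine Fin.cases ?_ (fun i => ?_) i <;> simp [Fin.append_left]
  right_inv x := by
    ext i
    refine Fin.cases ?_ (fun i => ?_) i
    · simp; ring
    refine Fin.addCases (fun i => ?_) (fun i => ?_) i
    · fin_cases i <;> simp
    · simp
  map_app' p q := by
    simp [lorentzForm_apply, sumForm_apply, negForm_apply, Fin.sum_univ_add, hyperbolicPlane,
      Fin.sum_univ_succ]
    ring

/-! ### Vectors on the last wall -/

/-- The reflection in a class f of square −1 orthogonal to v would fix v and send −K to a forward
characteristic vector of square 9 − j with the same pairing with v. By uniqueness it fixes K, so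
Q(f, K) = 0, whereas Q(f, f) + Q(f, K) is even. -/
theorem sq_ne_neg_one_of_orthogonal {j : ℕ} (hj : 3 ≤ j) (hj8 : j ≤ 8) {v : H₂ j}
    (hv : IsForward v) (hd : IsDominant hj v)
    (hlast : 0 < Q v (exc (⟨j - 1, by omega⟩ : Fin j))) (f : H₂ j) (hf : Q f v = 0) :
    Q f f ≠ -1 := by
  intro hff
  set K := canonicalClass j with hK
  have huv : Q (-K - (2 * Q f K) • f) v = Q (-K) v := by
    rw [LinearMap.map_sub₂, LinearMap.map_smul₂, hf, smul_zero, sub_zero]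
  have hsq : Q (-K - (2 * Q f K) • f) (-K - (2 * Q f K) • f) = 9 - j := by
    simp only [map_sub, map_neg, map_smul, LinearMap.sub_apply, LinearMap.neg_apply,
      LinearMap.smul_apply, smul_eq_mul, hff, lorentzForm_comm K f]
    rw [hK, canonicalClass_sq]; ring
  have hpos : IsForward (-K - (2 * Q f K) • f) := by
    apply hv.of_pos
    · rw [hsq]; omega
    · rw [lorentzForm_comm, huv]; exact (isForward_neg_canonicalClass hj8).pos hv
  have hodd : ∀ i, Odd ((-K - (2 * Q f K) • f) i) := by
    intro i
    simp only [Pi.sub_apply, Pi.neg_apply, Pi.smul_apply, smul_eq_mul, mul_assoc]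
    refine Odd.sub_even ?_ (even_two_mul _)
    refine Fin.cases ?_ (fun i => ?_) i
    · rw [hK, canonicalClass_zero]; decide
    · rw [hK, canonicalClass_succ]; decide
  have h := IsCharacteristic.eq_of_pairing_eq ⟨hodd, hsq, hpos.2⟩ hj hj8 hd hlast huv
  have h0 : Q f K = 0 := by
    have h1 := congrArg (fun x => Q x f) h
    simp only [map_sub, LinearMap.sub_apply, map_smul, LinearMap.smul_apply, hff, smul_eq_mul] at h1
    linarith
  have := even_sq_add_canonicalClass f
  rw [hff, ← hK, h0] at this
  exact absurd this (by decide)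

/-- The Eᵢ-coefficients of v increase to 0, so v comes from M_j, where j counts the nonzero ones.
There v' has no orthogonal class of square −1: by the preceding lemma for j ≥ 3, and by hand for j ≤
2, with one exception at j = 2 in which the quadric takes the place of M₂. -/
theorem isReducible_of_isDominant {n : ℕ} (hn : 3 ≤ n) (hn8 : n ≤ 8) {v : H₂ n}
    (hv : IsForward v) (hd : IsDominant hn v)
    (hlast : Q v (exc (⟨n - 1, by omega⟩ : Fin n)) = 0) {g : ModGroup n} (hg : g • v = v) :
    IsReducible g := by
  rw [lorentzForm_exc, neg_eq_zero] at hlast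
  have hle : ∀ i : Fin n, v i.succ ≤ 0 := fun i =>
    hlast ▸ hd.antitone (i := i) (j := ⟨n - 1, by omega⟩) (by rw [Fin.le_def]; simp; omega)
  obtain ⟨j, hjn, hj⟩ : ∃ j < n, ∀ i : Fin n, v i.succ < 0 ↔ (i : ℕ) < j := by
    have hex : ∃ j, ∃ h : j < n, v (⟨j, h⟩ : Fin n).succ = 0 := ⟨n - 1, by omega, hlast⟩
    classical
    obtain ⟨hjn, hj0⟩ := Nat.find_spec hex
    refine ⟨Nat.find hex, hjn, fun i => ⟨fun h => ?_, fun h => ?_⟩⟩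
    · by_contra hlt
      have := hd.antitone (i := ⟨_, hjn⟩) (j := i) (not_lt.1 hlt)
      omega
    · have := Nat.find_min hex h
      have h2 : v i.succ ≠ 0 := fun h0 => this ⟨i.2, h0⟩
      exact lt_of_le_of_ne (hle i) h2
  obtain ⟨k, rfl⟩ := Nat.exists_eq_add_of_le hjn.le
  have hk : 0 < k := by omega
  have hz : ∀ i : Fin k, v (Fin.natAdd j i).succ = 0 := by
    intro i
    have h1 := hle (Fin.natAdd j i)
    have h2 := mt (hj (Fin.natAdd j i)).1 (by simp)
    omega
  set v' : H₂ j := ((blowupIsometry j k).symm v).1 with hv'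
  have hv'0 : v' 0 = v 0 := rfl
  have hv'i : ∀ i : Fin j, v' i.succ = v (Fin.castAdd k i).succ := fun i => rfl
  have hι : blowupIsometry j k (v', 0) = v := by
    have : (v', 0) = (blowupIsometry j k).symm v := Prod.ext rfl (funext fun i => (hz i).symm)
    rw [this]; exact (blowupIsometry j k).toLinearEquiv.apply_symm_apply v
  have hfwd : IsForward v' := by
    refine ⟨?_, hv.2⟩
    have h1 := (blowupIsometry j k).map_app (v', 0) (v', 0)
    rw [hι, sumForm_apply] at h1
    simp only [map_zero, add_zero] at h1
    rw [← h1]; exact hv.1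
  have hneg : ∀ x, x ≠ 0 → Q x v' = 0 → Q x x < 0 := fun x hx h =>
    lorentzForm_neg_of_orthogonal hfwd.1 h hx
  have main : (∀ x, Q x v' = 0 → Q x x ≠ -1) → IsReducible g := fun hno =>
    isReducible_of_fixed (.blowup j (by omega)) hk (blowupIsometry j k) (v := v') hneg hno
      (by
        change g • (blowupIsometry j k) (v', 0) = (blowupIsometry j k) (v', 0)
        rw [hι]; exact hg)
  have hv'neg : ∀ i : Fin j, v' i.succ < 0 := fun i => (hj (Fin.castAdd k i)).2 i.2
  rcases (by omega : 3 ≤ j ∨ j = 0 ∨ j = 1 ∨ j = 2) with h3 | rfl | rfl | rfl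
  · refine main (sq_ne_neg_one_of_orthogonal h3 (by omega) hfwd ?_ ?_)
    · intro i
      have := hd (Fin.castAdd k i)
      rw [lorentzForm_simpleRoot] at this ⊢
      exact this
    · rw [lorentzForm_exc]
      have := hv'neg ⟨j - 1, by omega⟩
      linarith
  · refine main fun x _ h => ?_
    simp only [lorentzForm_apply, Finset.univ_eq_empty, Finset.sum_empty] at h
    nlinarith [mul_self_nonneg (x 0)]
  · refine main fun x h1 h2 => ?_
    have hn1 := hv'neg 0
    have hp := hfwd.2
    simp only [lorentzForm_apply, Fin.sum_univ_one] at h1 h2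
    have h3 : (x 1 - x 0) * (x 1 + x 0) = 1 := by
      have : x (Fin.succ 0) = x 1 := rfl
      rw [this] at h2; linear_combination -h2
    have h4 : x (Fin.succ 0) = x 1 := rfl
    rcases Int.mul_eq_one_iff_eq_one_or_neg_one.1 h3 with ⟨h5, h6⟩ | ⟨h5, h6⟩
    · have hx : x 0 = 0 := by omega
      have hx1 : x 1 = 1 := by omega
      rw [h4, hx, hx1] at h1; omega
    · have hx : x 0 = 0 := by omega
      have hx1 : x 1 = -1 := by omega
      rw [h4, hx, hx1] at h1; omega
  · have ha := hv'neg 0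
    have hb := hv'neg 1
    have hc : 0 ≤ v' 0 + v' (Fin.succ 0) + v' (Fin.succ 1) := by
      have h1 := hd.cremona
      have h2 := hz ⟨0, hk⟩
      have h3 : v (⟨2, by omega⟩ : Fin (2 + k)).succ = 0 := h2
      have h4 : v' (Fin.succ 0) = v (⟨0, by omega⟩ : Fin (2 + k)).succ := rfl
      have h5 : v' (Fin.succ 1) = v (⟨1, by omega⟩ : Fin (2 + k)).succ := rfl
      rw [h4, h5, hv'0]
      linarith
    -- Equality means that v is orthogonal to H − E₁ − E₂. It then lives on the quadric, whose form
    -- is even.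
    rcases hc.eq_or_lt with hc | hc
    · set p := ((quadricIsometry k).symm v).1 with hp
      have hp0 : p 0 = -v' (Fin.succ 0) := by
        have : p 0 = v' 0 + v' (Fin.succ 1) := rfl
        omega
      have hp1 : p 1 = -v' (Fin.succ 1) := by
        have : p 1 = v' 0 + v' (Fin.succ 0) := rfl
        omega
      have hιp : quadricIsometry k (p, 0) = v := by
        have : (p, 0) = (quadricIsometry k).symm v := by
          refine Prod.ext rfl (funext fun i => ?_)
          refine Fin.cases ?_ (fun i => (hz i).symm) i
          have : ((quadricIsometry k).symm v).2 0 =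
            -(v' 0 + v' (Fin.succ 0) + v' (Fin.succ 1)) := rfl
          rw [this, ← hc]; rfl
        rw [this]; exact (quadricIsometry k).toLinearEquiv.apply_symm_apply v
      have hform : ∀ x y, hyperbolicPlane x y = x 0 * y 1 + x 1 * y 0 := fun _ _ => rfl
      refine isReducible_of_fixed .quadric (Nat.succ_pos k) (quadricIsometry k) (v := p) ?_ ?_
        (by
          change g • (quadricIsometry k) (p, 0) = (quadricIsometry k) (p, 0)
          rw [hιp]; exact hg)
      · intro (x : Fin 2 → ℤ) hx h
        change hyperbolicPlane x p = 0 at h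
        change hyperbolicPlane x x < 0
        rw [hform x p] at h
        rw [hform x x]
        have hpa : 0 < p 0 := by omega
        have hpb : 0 < p 1 := by omega
        by_contra hge
        have hge' : 0 ≤ x 0 * x 1 := by linarith [mul_comm (x 0) (x 1)]
        have h0 : x 0 = 0 := by
          have : x 0 * x 0 * p 1 + (x 0 * x 1) * p 0 = 0 := by linear_combination x 0 * h
          have h1 := mul_nonneg hge' hpa.le
          have h2 := mul_nonneg (mul_self_nonneg (x 0)) hpb.le
          have h3 : x 0 * x 0 * p 1 = 0 := by linarith
          simpa [hpb.ne'] using h3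
        have h1 : x 1 = 0 := by
          rw [h0] at h
          simpa [hpa.ne'] using h
        apply hx
        ext i
        match i with
        | 0 => exact h0
        | 1 => exact h1
      · intro (x : Fin 2 → ℤ) _ h
        change hyperbolicPlane x x = -1 at h
        rw [hform x x, mul_comm (x 1)] at h
        omega
    · refine main fun x h1 h2 => ?_
      simp only [lorentzForm_apply, Fin.sum_univ_two] at h1 h2
      generalize x 0 = s at h1 h2
      generalize x (Fin.succ 0) = t at h1 h2
      generalize x (Fin.succ 1) = u at h1 h2
      generalize v' 0 = d at *
      generalize v' (Fin.succ 0) = a at *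
      generalize v' (Fin.succ 1) = b at *
      -- Here sd = ta + ub, s² + 1 = t² + u² and d > −a − b. If |t| and |u| are at most |s|, then
      -- |s|d ≤ |s|(−a − b) forces s = 0. If one exceeds |s|, the other and s vanish, and the linear
      -- equation fails because a, b < 0.
      by_cases ht : |t| ≤ |s|
      · by_cases hu : |u| ≤ |s|
        · have h3 : |s| * d ≤ |s| * (-a - b) := by
            have e1 : t * a ≤ |s| * (-a) := by
              calc t * a = (-t) * (-a) := by ring
                _ ≤ |s| * (-a) := by gcongr <;> [omega; exact (neg_le_abs t).trans ht]
            have e2 : u * b ≤ |s| * (-b) := by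
              calc u * b = (-u) * (-b) := by ring
                _ ≤ |s| * (-b) := by gcongr <;> [omega; exact (neg_le_abs u).trans hu]
            have e1' : -(t * a) ≤ |s| * (-a) := by
              calc -(t * a) = t * (-a) := by ring
                _ ≤ |s| * (-a) := by gcongr <;> [omega; exact (le_abs_self t).trans ht]
            have e2' : -(u * b) ≤ |s| * (-b) := by
              calc -(u * b) = u * (-b) := by ring
                _ ≤ |s| * (-b) := by gcongr <;> [omega; exact (le_abs_self u).trans hu]
            rcases abs_choice s with h | h
            · have e : s * d = |s| * d := by rw [h]
              linarith
            · have e : s * d = -(|s| * d) := by rw [h]; ring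
              linarith
          have h4 : |s| = 0 := by
            have := abs_nonneg s
            nlinarith
          have h5 : t = 0 := abs_eq_zero.1 (le_antisymm (h4 ▸ ht) (abs_nonneg _))
          have h6 : u = 0 := abs_eq_zero.1 (le_antisymm (h4 ▸ hu) (abs_nonneg _))
          have h7 : s = 0 := abs_eq_zero.1 h4
          subst h5 h6 h7
          simp at h2
        · have h3 : s * s + 2 * |s| + 1 ≤ u * u := by
            rw [← abs_mul_abs_self s, ← abs_mul_abs_self u]
            nlinarith [abs_nonneg s]
          have h4 : |s| = 0 := by nlinarith [abs_nonneg s, mul_self_nonneg t]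
          have h5 : t = 0 := by nlinarith [abs_nonneg s, mul_self_nonneg t]
          have h6 : s = 0 := abs_eq_zero.1 h4
          subst h5 h6
          have : u = 0 := by
            have : u * b = 0 := by linarith
            exact (mul_eq_zero.1 this).resolve_right hb.ne
          subst this
          simp at h2
      · have h3 : s * s + 2 * |s| + 1 ≤ t * t := by
          rw [← abs_mul_abs_self s, ← abs_mul_abs_self t]
          nlinarith [abs_nonneg s]
        have h4 : |s| = 0 := by nlinarith [abs_nonneg s, mul_self_nonneg u]
        have h5 : u = 0 := by nlinarith [abs_nonneg s, mul_self_nonneg u]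
        have h6 : s = 0 := abs_eq_zero.1 h4
        subst h5 h6
        have : t = 0 := by
          have : t * a = 0 := by linarith
          exact (mul_eq_zero.1 this).resolve_right ha.ne
        subst this
        simp at h2

theorem IsReducible.conj {n : ℕ} {w : ModGroup n} (h : IsReducible w) (g : ModGroup n) :
    IsReducible (g * w * g⁻¹) := by
  obtain ⟨M, k, hk, ι, a, ha, b, hb, hw⟩ := h
  let γ : (lorentzForm ℤ n).IsometryEquiv (lorentzForm ℤ n) := ⟨g, g.2⟩
  refine ⟨M, k, hk, ι.trans γ, a, ha, b, hb, ?_⟩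
  change (g : H₂ n ≃ₗ[ℤ] H₂ n) * w * (g : H₂ n ≃ₗ[ℤ] H₂ n)⁻¹ = _
  rw [hw]
  rfl

theorem isReducible_conj_iff {n : ℕ} {w : ModGroup n} (g : ModGroup n) :
    IsReducible (g * w * g⁻¹) ↔ IsReducible w := by
  refine ⟨fun h => ?_, fun h => h.conj g⟩
  simpa [mul_assoc] using h.conj g⁻¹

theorem IsIrreducible.conj {n : ℕ} {w : ModGroup n} (h : IsIrreducible w) (g : ModGroup n) :
    IsIrreducible (g * w * g⁻¹) := fun h' => h ((isReducible_conj_iff g).1 h')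

theorem conj_smul_smul {n : ℕ} (g w : ModGroup n) (v : H₂ n) :
    (g * w * g⁻¹) • g • v = g • w • v := by
  rw [mul_smul, mul_smul, inv_smul_smul]

/-- A mapping class fixing a forward vector `v` and a class of square `-1` orthogonal to `v` to
itself is reducible. -/
theorem isReducible_of_orthogonal {n : ℕ} (hn : 3 ≤ n) (hn8 : n ≤ 8) {v f : H₂ n}
    (hv : IsForward v) (hf : Q f f = -1) (hfv : Q f v = 0) {w : ModGroup n} (hw : w • v = v) :
    IsReducible w := by
  obtain ⟨g, hg, hd, hl⟩ := exists_modPlus_isDominant hn hn8 hv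
  have hgw : (g * w * g⁻¹) • g • v = g • v := by rw [conj_smul_smul, hw]
  rcases hl.eq_or_lt with h | h
  · exact (isReducible_conj_iff g).1
      (isReducible_of_isDominant hn hn8 (hv.smul hg) hd h.symm hgw)
  · exact absurd (by rw [lorentzForm_smul_smul, hf])
      (sq_ne_neg_one_of_orthogonal hn hn8 (hv.smul hg) hd h (g • f)
        (by rw [lorentzForm_smul_smul, hfv]))

/-- The forward cone is closed under sums and stable under Mod⁺, so the sum over the orbit of H will
do. -/
theorem exists_isForward_fixed {n : ℕ} {w : ModGroup n} (hw : w ∈ ModPlus n)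
    (hfin : IsOfFinOrder w) : ∃ v : H₂ n, IsForward v ∧ w • v = v := by
  have hN := hfin.orderOf_pos
  refine ⟨∑ k ∈ Finset.range (orderOf w), w ^ k • (hyp n : H₂ n), ?_, ?_⟩
  · exact IsForward.sum _ (Finset.nonempty_range_iff.2 hN.ne') fun k _ =>
      (IsForward.hyp n).smul (pow_mem hw k)
  · rw [smul_sum']
    simp only [smul_smul, ← pow_succ']
    have h1 := Finset.sum_range_succ (fun k => w ^ k • (hyp n : H₂ n)) (orderOf w)
    rw [Finset.sum_range_succ', pow_orderOf_eq_one, pow_zero] at h1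
    exact add_right_cancel h1

/-- An irreducible mapping class of finite order is conjugate into the Weyl group. -/
theorem exists_conj_mem_weylGroup {n : ℕ} (hn : 3 ≤ n) (hn8 : n ≤ 8) {w : ModGroup n}
    (hw : w ∈ ModPlus n) (hfin : IsOfFinOrder w) (hirr : IsIrreducible w) :
    ∃ g ∈ ModPlus n, g * w * g⁻¹ ∈ weylGroup n := by
  obtain ⟨v, hv, hwv⟩ := exists_isForward_fixed hw hfin
  obtain ⟨g, hg, hd, hl⟩ := exists_modPlus_isDominant hn hn8 hv
  have hgw : (g * w * g⁻¹) • g • v = g • v := by rw [conj_smul_smul, hwv]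
  rcases hl.eq_or_lt with h | h
  · exact absurd ((isReducible_conj_iff g).1
      (isReducible_of_isDominant hn hn8 (hv.smul hg) hd h.symm hgw)) hirr
  · refine ⟨g, hg, mem_weylGroup.2 ?_⟩
    set c := g * w * g⁻¹ with hc
    have hcm : c ∈ ModPlus n := mul_mem (mul_mem hg hw) (inv_mem hg)
    have hfwd := (isForward_neg_canonicalClass hn8).smul hcm
    -- Being characteristic is invariant under isometries, so c(−K) has odd coordinates. It also has
    -- square 9 − n and, as c fixes g v, the same pairing with g v as −K.
    have hodd' : ∀ b, Odd (Q b b) → Odd (Q (c • -canonicalClass n) b) := by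
      intro b hb
      have h1 := even_sq_add_canonicalClass (c⁻¹ • b)
      rw [lorentzForm_smul_smul] at h1
      rw [lorentzForm_smul_left, map_neg, LinearMap.neg_apply, lorentzForm_comm, odd_neg]
      exact (Int.even_add'.1 h1).1 hb
    have hodd : ∀ i, Odd ((c • -canonicalClass n) i) := by
      intro i
      refine Fin.cases ?_ (fun i => ?_) i
      · rw [← lorentzForm_hyp (c • -canonicalClass n)]
        exact hodd' _ (by rw [lorentzForm_hyp]; simp [hyp])
      · have := hodd' (exc i) (by rw [lorentzForm_exc_exc]; simp)
        rwa [lorentzForm_exc, odd_neg] at this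
    have h1 := IsCharacteristic.eq_of_pairing_eq ⟨hodd, by
      rw [lorentzForm_smul_smul]; simp [canonicalClass_sq], hfwd.2⟩ hn hn8 hd h (by
        conv_lhs => rw [← hgw]
        rw [lorentzForm_smul_smul])
    rw [smul_neg] at h1
    exact neg_injective h1

/-! ### Elliptic elements of the Weyl group -/

/-- An element of the mapping class group without nonzero fixed vector orthogonal to `K`. -/
def IsElliptic {n : ℕ} (c : ModGroup n) : Prop :=
  ∀ x : H₂ n, c • x = x → Q x (canonicalClass n) = 0 → x = 0

/-- The vector (9 − n)x − Q(x, K)K lies in K^⊥ and is fixed as well. -/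
theorem IsElliptic.fixed {n : ℕ} {c : ModGroup n} (hc : IsElliptic c) (hK : c ∈ weylGroup n)
    {x : H₂ n} (hx : c • x = x) :
    ((9 : ℤ) - n) • x = Q x (canonicalClass n) • canonicalClass n := by
  rw [← sub_eq_zero]
  refine hc _ ?_ ?_
  · rw [smul_sub, smul_zsmul', smul_zsmul', hx, mem_weylGroup.1 hK]
  · rw [LinearMap.map_sub₂, LinearMap.map_smul₂, LinearMap.map_smul₂, canonicalClass_sq]
    simp only [smul_eq_mul]
    ring

/-- Suppose c preserves a summand k⟨−1⟩ with basis vector e₁. The orbit sum of e₁ is fixed, hence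
rationally a multiple of K, and its square is at most 0, so it vanishes. Since Q(e₁, e₁) = −1, some
c^j e₁ pairs positively with e₁; being a vector of square −1 in k⟨−1⟩ it equals −e₁. As c fixes K,
Q(e₁, K) = 0, against the parity of Q(e₁, e₁) + Q(e₁, K). -/
theorem IsElliptic.isIrreducible {n : ℕ} (hn8 : n ≤ 8) {c : ModGroup n} (hc : IsElliptic c)
    (hK : c ∈ weylGroup n) (hfin : IsOfFinOrder c) : IsIrreducible c := by
  rintro ⟨M, k, hk, ι, a, ha, b, hb, hcab⟩
  set f : (Fin k → ℤ) →ₗ[ℤ] H₂ n := ι.toLinearEquiv.toLinearMap ∘ₗ LinearMap.inr ℤ _ _ with hf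
  have hQ : ∀ x y, Q (f x) (f y) = negForm k x y := by
    intro x y
    have := ι.map_app (0, y) (0, x)
    simp only [sumForm_apply, map_zero, zero_add] at this
    exact this
  have hcf : ∀ x, c • f x = f (b x) := by
    intro x
    rw [smul_def, hcab]
    change ι (a.prodCongr b (ι.symm (ι (0, x)))) = ι (0, b x)
    have : ι.symm (ι (0, x)) = (0, x) := ι.toLinearEquiv.symm_apply_apply _
    rw [this, LinearEquiv.prodCongr_apply, map_zero]
  have hcpow : ∀ (j : ℕ) x, c ^ j • f x = f ((b ^ j) x) := by
    intro j
    induction j with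
    | zero => intro x; simp
    | succ j ih => intro x; rw [pow_succ, mul_smul, hcf, ih, pow_succ]; rfl
  set e₁ : Fin k → ℤ := Pi.single ⟨0, hk⟩ 1 with he₁
  set N := orderOf c with hN
  have hNpos : 0 < N := hfin.orderOf_pos
  set S := ∑ j ∈ Finset.range N, c ^ j • f e₁ with hS
  have hcS : c • S = S := by
    rw [hS, smul_sum']
    simp only [smul_smul, ← pow_succ']
    have h1 := Finset.sum_range_succ (fun k => c ^ k • f e₁) N
    rw [Finset.sum_range_succ', hN, pow_orderOf_eq_one, pow_zero, ← hN] at h1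
    exact add_right_cancel h1
  have hSS : Q S S ≤ 0 := by
    have : S = f (∑ j ∈ Finset.range N, (b ^ j) e₁) := by
      rw [map_sum]; exact Finset.sum_congr rfl fun j _ => hcpow j e₁
    rw [this, hQ]
    exact negForm_nonpos _
  have hd : (0 : ℤ) < 9 - n := by omega
  have hS0 : S = 0 := by
    have h1 := hc.fixed hK hcS
    set m := Q S (canonicalClass n) with hm
    have h2 : Q (((9 : ℤ) - n) • S) (((9 : ℤ) - n) • S) = m * m * (9 - n) := by
      rw [h1, LinearMap.map_smul₂, map_smul, canonicalClass_sq]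
      simp only [smul_eq_mul]
      ring
    simp only [map_smul, LinearMap.smul_apply, smul_eq_mul] at h2
    have h3 : m = 0 := by
      have : m * m * (9 - n) ≤ 0 := by
        rw [← h2, ← mul_assoc]
        exact mul_nonpos_of_nonneg_of_nonpos (mul_self_nonneg _) hSS
      have h4 : m * m ≤ 0 := nonpos_of_mul_nonpos_left this hd
      exact mul_self_eq_zero.1 (le_antisymm h4 (mul_self_nonneg _))
    rw [h3, zero_smul] at h1
    exact (smul_eq_zero.1 h1).resolve_left hd.ne'
  have hQ0 : ∑ j ∈ Finset.range N, Q (c ^ j • f e₁) (f e₁) = 0 := by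
    rw [← LinearMap.sum_apply, ← map_sum, ← hS, hS0, map_zero, LinearMap.zero_apply]
  have hee : Q (f e₁) (f e₁) = -1 := by
    rw [hQ, negForm_apply]; simp [he₁, Pi.single_apply]
  obtain ⟨j, hj⟩ : ∃ j, 0 < Q (c ^ j • f e₁) (f e₁) := by
    by_contra! hle
    obtain ⟨N', hN'⟩ := Nat.exists_eq_succ_of_ne_zero hNpos.ne'
    rw [hN', Finset.sum_range_succ', pow_zero, one_smul, hee] at hQ0
    have := Finset.sum_nonpos fun j (_ : j ∈ Finset.range N') => hle (j + 1)
    omega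
  set y := (b ^ j) e₁ with hy
  have hjy : c ^ j • f e₁ = f y := hcpow j e₁
  have hyy : ∑ i, y i * y i = 1 := by
    have h1 : Q (f y) (f y) = -1 := by rw [← hjy, lorentzForm_smul_smul, hee]
    rw [hQ, negForm_apply] at h1
    omega
  have hy0 : y ⟨0, hk⟩ < 0 := by
    rw [hjy, hQ, negForm_apply] at hj
    simp [he₁, Pi.single_apply] at hj
    exact hj
  have hye : y = -e₁ := by
    have hs := Finset.add_sum_erase Finset.univ (fun i => y i * y i)
      (Finset.mem_univ (⟨0, hk⟩ : Fin k))
    have hr : 0 ≤ ∑ i ∈ Finset.univ.erase (⟨0, hk⟩ : Fin k), y i * y i :=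
      Finset.sum_nonneg fun i _ => mul_self_nonneg _
    simp only [hyy] at hs
    have h1 : y ⟨0, hk⟩ = -1 := by nlinarith
    rw [h1] at hs
    have h2 := (Finset.sum_eq_zero_iff_of_nonneg fun i _ => mul_self_nonneg (y i)).1
      (by linarith : ∑ i ∈ Finset.univ.erase (⟨0, hk⟩ : Fin k), y i * y i = 0)
    ext i
    by_cases hi : i = ⟨0, hk⟩
    · rw [hi, h1]; simp [he₁]
    · have := h2 i (Finset.mem_erase.2 ⟨hi, Finset.mem_univ _⟩)
      rw [mul_self_eq_zero.1 this]; simp [he₁, hi]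
  have hK0 : Q (f e₁) (canonicalClass n) = 0 := by
    have h1 := lorentzForm_smul_smul (c ^ j) (f e₁) (canonicalClass n)
    rw [mem_weylGroup.1 (pow_mem hK j), hjy, hye, map_neg, map_neg, LinearMap.neg_apply] at h1
    linarith
  have := even_sq_add_canonicalClass (f e₁)
  rw [hK0, hee] at this
  exact absurd this (by decide)

/-! ### Conjugacy of the Coxeter elements -/

/-- Words that are related by rotations and by exchanges of adjacent commuting letters. -/
inductive WordRel {ι G : Type} [Group G] (s : ι → G) : List ι → List ι → Prop
  | refl (l) : WordRel s l l
  | symm {l m} : WordRel s l m → WordRel s m l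
  | trans {l m k} : WordRel s l m → WordRel s m k → WordRel s l k
  | swap (l : List ι) (i j : ι) (m : List ι) : Commute (s i) (s j) →
      WordRel s (l ++ i :: j :: m) (l ++ j :: i :: m)
  | rotate (i : ι) (l : List ι) : WordRel s (i :: l) (l ++ [i])

section Words

variable {ι G : Type} [Group G] {s : ι → G}

theorem WordRel.perm {l m : List ι} (h : WordRel s l m) : l.Perm m := by
  induction h with
  | refl l => exact List.Perm.refl l
  | symm _ ih => exact ih.symm
  | trans _ _ ih ih' => exact ih.trans ih'
  | swap l i j m _ => exact (List.Perm.swap j i m).append_left l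
  | rotate i l => exact (List.perm_append_singleton i l).symm

theorem WordRel.isConj {l m : List ι} (h : WordRel s l m) :
    IsConj (l.map s).prod (m.map s).prod := by
  induction h with
  | refl l => exact IsConj.refl _
  | symm _ ih => exact ih.symm
  | trans _ _ ih ih' => exact ih.trans ih'
  | swap l i j m h =>
    simp only [List.map_append, List.map_cons, List.prod_append, List.prod_cons]
    rw [← mul_assoc (s i), h.eq, mul_assoc (s j)]
  | rotate i l =>
    rw [isConj_iff]
    refine ⟨(s i)⁻¹, ?_⟩
    simp

theorem WordRel.rotate_append (l m : List ι) : WordRel s (l ++ m) (m ++ l) := by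
  induction l generalizing m with
  | nil => simpa using WordRel.refl m
  | cons a l ih =>
    refine (WordRel.rotate a (l ++ m)).trans ?_
    have := ih (m ++ [a])
    simpa using this

theorem WordRel.move_right {a : ι} {m : List ι} (p : List ι) (h : ∀ x ∈ m, Commute (s a) (s x)) :
    WordRel s (p ++ a :: m) (p ++ m ++ [a]) := by
  induction m generalizing p with
  | nil => simpa using WordRel.refl _
  | cons x m ih =>
    refine (WordRel.swap p a x m (h x (by simp))).trans ?_
    have := ih (p ++ [x]) fun y hy => h y (by simp [hy])
    simpa using this

/-- The hypothesis says that at most one letter of l fails to commute with a. In a rotation of i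
past l, either a commutes with i and the two are exchanged, or a commutes with all other letters and
can be carried around them. -/
theorem WordRel.cons {l m : List ι} (h : WordRel s l m) {a : ι}
    (hl : l.Pairwise fun x y => Commute (s a) (s x) ∨ Commute (s a) (s y)) :
    WordRel s (a :: l) (a :: m) := by
  have hsymm : ∀ {x y : ι}, Commute (s a) (s x) ∨ Commute (s a) (s y) →
    Commute (s a) (s y) ∨ Commute (s a) (s x) := fun h => h.symm
  induction h with
  | refl l => exact WordRel.refl _
  | symm h ih => exact (ih (h.symm.perm.pairwise hl hsymm)).symm
  | trans h _ ih ih' => exact (ih hl).trans (ih' (h.perm.pairwise hl hsymm))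
  | swap l i j m h => exact WordRel.swap (a :: l) i j m h
  | rotate i l =>
    by_cases hi : Commute (s a) (s i)
    · exact (WordRel.swap [] a i l hi).trans (WordRel.rotate i (a :: l))
    · have hl' : ∀ x ∈ l, Commute (s a) (s x) := fun x hx =>
        ((List.pairwise_cons.1 hl).1 x hx).resolve_left hi
      exact (WordRel.rotate a (i :: l)).trans
        ((WordRel.move_right [i] hl').symm.trans (WordRel.rotate i (a :: l)))

/-- The rearrangements of a word whose letters can be removed one by one, such that each letter
fails to commute with at most one of the remaining ones, are all equivalent. -/
theorem wordRel_of_perm {l : List ι} (hl : l.tails.Forall fun t => ∀ a m, t = a :: m →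
    m.Pairwise fun x y => Commute (s a) (s x) ∨ Commute (s a) (s y)) {l' : List ι}
    (h : l'.Perm l) : WordRel s l' l := by
  induction l generalizing l' with
  | nil => rw [List.perm_nil.1 h]; exact WordRel.refl _
  | cons a m ih =>
    obtain ⟨p, q, rfl⟩ := List.append_of_mem (h.symm.subset (List.mem_cons_self))
    rw [List.tails_cons, List.forall_cons] at hl
    have h1 : (q ++ p).Perm m := by
      have : (a :: (q ++ p)).Perm (a :: m) :=
        ((List.perm_append_comm (l₁ := p) (l₂ := a :: q)).symm).trans h
      exact this.cons_inv
    have h2 := ih hl.2 h1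
    have h3 : (q ++ p).Pairwise fun x y => Commute (s a) (s x) ∨ Commute (s a) (s y) :=
      h1.symm.pairwise (hl.1 a m rfl) fun h => h.symm
    exact (WordRel.rotate_append p (a :: q)).trans (h2.cons h3)

end Words

theorem simpleReflection_commute {n : ℕ} (hn : 3 ≤ n) {i j : Fin n}
    (h : Q (simpleRoot hn i) (simpleRoot hn j) = 0) :
    Commute (simpleReflection hn i) (simpleReflection hn j) := by
  apply ModGroup.ext
  intro x
  rw [mul_smul, mul_smul]
  simp only [simpleReflection_smul, map_add, map_smul, LinearMap.add_apply, LinearMap.smul_apply, h,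
    lorentzForm_comm (simpleRoot hn j) (simpleRoot hn i), smul_zero, add_zero]
  abel

/-- The Coxeter element `s₀ s₁ ⋯ s_(n-1)`. -/
def coxeterElement {n : ℕ} (hn : 3 ≤ n) : ModGroup n := (List.ofFn (simpleReflection hn)).prod

theorem coxeterElement_mem {n : ℕ} (hn : 3 ≤ n) : coxeterElement hn ∈ weylGroup n := by
  refine Subgroup.list_prod_mem _ fun x hx => ?_
  obtain ⟨i, rfl⟩ := (List.mem_ofFn' _ _).1 hx
  exact simpleReflection_mem_weylGroup hn i

theorem isCoxeterElement_coxeterElement {n : ℕ} (hn : 3 ≤ n) :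
    IsCoxeterElement hn (coxeterElement hn) := ⟨1, rfl⟩

/-- The simple roots, ordered such that each is orthogonal to all but one of the later ones. -/
def peelingOrder (n : ℕ) (hn : 3 ≤ n) : List (Fin n) :=
  (List.finRange n).reverse.filter (fun i => 4 ≤ i.1) ++
    (⟨0, by omega⟩ :: (List.finRange n).reverse.filter (fun i => i.1 < 4 ∧ 0 < i.1))

/-- The Dynkin diagram is a forest: the simple roots 1, 2, … form a chain and root 0 is attached to
root 3 only, when that exists. The order strips the end of the chain down to 3, removes 0, and
strips the rest. -/
theorem peelingOrder_pairwise {n : ℕ} (hn : 3 ≤ n) (hn8 : n ≤ 8) :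
    (peelingOrder n hn).tails.Forall fun t => ∀ a m, t = a :: m → m.Pairwise fun x y =>
      Q (simpleRoot hn a) (simpleRoot hn x) = 0 ∨ Q (simpleRoot hn a) (simpleRoot hn y) = 0 := by
  have key : (peelingOrder n hn).tails.Forall fun t => ∀ a ∈ t.head?, t.tail.Pairwise fun x y =>
      Q (simpleRoot hn a) (simpleRoot hn x) = 0 ∨ Q (simpleRoot hn a) (simpleRoot hn y) = 0 := by
    have h3 := hn
    revert hn
    interval_cases n <;> decide +kernel
  refine key.imp fun t ht a m e => ?_
  subst e
  exact ht a rfl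

theorem mem_peelingOrder {n : ℕ} (hn : 3 ≤ n) (i : Fin n) : i ∈ peelingOrder n hn := by
  simp only [peelingOrder, List.mem_append, List.mem_filter, List.mem_reverse, List.mem_finRange,
    List.mem_cons, Fin.ext_iff, decide_eq_true_eq, true_and]
  omega

theorem nodup_peelingOrder {n : ℕ} (hn : 3 ≤ n) : (peelingOrder n hn).Nodup := by
  have h := List.nodup_reverse.2 (List.nodup_finRange n)
  refine List.Nodup.append (h.filter _) (List.nodup_cons.2 ⟨by simp, h.filter _⟩) ?_
  intro i hi hi'
  simp only [List.mem_filter, List.mem_cons, decide_eq_true_eq, Fin.ext_iff] at hi hi'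
  omega

theorem exists_conj_of_isCoxeterElement {n : ℕ} (hn : 3 ≤ n) (hn8 : n ≤ 8) {c : ModGroup n}
    (hc : IsCoxeterElement hn c) : ∃ g ∈ weylGroup n, c = g * coxeterElement hn * g⁻¹ := by
  -- Words are evaluated in W_n so that the conjugating element lies there.
  let s : Fin n → weylGroup n := fun i => ⟨_, simpleReflection_mem_weylGroup hn i⟩
  have hrel : ∀ σ : Equiv.Perm (Fin n), WordRel s (List.ofFn σ) (peelingOrder n hn) := by
    intro σ
    refine wordRel_of_perm ?_ ?_
    · refine (peelingOrder_pairwise hn hn8).imp fun t ht a m e => (ht a m e).imp ?_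
      intro x y h
      exact h.imp (fun h => Subtype.ext (simpleReflection_commute hn h))
        fun h => Subtype.ext (simpleReflection_commute hn h)
    · refine (List.perm_ext_iff_of_nodup (List.nodup_ofFn.2 σ.injective)
        (nodup_peelingOrder hn)).2 fun i => ?_
      simp only [mem_peelingOrder, iff_true]
      exact (List.mem_ofFn' _ _).2 (σ.surjective i)
  have hval : ∀ σ : Equiv.Perm (Fin n), (((List.ofFn σ).map s).prod : ModGroup n) =
      (List.ofFn fun i => simpleReflection hn (σ i)).prod := by
    intro σ
    rw [← Subgroup.subtype_apply, map_list_prod, List.map_map, List.map_ofFn]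
    rfl
  obtain ⟨σ, rfl⟩ := hc
  obtain ⟨g, hg⟩ := isConj_iff.1 (((hrel 1).trans (hrel σ).symm).isConj)
  refine ⟨g, g.2, ?_⟩
  rw [← hval, ← hg]
  simp only [Subgroup.coe_mul, Subgroup.coe_inv, hval]
  rfl

/-! ### Elements fixing a conic class -/

theorem exists_eq_single_of_sum_sq_eq_one {m : ℕ} {y : Fin m → ℤ} (h : ∑ i, y i * y i = 1) :
    ∃ i, y = Pi.single i 1 ∨ y = Pi.single i (-1) := by
  obtain ⟨i, hi⟩ : ∃ i, y i ≠ 0 := by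
    by_contra! h0
    simp [h0] at h
  have hs := Finset.add_sum_erase Finset.univ (fun i => y i * y i) (Finset.mem_univ i)
  have hr : 0 ≤ ∑ i ∈ Finset.univ.erase i, y i * y i :=
    Finset.sum_nonneg fun i _ => mul_self_nonneg _
  simp only [h] at hs
  have hpos : 0 < y i * y i := mul_self_pos.2 hi
  have h1 : y i * y i = 1 := by omega
  have h2 := (Finset.sum_eq_zero_iff_of_nonneg fun i _ => mul_self_nonneg (y i)).1
    (by linarith : ∑ i ∈ Finset.univ.erase i, y i * y i = 0)
  have h3 : ∀ j, j ≠ i → y j = 0 := fun j hj =>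
    mul_self_eq_zero.1 (h2 j (Finset.mem_erase.2 ⟨hj, Finset.mem_univ _⟩))
  refine ⟨i, ?_⟩
  rcases mul_self_eq_one_iff.1 h1 with h4 | h4
  · left; ext j
    by_cases hj : j = i
    · subst hj; simp [h4]
    · simp [hj, h3 j hj]
  · right; ext j
    by_cases hj : j = i
    · subst hj; simp [h4]
    · simp [hj, h3 j hj]

/-- The class `H - E₁`. -/
def conic (m : ℕ) : H₂ (m + 1) := hyp _ - exc 0

/-- The components of the singular fibres of the conic bundle of class `H - E₁`. -/
def fibreComponent {m : ℕ} (p : Fin m × Bool) : H₂ (m + 1) :=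
  if p.2 then conic m - exc p.1.succ else exc p.1.succ

section Conic

variable {m : ℕ}

theorem lorentzForm_conic (x : H₂ (m + 1)) : Q x (conic m) = x 0 + x (Fin.succ 0) := by
  rw [conic, map_sub, lorentzForm_hyp, lorentzForm_exc, sub_neg_eq_add]

theorem fibreComponent_zero (p : Fin m × Bool) : fibreComponent p 0 = if p.2 then 1 else 0 := by
  obtain ⟨j, b⟩ := p
  cases b <;> simp [fibreComponent, exc, conic, hyp]

theorem fibreComponent_succ_zero (p : Fin m × Bool) :
    fibreComponent p (Fin.succ 0) = if p.2 then -1 else 0 := by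
  have h (j : Fin m) : Fin.succ 0 ≠ j.succ.succ := fun h =>
    (Fin.succ_ne_zero _).symm (Fin.succ_injective _ h)
  obtain ⟨j, b⟩ := p
  cases b <;>
    simp only [fibreComponent, exc, conic, hyp, Pi.single_apply, Pi.sub_apply, h, if_true, if_false,
      Bool.false_eq_true, Fin.succ_ne_zero, sub_zero, zero_sub]

theorem fibreComponent_succ_succ (p : Fin m × Bool) (i : Fin m) :
    fibreComponent p i.succ.succ = if i = p.1 then (if p.2 then -1 else 1) else 0 := by
  have h : i.succ.succ ≠ Fin.succ 0 := fun h => by simpa using Fin.succ_injective _ h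
  obtain ⟨j, b⟩ := p
  cases b <;>
    simp only [fibreComponent, exc, conic, hyp, Pi.single_apply, Pi.sub_apply, h, if_true, if_false,
      Bool.false_eq_true, Fin.succ_ne_zero, sub_zero, zero_sub, Fin.succ_inj] <;> split_ifs <;> rfl

/-- Orthogonality to H − E₁ makes the coefficients of H and E₁ opposite, so the others have square
sum 1. The sign of the only nonzero one and the degree then determine the coefficient of H. -/
theorem eq_fibreComponent {x : H₂ (m + 1)} (hx : Q x x = -1) (hK : Q x (canonicalClass _) = -1)
    (hf : Q x (conic m) = 0) : ∃ p, x = fibreComponent p := by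
  rw [lorentzForm_conic] at hf
  rw [lorentzForm_apply, Fin.sum_univ_succ] at hx
  rw [lorentzForm_canonicalClass, Fin.sum_univ_succ] at hK
  have h1 : x (Fin.succ 0) = -x 0 := by omega
  rw [h1] at hx hK
  have hy : ∑ i : Fin m, x i.succ.succ * x i.succ.succ = 1 := by linarith
  obtain ⟨j, hj⟩ := exists_eq_single_of_sum_sq_eq_one (y := fun i => x i.succ.succ) hy
  rcases hj with hj | hj
  · have hj' : ∀ i : Fin m, x i.succ.succ = (Pi.single j 1 : Fin m → ℤ) i := congrFun hj
    have h0 : x 0 = 0 := by simp [hj'] at hK; omega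
    refine ⟨(j, false), ?_⟩
    ext i
    refine Fin.cases ?_ (fun i => Fin.cases ?_ (fun i => ?_) i) i
    · rw [fibreComponent_zero, h0]; rfl
    · rw [fibreComponent_succ_zero, h1, h0]; rfl
    · rw [fibreComponent_succ_succ, hj', Pi.single_apply]; simp
  · have hj' : ∀ i : Fin m, x i.succ.succ = (Pi.single j (-1) : Fin m → ℤ) i := congrFun hj
    have h0 : x 0 = 1 := by simp [hj'] at hK; omega
    refine ⟨(j, true), ?_⟩
    ext i
    refine Fin.cases ?_ (fun i => Fin.cases ?_ (fun i => ?_) i) i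
    · rw [fibreComponent_zero, h0]; rfl
    · rw [fibreComponent_succ_zero, h1, h0]; rfl
    · rw [fibreComponent_succ_succ, hj', Pi.single_apply]; simp

theorem fibreComponent_injective : Function.Injective (fibreComponent (m := m)) := by
  rintro ⟨i, b⟩ ⟨j, c⟩ h
  have h0 := congrFun h 0
  have hi := congrFun h i.succ.succ
  rw [fibreComponent_zero, fibreComponent_zero] at h0
  rw [fibreComponent_succ_succ, fibreComponent_succ_succ] at hi
  cases b <;> cases c <;> simp at h0 hi ⊢ <;> exact hi

theorem lorentzForm_fibreComponent_self (p : Fin m × Bool) :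
    Q (fibreComponent p) (fibreComponent p) = -1 := by
  simp only [lorentzForm_apply, Fin.sum_univ_succ (n := m), fibreComponent_zero,
    fibreComponent_succ_zero, fibreComponent_succ_succ]
  cases p.2 <;> simp

theorem fibreComponent_canonicalClass (p : Fin m × Bool) :
    Q (fibreComponent p) (canonicalClass _) = -1 := by
  simp only [lorentzForm_canonicalClass, Fin.sum_univ_succ (n := m), fibreComponent_zero,
    fibreComponent_succ_zero, fibreComponent_succ_succ]
  cases p.2 <;> simp

theorem fibreComponent_conic (p : Fin m × Bool) : Q (fibreComponent p) (conic m) = 0 := by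
  rw [lorentzForm_conic, fibreComponent_zero, fibreComponent_succ_zero]
  cases p.2 <;> simp

theorem fibreComponent_not (p : Fin m × Bool) :
    fibreComponent (p.1, !p.2) = conic m - fibreComponent p := by
  obtain ⟨j, b⟩ := p
  cases b <;> simp [fibreComponent]

/-- Thus K, H − E₁ and the components E_{j+2} determine E₁. This makes the action on components
faithful, and divisibility by 2 restricts the number of sign changes. -/
theorem two_smul_exc_zero :
    (2 : ℤ) • (exc 0 : H₂ (m + 1)) =
      -canonicalClass _ - (3 : ℤ) • conic m + ∑ j, fibreComponent (j, false) := by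
  have : canonicalClass (m + 1) = (-3 : ℤ) • hyp _ + (exc 0 + ∑ j : Fin m, exc j.succ) := by
    rw [canonicalClass, Fin.sum_univ_succ]
  simp only [this, conic, fibreComponent, Bool.false_eq_true, if_false]
  module

theorem exc_zero_fixed {w : ModGroup (m + 1)} (hw : w ∈ weylGroup _)
    (hf : w • (conic m : H₂ (m + 1)) = conic m)
    (h : ∀ j : Fin m, w • (fibreComponent (j, false) : H₂ (m + 1)) = fibreComponent (j, false)) :
    w = 1 := by
  have h0 : w • (exc 0 : H₂ (m + 1)) = exc 0 := by
    have h2 : (2 : ℤ) • (w • (exc 0 : H₂ (m + 1))) = (2 : ℤ) • exc 0 := by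
      rw [← smul_zsmul', two_smul_exc_zero, smul_add, smul_sub, smul_neg, mem_weylGroup.1 hw,
        smul_zsmul', hf, smul_sum']
      simp only [h]
    exact smul_right_injective _ (two_ne_zero) h2
  have hH : w • (hyp (m + 1) : H₂ (m + 1)) = hyp (m + 1) := by
    have : hyp (m + 1) = conic m + exc 0 := by simp [conic]
    rw [this, smul_add, hf, h0]
  have hall : ∀ i : Fin (m + 1 + 1), w • (Pi.single i 1 : H₂ (m + 1)) = Pi.single i 1 := by
    intro i
    refine Fin.cases hH (fun i => ?_) i
    refine Fin.cases h0 (fun i => ?_) i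
    exact h i
  apply ModGroup.ext
  intro x
  have : ((w : H₂ (m + 1) ≃ₗ[ℤ] H₂ (m + 1)) : H₂ (m + 1) →ₗ[ℤ] H₂ (m + 1)) = LinearMap.id := by
    apply LinearMap.pi_ext'
    intro i
    ext1
    exact hall i
  exact congrArg (fun f => f x) this

/-- An element of `W_(m+1)` fixing `H - E₁` acts on the components of the singular fibres as a
signed permutation. -/
theorem exists_signed_perm {w : ModGroup (m + 1)} (hw : w ∈ weylGroup _)
    (hf : w • (conic m : H₂ (m + 1)) = conic m) : ∃ (π : Equiv.Perm (Fin m)) (ε : Fin m → Bool),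
      ∀ j b, w • fibreComponent (j, b) = fibreComponent (π j, xor b (ε j)) := by
  have h1 : ∀ j : Fin m, ∃ p, w • fibreComponent (j, false) = fibreComponent p := by
    intro j
    apply eq_fibreComponent
    · rw [lorentzForm_smul_smul, lorentzForm_fibreComponent_self]
    · rw [← mem_weylGroup.1 hw, lorentzForm_smul_smul, fibreComponent_canonicalClass]
    · rw [← hf, lorentzForm_smul_smul, fibreComponent_conic]
  choose p hp using h1
  have hp' : ∀ j b, w • fibreComponent (j, b) = fibreComponent ((p j).1, xor b (p j).2) := by
    intro j b
    cases b
    · simp [hp]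
    · have := fibreComponent_not (j, false)
      simp only [Bool.not_false] at this
      rw [this, smul_sub, hf, hp, Bool.true_xor, fibreComponent_not]
  have hinj : Function.Injective fun j => (p j).1 := by
    intro i j hij
    by_cases hb : (p i).2 = (p j).2
    · have : p i = p j := Prod.ext hij hb
      have h2 := hp i
      rw [this, ← hp j] at h2
      exact congrArg Prod.fst (fibreComponent_injective (MulAction.injective w h2))
    · have : p i = ((p j).1, xor true (p j).2) := Prod.ext hij (by
        revert hb; cases (p i).2 <;> cases (p j).2 <;> simp)
      have h2 := hp i
      rw [this, ← hp' j true] at h2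
      exact congrArg Prod.fst (fibreComponent_injective (MulAction.injective w h2))
  exact ⟨Equiv.ofBijective _ hinj.bijective_of_finite, fun j => (p j).2, hp'⟩

/-- w^k preserves each singular fibre and at most exchanges its two components, so its square fixes
every component. -/
theorem pow_two_mul_eq_one {w : ModGroup (m + 1)} (hw : w ∈ weylGroup _)
    (hf : w • (conic m : H₂ (m + 1)) = conic m) {π : Equiv.Perm (Fin m)} {ε : Fin m → Bool}
    (h : ∀ j b, w • fibreComponent (j, b) = fibreComponent (π j, xor b (ε j))) {k : ℕ}
    (hk : π ^ k = 1) : w ^ (2 * k) = 1 := by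
  have hfk : ∀ k : ℕ, w ^ k • (conic m : H₂ (m + 1)) = conic m := by
    intro k
    induction k with
    | zero => simp
    | succ k ih => rw [pow_succ, mul_smul, hf, ih]
  have h1 : ∀ (k : ℕ) j b, ∃ c, w ^ k • fibreComponent (j, b) = fibreComponent ((π ^ k) j, c) := by
    intro k
    induction k with
    | zero => intro j b; exact ⟨b, by simp⟩
    | succ k ih =>
      intro j b
      obtain ⟨c, hc⟩ := ih (π j) (xor b (ε j))
      exact ⟨c, by rw [pow_succ, mul_smul, h, hc, pow_succ, Equiv.Perm.mul_apply]⟩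
  refine exc_zero_fixed (pow_mem hw _) (hfk _) fun j => ?_
  rw [two_mul, pow_add, mul_smul]
  obtain ⟨c, hc⟩ := h1 k j false
  rw [hk, Equiv.Perm.one_apply] at hc
  cases c
  · rw [hc, hc]
  · have h2 := fibreComponent_not (j, false)
    simp only [Bool.not_false] at h2
    rw [hc, h2, smul_sub, hfk, hc, h2]
    abel

/-- Apply w to 2E₁ and pair with E₁. The result is even, and each sign change contributes 1. -/
theorem even_card_of_signed_perm {w : ModGroup (m + 1)} (hw : w ∈ weylGroup _)
    (hf : w • (conic m : H₂ (m + 1)) = conic m) {π : Equiv.Perm (Fin m)} {ε : Fin m → Bool}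
    (h : ∀ j b, w • fibreComponent (j, b) = fibreComponent (π j, xor b (ε j))) :
    Even (Finset.univ.filter fun j => ε j = true).card := by
  have h1 : ∀ j, Q (fibreComponent (π j, xor false (ε j))) (exc 0) =
      if ε j = true then 1 else 0 := by
    intro j
    rw [lorentzForm_exc]
    rw [fibreComponent_succ_zero]
    cases ε j <;> simp
  have h2 := congrArg (fun x => Q (w • x) (exc 0)) (two_smul_exc_zero (m := m))
  simp only [smul_add, smul_sub, smul_neg, mem_weylGroup.1 hw, smul_zsmul', hf, smul_sum', h,
    map_add, map_sub, map_neg, map_smul, map_sum, LinearMap.add_apply, LinearMap.sub_apply,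
    LinearMap.neg_apply, LinearMap.smul_apply, LinearMap.sum_apply, h1, Finset.sum_boole] at h2
  rw [lorentzForm_exc, lorentzForm_exc, lorentzForm_exc, canonicalClass_succ] at h2
  have h3 : conic m (Fin.succ 0) = -1 := by
    simp only [conic, hyp, exc, Pi.sub_apply, Pi.single_apply, Fin.succ_ne_zero, if_false, if_true]
    rfl
  simp only [h3, smul_eq_mul] at h2
  rw [← Int.even_coe_nat, Int.even_iff]
  omega

/-- The parity condition excludes the signed 4-cycles with an odd number of sign changes, which have
order 8. -/
theorem signed_perm_four : ∀ (π : Equiv.Perm (Fin 4)) (ε : Fin 4 → Bool),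
    Even (Finset.univ.filter fun j => ε j = true).card →
    (∀ p, (fun p : Fin 4 × Bool => (π p.1, xor p.2 (ε p.1)))^[4] p = p) ∨
      ∀ p, (fun p : Fin 4 × Bool => (π p.1, xor p.2 (ε p.1)))^[6] p = p := by
  decide +kernel

theorem pow_eq_one_of_iterate {w : ModGroup (m + 1)} (hw : w ∈ weylGroup _)
    (hf : w • (conic m : H₂ (m + 1)) = conic m) {T : Fin m × Bool → Fin m × Bool}
    (h : ∀ p, w • fibreComponent p = fibreComponent (T p)) {k : ℕ} (hk : ∀ p, T^[k] p = p) :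
    w ^ k = 1 := by
  have hfk : ∀ k : ℕ, w ^ k • (conic m : H₂ (m + 1)) = conic m := by
    intro k
    induction k with
    | zero => simp
    | succ k ih => rw [pow_succ, mul_smul, hf, ih]
  have h1 : ∀ (k : ℕ) p, w ^ k • fibreComponent p = fibreComponent (T^[k] p) := by
    intro k
    induction k with
    | zero => intro p; simp
    | succ k ih => intro p; rw [pow_succ, mul_smul, h, ih, Function.iterate_succ_apply]
  exact exc_zero_fixed (pow_mem hw _) (hfk _) fun j => by rw [h1, hk]

end Conic

/-! ### Elements of the order of a Coxeter element are elliptic -/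

/-- Let a ≤ b ≤ c ≤ 0 be the first three E-coefficients. Dominance gives u₀ ≥ −(a + b + c), and each
of ab, ac, bc is at least c², so (a + b + c)² leaves at least 6c² for the at most five remaining
squares. If b < 0 the excess is strict; if b = 0, then Q(u, u) = u₀² − a². -/
theorem IsDominant.sq_pos_or_eq {k : ℕ} (hk : k ≤ 5) {hn : 3 ≤ k + 3} {u : H₂ (k + 3)}
    (hu : IsDominant hn u) (hlast : u (Fin.last (k + 2)).succ = 0) :
    0 ≤ u 0 ∧ (0 < Q u u ∨ u = u 0 • (conic (k + 2) : H₂ (k + 3))) := by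
  have hle : ∀ i : Fin (k + 3), u i.succ ≤ 0 := fun i => hlast ▸ hu.antitone (Fin.le_last i)
  have hc := hu.cremona
  have h01 := hu.antitone (i := ⟨0, by omega⟩) (j := ⟨1, by omega⟩) (by simp)
  have h12 := hu.antitone (i := ⟨1, by omega⟩) (j := ⟨2, by omega⟩) (by simp [Fin.le_def])
  have h0 := hle ⟨0, by omega⟩
  have h1 := hle ⟨1, by omega⟩
  have h2 := hle ⟨2, by omega⟩
  have hQ : Q u u = u 0 * u 0 - (u (⟨0, by omega⟩ : Fin (k + 3)).succ *
      u (⟨0, by omega⟩ : Fin (k + 3)).succ + (u (⟨1, by omega⟩ : Fin (k + 3)).succ *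
      u (⟨1, by omega⟩ : Fin (k + 3)).succ + (u (⟨2, by omega⟩ : Fin (k + 3)).succ *
      u (⟨2, by omega⟩ : Fin (k + 3)).succ +
        ∑ i : Fin k, u i.succ.succ.succ.succ * u i.succ.succ.succ.succ))) := by
    rw [lorentzForm_apply, Fin.sum_univ_succ, Fin.sum_univ_succ, Fin.sum_univ_succ]
    rfl
  have hsum : ∑ i : Fin k, u i.succ.succ.succ.succ * u i.succ.succ.succ.succ ≤
      5 * (u (⟨2, by omega⟩ : Fin (k + 3)).succ * u (⟨2, by omega⟩ : Fin (k + 3)).succ) := by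
    refine (Finset.sum_le_card_nsmul _ _ (u (⟨2, by omega⟩ : Fin (k + 3)).succ *
      u (⟨2, by omega⟩ : Fin (k + 3)).succ) fun i _ => ?_).trans ?_
    · have h3 := hu.antitone (i := ⟨2, by omega⟩) (j := i.succ.succ.succ)
        (by simp [Fin.le_def])
      nlinarith [hle i.succ.succ.succ]
    · rw [Finset.card_fin, nsmul_eq_mul]
      gcongr
      · exact mul_self_nonneg _
      · exact_mod_cast hk
  have hrest : u (⟨1, by omega⟩ : Fin (k + 3)).succ = 0 → ∀ i : Fin (k + 2), u i.succ.succ = 0 := by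
    intro h i
    have := hu.antitone (i := ⟨1, by omega⟩) (j := i.succ) (by simp [Fin.le_def])
    have := hle i.succ
    omega
  have hsum0 : u (⟨1, by omega⟩ : Fin (k + 3)).succ = 0 →
      ∑ i : Fin k, u i.succ.succ.succ.succ * u i.succ.succ.succ.succ = 0 := fun h =>
    Finset.sum_eq_zero fun i _ => by rw [hrest h i.succ.succ, mul_zero]
  have heq : u (⟨1, by omega⟩ : Fin (k + 3)).succ = 0 →
      u (⟨0, by omega⟩ : Fin (k + 3)).succ = -u 0 → u = u 0 • (conic (k + 2) : H₂ (k + 3)) := by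
    intro h1 h0
    ext i
    refine Fin.cases ?_ (fun i => Fin.cases ?_ (fun i => ?_) i) i
    · simp [conic, hyp, exc]
    · have e : conic (k + 2) (Fin.succ 0) = -1 := by
        simp only [conic, hyp, exc, Pi.sub_apply, Pi.single_apply, Fin.succ_ne_zero, if_false,
          if_true]
        rfl
      rw [Pi.smul_apply, e, smul_eq_mul, mul_neg_one]
      exact h0
    · have h' : i.succ.succ ≠ Fin.succ 0 := fun h => Fin.succ_ne_zero _ (Fin.succ_injective _ h)
      have e : conic (k + 2) i.succ.succ = 0 := by
        simp only [conic, hyp, exc, Pi.sub_apply, Pi.single_apply, Fin.succ_ne_zero, if_false, h',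
          sub_zero]
      rw [hrest h1, Pi.smul_apply, e, smul_zero]
  rw [hQ]
  generalize u (⟨0, by omega⟩ : Fin (k + 3)).succ = a at *
  generalize u (⟨1, by omega⟩ : Fin (k + 3)).succ = b at *
  generalize u (⟨2, by omega⟩ : Fin (k + 3)).succ = c at *
  generalize ∑ i : Fin k, u i.succ.succ.succ.succ * u i.succ.succ.succ.succ = s at *
  clear hQ hu
  generalize u 0 = d at *
  refine ⟨by omega, ?_⟩
  rcases h1.eq_or_lt with hb | hb
  · rw [hsum0 hb, hb]
    have hc0 : c = 0 := by omega
    rw [hc0]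
    rcases (by omega : a = -d ∨ 0 < d + a) with h | h
    · exact Or.inr (heq hb h)
    · left; nlinarith
  · left
    have e1 : c * c ≤ a * b := by nlinarith
    have e2 : c * c ≤ a * c := by nlinarith
    have e3 : c * c ≤ b * c := by nlinarith
    have e4 : 0 < a * b := by nlinarith
    have e5 : (a + b + c) * (a + b + c) ≤ d * d := by nlinarith
    nlinarith

/-- Start from a nonzero fixed x in K^⊥, make it forward by subtracting a large multiple of K, and
move it into the chamber of W_n. Subtracting a further multiple of K places it on the wall of E_n
without affecting dominance or fixedness. A positive square would make w reducible, so it is a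
multiple of H − E₁. -/
theorem exists_conj_fixes_conic {k : ℕ} (hk : k ≤ 5) {w : ModGroup (k + 3)}
    (hw : w ∈ weylGroup _) (hirr : IsIrreducible w) (hell : ¬ IsElliptic w) :
    ∃ g ∈ weylGroup (k + 3), (g * w * g⁻¹) • (conic (k + 2) : H₂ (k + 3)) = conic (k + 2) := by
  unfold IsElliptic at hell
  push Not at hell
  obtain ⟨x, hwx, hxK, hx⟩ := hell
  have hn : 3 ≤ k + 3 := by omega
  have hn8 : k + 3 ≤ 8 := by omega
  set K := canonicalClass (k + 3) with hK
  have hKK : Q K K = 6 - k := by rw [canonicalClass_sq]; push_cast; ring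
  set N : ℤ := 1 + |Q x x| with hN
  have hN1 : 1 ≤ N := by have := abs_nonneg (Q x x); omega
  set v := x - N • K with hv
  have hvK : Q (-K) v = N * (6 - k) := by
    rw [lorentzForm_comm, map_neg, hv, LinearMap.map_sub₂, LinearMap.map_smul₂, hxK, hKK,
        smul_eq_mul]
    ring
  have hk' : (0 : ℤ) < 6 - k := by omega
  have hfv : IsForward v := by
    refine (isForward_neg_canonicalClass hn8).of_pos ?_ ?_
    · simp only [hv, map_sub, map_smul, LinearMap.sub_apply, LinearMap.smul_apply, smul_eq_mul, hxK,
        lorentzForm_comm K x, hKK]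
      have h1 := neg_abs_le (Q x x)
      have h2 : N * N * 1 ≤ N * N * (6 - k) := by gcongr; omega
      nlinarith
    · rw [hvK]; positivity
  obtain ⟨g, hg, hd⟩ := exists_weylGroup_isDominant hn hn8 hfv
  refine ⟨g, hg, ?_⟩
  set c := g * w * g⁻¹ with hc
  have hcW : c ∈ weylGroup _ := mul_mem (mul_mem hg hw) (inv_mem hg)
  have hwv : w • v = v := by rw [hv, smul_sub, smul_zsmul', hwx, mem_weylGroup.1 hw]
  set a := (g • v) (Fin.last (k + 2)).succ with ha
  set u := g • v - a • K with hu
  have hcu : c • u = u := by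
    rw [hu, smul_sub, smul_zsmul', mem_weylGroup.1 hcW, hc, conj_smul_smul, hwv]
  have hud : IsDominant hn u := by
    intro i
    have := hd i
    rwa [hu, LinearMap.map_sub₂, LinearMap.map_smul₂, lorentzForm_comm K,
      simpleRoot_canonicalClass, smul_zero, sub_zero]
  have hul : u (Fin.last (k + 2)).succ = 0 := by
    rw [hu, Pi.sub_apply, Pi.smul_apply, hK, canonicalClass_succ, smul_eq_mul, mul_one, ← ha,
      sub_self]
  have hu0 : u ≠ 0 := by
    intro h0
    have h1 : g • x = (N + a) • K := by
      have : u = g • x - (N + a) • K := by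
        rw [hu, hv, smul_sub, smul_zsmul', mem_weylGroup.1 hg, sub_sub, ← add_smul]
      rw [this] at h0
      exact sub_eq_zero.1 h0
    have h2 : Q (g • x) K = 0 := by
      rw [hK, ← mem_weylGroup.1 hg, lorentzForm_smul_smul, hxK]
    rw [h1, LinearMap.map_smul₂, hKK, smul_eq_mul] at h2
    have h3 : N + a = 0 := (mul_eq_zero.1 h2).resolve_right hk'.ne'
    rw [h3, zero_smul] at h1
    exact hx ((smul_eq_zero_iff_eq g).1 h1)
  obtain ⟨h0, h1⟩ := hud.sq_pos_or_eq hk hul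
  rcases h1 with h1 | h1
  · have h2 : 0 < u 0 := by
      refine lt_of_le_of_ne h0 fun h => ?_
      rw [lorentzForm_apply, ← h] at h1
      have := Finset.sum_nonneg fun (i : Fin (k + 3)) (_ : i ∈ Finset.univ) =>
        mul_self_nonneg (u i.succ)
      omega
    refine absurd (isReducible_of_isDominant hn hn8 ⟨h1, h2⟩ hud ?_ hcu) (hirr.conj g)
    rw [lorentzForm_exc, neg_eq_zero]
    exact hul
  · have h2 : u 0 ≠ 0 := fun h => hu0 (by rw [h1, h, zero_smul])
    rw [h1, smul_zsmul'] at hcu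
    exact smul_right_injective _ h2 hcu

theorem orderOf_dvd_sixty (π : Equiv.Perm (Fin 6)) : π ^ 60 = 1 := by
  rw [← orderOf_dvd_iff_pow_eq_one, ← Equiv.Perm.lcm_cycleType, Multiset.lcm_dvd]
  intro b hb
  have h1 := Equiv.Perm.le_card_support_of_mem_cycleType hb
  have h2 := Equiv.Perm.two_le_of_mem_cycleType hb
  have h3 : π.support.card ≤ 6 := by simpa using Finset.card_le_univ π.support
  have h4 : b ≤ 6 := h1.trans h3
  interval_cases b <;> norm_num

/-- A 5-cycle leaves room only for a transposition; without one the cycle lengths are among 2, 3, 4,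
6, 7. -/
theorem pow_eq_one_of_perm_seven (π : Equiv.Perm (Fin 7)) : π ^ 84 = 1 ∨ π ^ 10 = 1 := by
  simp only [← orderOf_dvd_iff_pow_eq_one, ← Equiv.Perm.lcm_cycleType, Multiset.lcm_dvd]
  have h3 : π.cycleType.sum ≤ 7 := by
    rw [Equiv.Perm.sum_cycleType]; simpa using Finset.card_le_univ π.support
  by_cases h5 : 5 ∈ π.cycleType
  · right
    obtain ⟨t, ht⟩ := Multiset.exists_cons_of_mem h5
    intro b hb
    have h2 := Equiv.Perm.two_le_of_mem_cycleType hb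
    rw [ht] at h3 hb
    rw [Multiset.sum_cons] at h3
    rcases Multiset.mem_cons.1 hb with rfl | hb
    · norm_num
    · have h1 := Multiset.single_le_sum (fun _ _ => Nat.zero_le _) _ hb
      have : b = 2 := by omega
      subst this
      norm_num
  · left
    intro b hb
    have h2 := Equiv.Perm.two_le_of_mem_cycleType hb
    have h1 := (Multiset.single_le_sum (fun _ _ => Nat.zero_le _) _ hb).trans h3
    have : b ≠ 5 := fun h => h5 (h ▸ hb)
    interval_cases b <;> first | exact absurd rfl this | norm_num

/-- The orders of the Coxeter elements. -/
def coxeterOrder : ℕ → ℕ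
  | 3 => 6
  | 4 => 5
  | 5 => 8
  | 6 => 12
  | 7 => 18
  | 8 => 30
  | _ => 0

/-- Otherwise a conjugate is a signed permutation of n − 1 fibres. Its order divides 4 for n = 3, 12
for n = 4, 4 or 6 for n = 5, 120 for n = 7, and 168 or 20 for n = 8, so it is not h_n. Order 12 for
n = 6 is not excluded in this way. -/
theorem isElliptic_of_orderOf_eq {n : ℕ} (hn : 3 ≤ n) (hn8 : n ≤ 8) {w : ModGroup n}
    (hw : w ∈ weylGroup n) (hirr : IsIrreducible w) (ho : orderOf w = coxeterOrder n) :
    IsElliptic w := by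
  by_contra hell
  obtain ⟨k, rfl⟩ := Nat.exists_eq_add_of_le' hn
  obtain ⟨g, hg, hf⟩ := exists_conj_fixes_conic (by omega) hw hirr hell
  set c := g * w * g⁻¹ with hc
  have hcW : c ∈ weylGroup _ := mul_mem (mul_mem hg hw) (inv_mem hg)
  have hco : orderOf c = coxeterOrder (k + 3) := by
    rw [← ho, hc]
    exact orderOf_injective (MulAut.conj g).toMonoidHom (MulAut.conj g).injective w
  obtain ⟨π, ε, h⟩ := exists_signed_perm hcW hf
  have hord : ∀ l : ℕ, π ^ l = 1 → coxeterOrder (k + 3) ∣ 2 * l := fun l hl =>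
    hco ▸ orderOf_dvd_of_pow_eq_one (pow_two_mul_eq_one hcW hf h hl)
  have hk : k ≤ 5 := by omega
  interval_cases k
  · exact absurd (hord 2 ((by decide : ∀ π : Equiv.Perm (Fin 2), π ^ 2 = 1) π)) (by decide)
  · exact absurd (hord 6 ((by decide +kernel : ∀ π : Equiv.Perm (Fin 3), π ^ 6 = 1) π)) (by decide)
  · have h4 := signed_perm_four π ε (even_card_of_signed_perm hcW hf h)
    have hd : ∀ l : ℕ, (∀ p, (fun p : Fin 4 × Bool => (π p.1, xor p.2 (ε p.1)))^[l] p = p) →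
        coxeterOrder 5 ∣ l := fun l hl =>
      hco ▸ orderOf_dvd_of_pow_eq_one (pow_eq_one_of_iterate hcW hf (fun p => h p.1 p.2) hl)
    rcases h4 with h4 | h4
    · exact absurd (hd 4 h4) (by decide)
    · exact absurd (hd 6 h4) (by decide)
  -- On a cubic surface −K − C is the line residual to the conic C. It is fixed along with C, and it
  -- is orthogonal to the fixed forward vector −2K − C.
  · refine hirr.conj g (isReducible_of_orthogonal hn hn8
      (v := -(2 : ℤ) • canonicalClass 6 - conic 5) (f := -canonicalClass 6 - conic 5) ?_ ?_ ?_ ?_)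
    · exact ⟨by decide +kernel, by decide +kernel⟩
    · decide +kernel
    · decide +kernel
    · rw [smul_sub, hf, smul_zsmul', mem_weylGroup.1 hcW]
  · exact absurd (hord 60 (orderOf_dvd_sixty π)) (by decide)
  · rcases pow_eq_one_of_perm_seven π with h7 | h7
    · exact absurd (hord 84 h7) (by decide)
    · exact absurd (hord 10 h7) (by decide)

/-! ### Recognizing conjugate elements -/

theorem eq_zero_of_forall_lorentzForm {n : ℕ} {u : H₂ n} (h : ∀ v, Q u v = 0) : u = 0 := by
  ext i
  refine Fin.cases ?_ (fun i => ?_) i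
  · simpa [lorentzForm_hyp] using h (hyp n)
  · simpa [lorentzForm_exc] using h (exc i)

/-- The Gram matrix of the standard basis. -/
def lorentzMatrix (n : ℕ) : Matrix (Fin (n + 1)) (Fin (n + 1)) ℤ :=
  Matrix.diagonal (Fin.cons 1 fun _ => -1)

theorem lorentzMatrix_mul_self (n : ℕ) : lorentzMatrix n * lorentzMatrix n = 1 := by
  rw [lorentzMatrix, Matrix.diagonal_mul_diagonal, ← Matrix.diagonal_one]
  congr 1
  ext i
  refine Fin.cases ?_ (fun i => ?_) i <;> simp

open Matrix in
theorem lorentzForm_eq_dotProduct {n : ℕ} (u v : H₂ n) :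
    Q u v = u ⬝ᵥ lorentzMatrix n *ᵥ v := by
  rw [lorentzForm_apply, dotProduct, Fin.sum_univ_succ]
  simp [lorentzMatrix, Matrix.mulVec_diagonal, Finset.sum_neg_distrib, sub_eq_add_neg]

open Matrix in
-- The linear map with matrix X Y⁻¹ takes each y i to x i. Equality of Gram matrices makes it
-- preserve J, whence it is invertible over ℤ.
theorem exists_modGroup_of_gram_eq {n : ℕ} {x y : Fin (n + 1) → H₂ n}
    (hxy : ∀ i j, Q (x i) (x j) = Q (y i) (y j)) {Y' : Matrix (Fin (n + 1)) (Fin (n + 1)) ℤ}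
    (hY : (Matrix.of fun i j => y j i) * Y' = 1) : ∃ g : ModGroup n, ∀ i, g • y i = x i := by
  set Y : Matrix (Fin (n + 1)) (Fin (n + 1)) ℤ := Matrix.of fun i j => y j i with hYdef
  set X : Matrix (Fin (n + 1)) (Fin (n + 1)) ℤ := Matrix.of fun i j => x j i with hXdef
  set J := lorentzMatrix n with hJ
  have hgram : Xᵀ * J * X = Yᵀ * J * Y := by
    have key : ∀ z : Fin (n + 1) → H₂ n,
        (Matrix.of fun i j => z j i)ᵀ * J * (Matrix.of fun i j => z j i) =
          Matrix.of fun i j => Q (z i) (z j) := by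
      intro z
      ext i j
      rw [Matrix.of_apply, lorentzForm_eq_dotProduct, Matrix.mul_assoc, Matrix.mul_apply']
      rfl
    rw [hXdef, hYdef, key, key]
    ext i j
    exact hxy i j
  set G := X * Y' with hG
  have hGJ : Gᵀ * J * G = J := by
    calc Gᵀ * J * G = Y'ᵀ * (Xᵀ * J * X) * Y' := by
          simp only [hG, Matrix.transpose_mul, Matrix.mul_assoc]
      _ = (Y * Y')ᵀ * J * (Y * Y') := by
          simp only [hgram, Matrix.transpose_mul, Matrix.mul_assoc]
      _ = J := by rw [hY]; simp
  have hinv : (J * Gᵀ * J) * G = 1 := by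
    rw [Matrix.mul_assoc, Matrix.mul_assoc, ← Matrix.mul_assoc Gᵀ, hGJ, lorentzMatrix_mul_self]
  let g : H₂ n ≃ₗ[ℤ] H₂ n := Matrix.toLin'OfInv hinv (mul_eq_one_comm.1 hinv)
  have hg : ∀ v, g v = G *ᵥ v := fun v => rfl
  refine ⟨⟨g, fun u v => ?_⟩, fun i => ?_⟩
  · rw [lorentzForm_eq_dotProduct, lorentzForm_eq_dotProduct, hg, hg, ← hJ, Matrix.mulVec_mulVec,
      ← Matrix.vecMul_transpose, ← Matrix.dotProduct_mulVec, Matrix.mulVec_mulVec,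
      ← Matrix.mul_assoc, hGJ]
  · change G *ᵥ y i = x i
    have h1 : y i = Y *ᵥ Pi.single i 1 := by
      rw [Matrix.mulVec_single_one]; rfl
    rw [h1, Matrix.mulVec_mulVec, hG, Matrix.mul_assoc, mul_eq_one_comm.1 hY, Matrix.mul_one,
      Matrix.mulVec_single_one]
    rfl

/-- The central element `-1`. -/
def negOne (n : ℕ) : ModGroup n :=
  ⟨LinearEquiv.neg ℤ, fun x y => by simp⟩

theorem negOne_smul {n : ℕ} (x : H₂ n) : negOne n • x = -x := rfl

/-- Since −1 is central, this lets a conjugating element of Mod be replaced by one in Mod⁺. -/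
theorem mem_modPlus_or {n : ℕ} (g : ModGroup n) : g ∈ ModPlus n ∨ g * negOne n ∈ ModPlus n := by
  have hH := IsForward.hyp n
  have h1 : Q (g • hyp n) (g • hyp n) = 1 := by
    rw [lorentzForm_smul_smul, lorentzForm_hyp]; simp [hyp]
  have h2 : (g • (hyp n : H₂ n)) 0 ≠ 0 := by
    intro h0
    rw [lorentzForm_apply, h0] at h1
    have := Finset.sum_nonneg fun (i : Fin n) (_ : i ∈ Finset.univ) =>
      mul_self_nonneg ((g • (hyp n : H₂ n)) i.succ)
    omega
  rcases lt_or_gt_of_ne h2 with h | h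
  · right
    refine mem_modPlus_of_isForward hH ?_
    rw [mul_smul, negOne_smul, smul_neg]
    refine ⟨by simp [h1], by simpa using h⟩
  · left
    exact mem_modPlus_of_isForward hH ⟨by rw [h1]; norm_num, h⟩

/-- Let g be the isometry taking the y i to the x i. Then w x i and g c y i have the same pairings
with all x j = g y j, so they coincide by nondegeneracy, and w g = g c. -/
theorem exists_conj_of_basis {n : ℕ} {w c : ModGroup n} {x y : Fin (n + 1) → H₂ n}
    (hxy : ∀ i j, Q (x i) (x j) = Q (y i) (y j))
    (hwc : ∀ i j, Q (w • x i) (x j) = Q (c • y i) (y j))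
    {Y' : Matrix (Fin (n + 1)) (Fin (n + 1)) ℤ} (hY : (Matrix.of fun i j => y j i) * Y' = 1) :
    ∃ g ∈ ModPlus n, w = g * c * g⁻¹ := by
  obtain ⟨g, hg⟩ := exists_modGroup_of_gram_eq hxy hY
  have hspan : ∀ f f' : H₂ n →ₗ[ℤ] H₂ n, (∀ i, f (y i) = f' (y i)) → f = f' := by
    intro f f' h
    have h2 : f ∘ₗ Matrix.toLin' (Matrix.of fun i j => y j i) =
        f' ∘ₗ Matrix.toLin' (Matrix.of fun i j => y j i) := by
      apply LinearMap.pi_ext'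
      intro i
      ext1
      have : (Matrix.of fun i j => y j i).mulVec (Pi.single i 1) = y i := by
        rw [Matrix.mulVec_single_one]; rfl
      simp only [LinearMap.comp_apply, LinearMap.single_apply, Matrix.toLin'_apply, this, h]
    have h3 := congrArg (fun F => F ∘ₗ Matrix.toLin' Y') h2
    simpa only [LinearMap.comp_assoc, ← Matrix.toLin'_mul, hY, Matrix.toLin'_one,
      LinearMap.comp_id] using h3
  have hcomm : w * g = g * c := by
    apply ModGroup.ext
    intro v
    have h := hspan ((w * g : ModGroup n) : H₂ n ≃ₗ[ℤ] H₂ n).toLinearMap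
      ((g * c : ModGroup n) : H₂ n ≃ₗ[ℤ] H₂ n).toLinearMap fun i => by
        change (w * g) • y i = (g * c) • y i
        rw [mul_smul, mul_smul, hg, ← sub_eq_zero]
        apply eq_zero_of_forall_lorentzForm
        intro v
        have h4 : ((lorentzForm ℤ n (w • x i - g • c • y i)).comp
            (g : H₂ n ≃ₗ[ℤ] H₂ n).toLinearMap) = 0 := by
          have : ∀ φ : H₂ n →ₗ[ℤ] ℤ, (∀ j, φ (y j) = 0) → φ = 0 := by
            intro φ hφ
            have := hspan (LinearMap.toSpanSingleton ℤ (H₂ n) (hyp n) ∘ₗ φ) 0 fun j => by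
              simp [hφ]
            ext v
            have h5 := congrFun (congrArg (fun f => f (Pi.single v 1)) this) 0
            simpa [hyp] using h5
          apply this
          intro j
          change Q (w • x i - g • c • y i) (g • y j) = 0
          rw [LinearMap.map_sub₂, lorentzForm_smul_smul, hg, hwc, sub_self]
        have h5 := congrArg (fun f => f (g⁻¹ • v)) h4
        change Q (w • x i - g • c • y i) (g • g⁻¹ • v) = 0 at h5
        rwa [smul_inv_smul] at h5
    exact congrArg (fun f => f v) h
  have hw : w = g * c * g⁻¹ := by rw [← hcomm]; group
  rcases mem_modPlus_or g with h | h
  · exact ⟨g, h, hw⟩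
  · refine ⟨g * negOne n, h, ?_⟩
    have hz : negOne n * c = c * negOne n := by
      apply ModGroup.ext
      intro x
      rw [mul_smul, mul_smul, negOne_smul, negOne_smul, smul_neg]
    rw [hw, mul_inv_rev, mul_assoc g (negOne n), hz]
    group

/-- With truncated subtraction the exponent is |i − j|: the Gram matrix of an orbit is Toeplitz. -/
theorem lorentzForm_pow_pow {n : ℕ} (w : ModGroup n) (x : H₂ n) (i j : ℕ) :
    Q (w ^ i • x) (w ^ j • x) = Q x (w ^ ((j - i) + (i - j)) • x) := by
  rcases le_total i j with h | h
  · obtain ⟨k, rfl⟩ := Nat.exists_eq_add_of_le h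
    rw [pow_add, mul_smul, lorentzForm_smul_smul]
    congr 3; omega
  · obtain ⟨k, rfl⟩ := Nat.exists_eq_add_of_le h
    rw [pow_add, mul_smul, lorentzForm_smul_smul, lorentzForm_comm]
    congr 3; omega

/-- Two elements with cyclic vectors of the same self-pairings are conjugate. -/
theorem exists_conj_of_cyclic {n : ℕ} {w c : ModGroup n} {x y : H₂ n}
    (h : ∀ k ≤ n + 1, Q x (w ^ k • x) = Q y (c ^ k • y))
    {Y' : Matrix (Fin (n + 1)) (Fin (n + 1)) ℤ}
    (hY : (Matrix.of fun i (j : Fin (n + 1)) => (c ^ (j : ℕ) • y) i) * Y' = 1) :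
    ∃ g ∈ ModPlus n, w = g * c * g⁻¹ := by
  have h' : ∀ i j : ℕ, i ≤ n + 1 → j ≤ n + 1 →
      Q (w ^ i • x) (w ^ j • x) = Q (c ^ i • y) (c ^ j • y) := by
    intro i j hi hj
    rw [lorentzForm_pow_pow, lorentzForm_pow_pow]
    exact h _ (by omega)
  -- The pairings of w x i with x j involve exponents up to n + 1, one more than the Gram matrix.
  refine exists_conj_of_basis (x := fun j => w ^ (j : ℕ) • x) (fun i j => h' _ _ ?_ ?_)
    (fun i j => ?_) hY
  · omega
  · omega
  · rw [← mul_smul, ← mul_smul, ← pow_succ', ← pow_succ']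
    exact h' _ _ (by omega) (by omega)

/-- `n + 2` vectors of `ℤ^(n+1)` have a singular Gram matrix. -/
theorem gram_mul_ne {n : ℕ} (x : Fin (n + 2) → H₂ n)
    (N : Matrix (Fin (n + 2)) (Fin (n + 2)) ℤ) {m : ℤ} (hm : m ≠ 0) :
    N * (Matrix.of fun i j => Q (x i) (x j)) ≠ m • 1 := by
  intro h
  have hli : LinearIndependent ℤ x := by
    rw [Fintype.linearIndependent_iff]
    intro c hc
    have h1 : (Matrix.of fun i j => Q (x i) (x j)).mulVec c = 0 := by
      ext i
      rw [Matrix.mulVec, dotProduct]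
      simp only [Matrix.of_apply]
      have h2 := congrArg (fun v => Q (x i) v) hc
      simp only [map_sum, map_smul, smul_eq_mul, map_zero] at h2
      rw [Pi.zero_apply, ← h2]
      exact Finset.sum_congr rfl fun j _ => mul_comm _ _
    have h2 : (m • (1 : Matrix (Fin (n + 2)) (Fin (n + 2)) ℤ)).mulVec c = 0 := by
      rw [← h, ← Matrix.mulVec_mulVec, h1, Matrix.mulVec_zero]
    rw [Matrix.smul_mulVec, Matrix.one_mulVec] at h2
    exact fun i => congrFun ((smul_eq_zero.1 h2).resolve_left hm) i
  have := hli.fintype_card_le_finrank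
  simp at this

/-! ### Positive semidefinite Toeplitz sequences -/

/-- `∑ᵢ cᵢ t(k+i)`. -/
def toeplitzDot (t : ℕ → ℤ) : ℕ → List ℤ → ℤ
  | _, [] => 0
  | k, a :: c => a * t k + toeplitzDot t (k + 1) c

/-- The value at `c` of the quadratic form with the Toeplitz matrix `t(|i-j|)`. -/
def toeplitzForm (t : ℕ → ℤ) : List ℤ → ℤ
  | [] => 0
  | a :: c => a * (a * t 0 + 2 * toeplitzDot t 1 c) + toeplitzForm t c

theorem toeplitzDot_congr {t t' : ℕ → ℤ} {m : ℕ} (h : ∀ i < m, t i = t' i) (c : List ℤ) (k : ℕ)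
    (hc : k + c.length ≤ m) : toeplitzDot t k c = toeplitzDot t' k c := by
  induction c generalizing k with
  | nil => rfl
  | cons a c ih =>
    rw [List.length_cons] at hc
    rw [toeplitzDot, toeplitzDot, h k (by omega), ih (k + 1) (by omega)]

theorem toeplitzForm_congr {t t' : ℕ → ℤ} {m : ℕ} (h : ∀ i < m, t i = t' i) (c : List ℤ)
    (hc : c.length ≤ m) : toeplitzForm t c = toeplitzForm t' c := by
  induction c with
  | nil => rfl
  | cons a c ih =>
    rw [List.length_cons] at hc
    rw [toeplitzForm, toeplitzForm, h 0 (by omega), ih (by omega),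
      toeplitzDot_congr h c 1 (by omega)]

/-- A step of the Levinson recursion, in integers: given the sequence `l` and the predictor `p` with
error `e` for `l` without its last term, return a test vector for the Toeplitz form of `l`, and the
new predictor and error. -/
def levinsonStep (l p : List ℤ) (e : ℤ) : List ℤ × List ℤ × ℤ :=
  let d := (List.zipWith (· * ·) p l.reverse).sum
  -- When the error vanishes, p is isotropic. The test vector then has value t₀(1 − 2|d|), which is
  -- negative for t₀ > 0 unless d = 0, so the next term is forced. Otherwise the usual combination
  -- of p and its reversal is the next predictor, and serves itself as test vector.
  if e = 0 then
    (p.map (-d.sign * l.headD 0 * ·) ++ List.replicate (l.length - 1 - p.length) 0 ++ [1], p, 0)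
  else
    let q := List.zipWith (fun x y => e * x - d * y) (p ++ [0]) (0 :: p.reverse)
    let g := q.foldr (fun x y => (Int.gcd x y : ℤ)) 0
    let q' := q.map (· / g)
    (q', q', (List.zipWith (· * ·) q' l).sum)

/-- The extensions by a term from `R` of an initial segment of a sequence which satisfy `P` and pass
the test of `levinsonStep`. -/
def toeplitzExtend (R : List ℤ) (P : List ℤ → Bool) (ν : List ℤ × List ℤ × ℤ) :
    List (List ℤ × List ℤ × ℤ) :=
  R.filterMap fun a =>
    let l := ν.1 ++ [a]
    if P l then
      let s := levinsonStep l ν.2.1 ν.2.2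
      if s.1.length ≤ l.length ∧ toeplitzForm (fun i => l.getD i 0) s.1 < 0 then none
      else some (l, s.2)
    else none

/-- The candidates for the initial segments of length `k + 1`. -/
def toeplitzSearch (R : List ℤ) (P : List ℤ → Bool) (t₀ : ℤ) : ℕ → List (List ℤ × List ℤ × ℤ)
  | 0 => [([t₀], [1], t₀)]
  | k + 1 => (toeplitzSearch R P t₀ k).flatMap (toeplitzExtend R P)

/-- A prefix is discarded only if it violates P or if an explicit integer vector gives its Toeplitz
form a negative value. So soundness does not depend on the test vectors being well chosen. -/
theorem mem_toeplitzSearch {R : List ℤ} {P : List ℤ → Bool} {t : ℕ → ℤ} (hR : ∀ k, t k ∈ R)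
    (hP : ∀ k, P ((List.range (k + 1)).map t) = true) (ht : ∀ c, 0 ≤ toeplitzForm t c) (k : ℕ) :
    (List.range (k + 1)).map t ∈ (toeplitzSearch R P (t 0) k).map Prod.fst := by
  induction k with
  | zero => simp [toeplitzSearch]
  | succ k ih =>
    obtain ⟨⟨l, ν⟩, hν, rfl⟩ := List.mem_map.1 ih
    simp only [toeplitzSearch, List.mem_map, List.mem_flatMap]
    have hl : (List.range (k + 1)).map t ++ [t (k + 1)] = (List.range (k + 1 + 1)).map t := by
      rw [List.range_succ (n := k + 1), List.map_append]; rfl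
    refine ⟨((List.range (k + 1 + 1)).map t,
      (levinsonStep ((List.range (k + 1 + 1)).map t) ν.1 ν.2).2), ⟨_, hν, ?_⟩, rfl⟩
    rw [toeplitzExtend, List.mem_filterMap]
    refine ⟨t (k + 1), hR _, ?_⟩
    simp only [hl, hP, if_true]
    rw [if_neg]
    rintro ⟨h1, h2⟩
    refine absurd h2 (not_lt.2 ?_)
    rw [← toeplitzForm_congr (t := t) (m := k + 1 + 1) _ _ (by simpa using h1)]
    · exact ht _
    · intro i hi
      simp [List.getD_eq_getElem?_getD, hi]

/-! ### Defect sequences of orbits, and lines -/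

section Pairing

variable {n : ℕ} {w : ModGroup n}

/-- The combination `∑ᵢ cᵢ wⁱ x`. -/
def orbitSum (w : ModGroup n) (x : H₂ n) : List ℤ → H₂ n
  | [] => 0
  | a :: c => a • x + w • orbitSum w x c

theorem orbitSum_canonicalClass (hw : w ∈ weylGroup n) (x : H₂ n) (c : List ℤ) :
    Q (orbitSum w x c) (canonicalClass n) = c.sum * Q x (canonicalClass n) := by
  induction c with
  | nil => simp [orbitSum]
  | cons a c ih =>
    have h := lorentzForm_smul_smul w (orbitSum w x c) (canonicalClass n)
    rw [mem_weylGroup.1 hw] at h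
    rw [orbitSum, LinearMap.map_add₂, LinearMap.map_smul₂, h, ih, List.sum_cons, smul_eq_mul]
    ring

/-- `d² Q(x', wᵏ x') / -d`, where `x'` is the projection of `x` to `K^⊥` and `d = K²`. -/
def defect (w : ModGroup n) (x : H₂ n) (k : ℕ) : ℤ :=
  Q x (canonicalClass n) * Q x (canonicalClass n) - (9 - n) * Q x (w ^ k • x)

theorem toeplitzDot_defect (x : H₂ n) (k : ℕ) (c : List ℤ) :
    toeplitzDot (defect w x) k c =
      Q x (canonicalClass n) * (c.sum * Q x (canonicalClass n)) -
        (9 - n) * Q x (w ^ k • orbitSum w x c) := by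
  induction c generalizing k with
  | nil => simp [toeplitzDot, orbitSum]
  | cons a c ih =>
    rw [toeplitzDot, ih, orbitSum, defect, smul_add, smul_zsmul', ← mul_smul, ← pow_succ, map_add,
      LinearMap.map_smul, List.sum_cons, smul_eq_mul]
    ring

/-- With S = ∑ cᵢ wⁱ x, the value is −(9 − n) times the square of the projection of S to K^⊥, which
`mul_sq_le` shows to be nonnegative. -/
theorem toeplitzForm_defect (hw : w ∈ weylGroup n) (x : H₂ n) (c : List ℤ) :
    toeplitzForm (defect w x) c =
      Q (orbitSum w x c) (canonicalClass n) * Q (orbitSum w x c) (canonicalClass n) -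
        (9 - n) * Q (orbitSum w x c) (orbitSum w x c) := by
  induction c with
  | nil => simp [toeplitzForm, orbitSum]
  | cons a c ih =>
    rw [toeplitzForm, ih, toeplitzDot_defect, pow_one, orbitSum_canonicalClass hw,
      orbitSum_canonicalClass hw, orbitSum, defect, pow_zero, one_smul, List.sum_cons]
    simp only [map_add, map_smul, LinearMap.add_apply, LinearMap.smul_apply, smul_eq_mul,
      lorentzForm_smul_smul, lorentzForm_comm (w • orbitSum w x c) x]
    ring

/-- The reverse Cauchy-Schwarz inequality for the canonical class. -/
theorem mul_sq_le (hn8 : n ≤ 8) (v : H₂ n) :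
    (9 - n) * Q v v ≤ Q v (canonicalClass n) * Q v (canonicalClass n) := by
  set K := canonicalClass n with hK
  have hd : (0 : ℤ) < 9 - n := by omega
  have hKK : Q K K = 9 - n := canonicalClass_sq n
  have h := lorentzForm_nonpos_of_orthogonal (x := ((9 : ℤ) - n) • v - Q v K • K) (v := K)
    (by rw [hKK]; exact hd) (by
      rw [LinearMap.map_sub₂, LinearMap.map_smul₂, LinearMap.map_smul₂, hKK, smul_eq_mul,
        smul_eq_mul]
      ring)
  simp only [map_sub, map_smul, LinearMap.sub_apply, LinearMap.smul_apply, smul_eq_mul, hKK,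
    lorentzForm_comm K v] at h
  have h2 : ((9 : ℤ) - n) * ((9 - n) * Q v v - Q v K * Q v K) ≤ 0 := by linarith
  have := nonpos_of_mul_nonpos_right h2 hd
  linarith

theorem eq_of_mul_sq_eq (hn8 : n ≤ 8) {v : H₂ n} (h0 : Q v (canonicalClass n) = 0)
    (h : 0 ≤ Q v v) : v = 0 := by
  by_contra hv
  refine absurd (lorentzForm_neg_of_orthogonal (v := canonicalClass n) ?_ h0 hv) (not_lt.2 h)
  rw [canonicalClass_sq]
  omega

theorem toeplitzForm_defect_nonneg (hn8 : n ≤ 8) (hw : w ∈ weylGroup n) (x : H₂ n) (c : List ℤ) :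
    0 ≤ toeplitzForm (defect w x) c := by
  rw [toeplitzForm_defect hw, sub_nonneg]
  exact mul_sq_le hn8 _

theorem defect_sub {N : ℕ} (hN : w ^ N = 1) (x : H₂ n) {k : ℕ} (hk : k ≤ N) :
    defect w x (N - k) = defect w x k := by
  rw [defect, defect]
  congr 2
  have h := lorentzForm_smul_smul (w ^ k) x (w ^ (N - k) • x)
  rw [← mul_smul, ← pow_add, Nat.add_sub_cancel' hk, hN, one_smul, lorentzForm_comm] at h
  exact h.symm

/-- The sum of w^k x over a period is fixed, hence rationally a multiple of K, and the degree of x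
determines which. -/
theorem sum_defect (hell : IsElliptic w) (hw : w ∈ weylGroup n) {N : ℕ} (hN : w ^ N = 1)
    (x : H₂ n) : ∑ k ∈ Finset.range N, defect w x k = 0 := by
  set S := ∑ k ∈ Finset.range N, w ^ k • x with hS
  have hwS : w • S = S := by
    rw [hS, smul_sum']
    simp only [smul_smul, ← pow_succ']
    have h1 := Finset.sum_range_succ (fun k => w ^ k • x) N
    rw [Finset.sum_range_succ', hN, pow_zero] at h1
    exact add_right_cancel h1
  have hSK : Q S (canonicalClass n) = N * Q x (canonicalClass n) := by
    have hk : ∀ k : ℕ, Q (w ^ k • x) (canonicalClass n) = Q x (canonicalClass n) := fun k => by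
      conv_lhs => rw [← mem_weylGroup.1 (pow_mem hw k), lorentzForm_smul_smul]
    rw [hS, map_sum, LinearMap.sum_apply]
    simp only [hk, Finset.sum_const, Finset.card_range, nsmul_eq_mul]
  have h1 := congrArg (fun v => Q x v) (hell.fixed hw hwS)
  simp only [LinearMap.map_smul, hSK, smul_eq_mul] at h1
  rw [hS, map_sum] at h1
  simp only [defect, Finset.sum_sub_distrib, ← Finset.mul_sum, h1]
  rw [Finset.sum_const, Finset.card_range, nsmul_eq_mul]
  ring

/-- A line: a class of square `-1` and degree `1`. -/
structure IsLine (e : H₂ n) : Prop where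
  sq : Q e e = -1
  deg : Q e (canonicalClass n) = -1

theorem IsLine.smul (hw : w ∈ weylGroup n) {e : H₂ n} (he : IsLine e) : IsLine (w • e) :=
  ⟨by rw [lorentzForm_smul_smul, he.sq],
    by rw [← mem_weylGroup.1 hw, lorentzForm_smul_smul, he.deg]⟩

theorem isLine_exc (i : Fin n) : IsLine (exc i : H₂ n) :=
  ⟨by rw [lorentzForm_exc_exc, if_pos rfl],
    by rw [lorentzForm_comm, lorentzForm_exc, canonicalClass_succ]⟩

/-- e − f lies in the negative definite K^⊥ and has square −2 − 2Q(e, f) ≥ 0. -/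
theorem IsLine.eq_of_pairing_neg (hn8 : n ≤ 8) {e f : H₂ n} (he : IsLine e) (hf : IsLine f)
    (h : Q e f < 0) : e = f := by
  rw [← sub_eq_zero]
  apply eq_of_mul_sq_eq hn8
  · rw [LinearMap.map_sub₂, he.deg, hf.deg, sub_self]
  · simp only [map_sub, LinearMap.sub_apply, he.sq, hf.sq, lorentzForm_comm f e]
    omega

theorem IsLine.pairing_le (hn8 : n ≤ 8) {e f : H₂ n} (he : IsLine e) (hf : IsLine f) :
    (9 - n) * Q e f ≤ 11 - n := by
  have h := mul_sq_le hn8 (e + f)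
  simp only [map_add, LinearMap.add_apply, he.sq, hf.sq, lorentzForm_comm f e, he.deg, hf.deg] at h
  linarith

end Pairing

/-- 3H = ∑ Eᵢ − K, and the lattice has no torsion. -/
theorem eq_one_of_forall_exc {n : ℕ} {w : ModGroup n} (hw : w ∈ weylGroup n)
    (h : ∀ i : Fin n, w • (exc i : H₂ n) = exc i) : w = 1 := by
  have hH : w • (hyp n : H₂ n) = hyp n := by
    have h1 : (3 : ℤ) • (hyp n : H₂ n) = ∑ i : Fin n, exc i - canonicalClass n := by
      rw [canonicalClass]; module
    have h2 : (3 : ℤ) • (w • (hyp n : H₂ n)) = (3 : ℤ) • hyp n := by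
      rw [← smul_zsmul', h1, smul_sub, smul_sum', mem_weylGroup.1 hw]
      simp only [h]
    exact smul_right_injective _ three_ne_zero h2
  apply ModGroup.ext
  intro x
  have : (w : H₂ n ≃ₗ[ℤ] H₂ n).toLinearMap = LinearMap.id := by
    apply LinearMap.pi_ext'
    intro i
    ext1
    refine Fin.cases ?_ (fun i => ?_) i
    · exact hH
    · exact h i
  exact congrArg (fun f => f x) this

/-! ### Pairings of lines in their orbits, for `n ≤ 7` -/

/-- The constraints on the sequence of defects of a line, not fixed by `w ^ m`, under an elliptic
element `w` of order `N`. -/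
def lineConstraint (N m : ℕ) (t₀ : ℤ) (l : List ℤ) : Bool :=
  !(l.length == m + 1 && l.getD m 0 == t₀) &&
  -- This is t_k = t_{N−k} for the last index k. The default is t_k itself, so the test is vacuous
  -- while t_{N−k} is not yet known.
  !(Nat.ble l.length (N + 1) && l.getD (l.length - 1) 0 !=
    l.getD (N - (l.length - 1)) (l.getD (l.length - 1) 0)) &&
  !(l.length == N && l.sum != 0)

theorem list_sum_map_range (f : ℕ → ℤ) (k : ℕ) :
    ((List.range k).map f).sum = ∑ i ∈ Finset.range k, f i := rfl

/-- A line moved by w^m does not pair negatively with its image, hence t_m ≠ t₀. The other two tests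
are the symmetry `defect_sub` and the vanishing `sum_defect` over a period. -/
theorem lineConstraint_defect {n N m : ℕ} (hn8 : n ≤ 8) {w : ModGroup n} (hw : w ∈ weylGroup n)
    (hell : IsElliptic w) (hN : w ^ N = 1) {e : H₂ n} (he : IsLine e) (hm : w ^ m • e ≠ e) (k : ℕ) :
    lineConstraint N m (defect w e 0) ((List.range (k + 1)).map (defect w e)) = true := by
  have hd : (9 : ℤ) - n ≠ 0 := by omega
  have hget : ∀ i a, i ≤ k → ((List.range (k + 1)).map (defect w e)).getD i a = defect w e i := by
    intro i a hi
    have : i < k + 1 := by omega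
    simp [List.getD_eq_getElem?_getD, this]
  have hget' : ∀ i, k < i → ((List.range (k + 1)).map (defect w e)).getD i (defect w e k) =
      defect w e k := by
    intro i hi
    have : ¬ i < k + 1 := by omega
    simp [List.getD_eq_getElem?_getD, this]
  simp only [lineConstraint, List.length_map, List.length_range, Nat.add_sub_cancel,
      hget k _ le_rfl,
    Bool.and_eq_true, Bool.not_eq_true', Bool.and_eq_false_iff, list_sum_map_range]
  refine ⟨⟨?_, ?_⟩, ?_⟩
  · rcases eq_or_ne k m with rfl | hkm
    · right
      rw [hget k _ le_rfl, beq_eq_false_iff_ne]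
      intro h
      simp only [defect, pow_zero, one_smul, sub_right_inj, mul_right_inj' hd] at h
      refine hm (IsLine.eq_of_pairing_neg hn8 he (he.smul (pow_mem hw k)) ?_).symm
      rw [h, he.sq]
      norm_num
    · left
      simpa using hkm
  · rcases le_or_gt k N with h | h
    · right
      rw [bne_eq_false_iff_eq]
      rcases le_or_gt (N - k) k with h' | h'
      · rw [hget _ _ h', defect_sub hN e h]
      · rw [hget' _ h']
    · left
      rw [Bool.eq_false_iff, Ne, Nat.ble_eq]
      omega
  · rcases eq_or_ne (k + 1) N with rfl | h
    · right
      rw [bne_eq_false_iff_eq, sum_defect hell hw hN]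
    · left
      simpa using h

theorem defect_mem_of_isLine {n : ℕ} (hn8 : n ≤ 8) {w : ModGroup n} (hw : w ∈ weylGroup n)
    {e : H₂ n} (he : IsLine e) (k : ℕ) :
    ∃ b : ℤ, -1 ≤ b ∧ (9 - n) * b ≤ 11 - n ∧ defect w e k = 1 - (9 - n) * b := by
  have he' := he.smul (pow_mem hw k)
  refine ⟨Q e (w ^ k • e), ?_, he.pairing_le hn8 he', by rw [defect, he.deg]; norm_num⟩
  by_contra! h
  have h1 := he.eq_of_pairing_neg hn8 he' (by omega)
  rw [← h1, he.sq] at h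
  omega

theorem exists_line_moved {n : ℕ} {w : ModGroup n} (hw : w ∈ weylGroup n) {m : ℕ}
    (h : w ^ m ≠ 1) : ∃ e : H₂ n, IsLine e ∧ w ^ m • e ≠ e := by
  by_contra! h'
  exact h (eq_one_of_forall_exc (pow_mem hw m) fun i => h' _ (isLine_exc i))

theorem exists_conj_of_defect {n : ℕ} (hn8 : n ≤ 8) {w c : ModGroup n} {x y : H₂ n}
    (hK : Q x (canonicalClass n) = Q y (canonicalClass n))
    (h : ∀ k ≤ n + 1, defect w x k = defect c y k)
    {Y' : Matrix (Fin (n + 1)) (Fin (n + 1)) ℤ}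
    (hY : (Matrix.of fun i (j : Fin (n + 1)) => (c ^ (j : ℕ) • y) i) * Y' = 1) :
    ∃ g ∈ ModPlus n, w = g * c * g⁻¹ := by
  refine exists_conj_of_cyclic (x := x) (fun k hk => ?_) hY
  have h1 := h k hk
  rw [defect, defect, hK, sub_right_inj] at h1
  exact mul_left_cancel₀ (by omega) h1

theorem exists_conj_of_map_eq {n N : ℕ} (hn8 : n ≤ 8) (hN : n + 1 < N) {w c : ModGroup n}
    {x y : H₂ n} {l : List ℤ} (hl : (List.range N).map (defect w x) = l)
    (hK : Q x (canonicalClass n) = Q y (canonicalClass n))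
    (h : ∀ k ≤ n + 1, l.getD k 0 = defect c y k)
    {Y' : Matrix (Fin (n + 1)) (Fin (n + 1)) ℤ}
    (hY : (Matrix.of fun i (j : Fin (n + 1)) => (c ^ (j : ℕ) • y) i) * Y' = 1) :
    ∃ g ∈ ModPlus n, w = g * c * g⁻¹ := by
  refine exists_conj_of_defect hn8 hK (fun k hk => ?_) hY
  rw [← h k hk, ← hl]
  have : k < N := by omega
  simp [List.getD_eq_getElem?_getD, this]

/-! ### Coxeter elements -/

theorem pow_eq_one_of_forall_single {n : ℕ} {c : ModGroup n} {N : ℕ}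
    (h : ∀ i, c ^ N • (Pi.single i 1 : H₂ n) = Pi.single i 1) : c ^ N = 1 := by
  apply ModGroup.ext
  intro x
  have : ((c ^ N : ModGroup n) : H₂ n ≃ₗ[ℤ] H₂ n).toLinearMap = LinearMap.id := by
    apply LinearMap.pi_ext'
    intro i
    ext1
    exact h i
  exact congrArg (fun f => f x) this

theorem orderOf_eq_of_forall_single {n : ℕ} {c : ModGroup n} {N : ℕ} (hN : 0 < N)
    (h : ∀ i, c ^ N • (Pi.single i 1 : H₂ n) = Pi.single i 1)
    (h' : ∀ m < N, 0 < m → ∃ i, c ^ m • (Pi.single i 1 : H₂ n) ≠ Pi.single i 1) :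
    orderOf c = N := by
  refine (orderOf_eq_iff hN).2 ⟨pow_eq_one_of_forall_single h, fun m hm hm0 h1 => ?_⟩
  obtain ⟨i, hi⟩ := h' m hm hm0
  exact hi (by rw [h1, one_smul])

/-- The hypothesis states on a basis that averaging over the powers of c is the orthogonal
projection to K. On a fixed vector the average is the vector itself. -/
theorem isElliptic_of_forall_single {n : ℕ} (hn8 : n ≤ 8) {c : ModGroup n} {N : ℕ} (hN : 0 < N)
    (h : ∀ i, ((9 : ℤ) - n) • ∑ k ∈ Finset.range N, c ^ k • (Pi.single i 1 : H₂ n) =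
      (N * Q (Pi.single i 1) (canonicalClass n)) • canonicalClass n) : IsElliptic c := by
  intro x hx hK
  have hlin : ((9 : ℤ) - n) • ∑ k ∈ Finset.range N,
      ((c ^ k : ModGroup n) : H₂ n ≃ₗ[ℤ] H₂ n).toLinearMap =
        (N : ℤ) • LinearMap.smulRight ((lorentzForm ℤ n).flip (canonicalClass n))
          (canonicalClass n) := by
    apply LinearMap.pi_ext'
    intro i
    ext1
    have := h i
    simp only [LinearMap.comp_apply, LinearMap.smul_apply, LinearMap.sum_apply,
      LinearMap.smulRight_apply, LinearMap.BilinForm.flip_apply, LinearMap.single_apply, ← mul_smul]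
    exact this
  have hck : ∀ k : ℕ, ((c ^ k : ModGroup n) : H₂ n ≃ₗ[ℤ] H₂ n) x = x := by
    intro k
    change c ^ k • x = x
    induction k with
    | zero => simp
    | succ k ih => rw [pow_succ, mul_smul, hx, ih]
  have h1 := congrArg (fun f => f x) hlin
  simp only [LinearMap.smul_apply, LinearMap.sum_apply, LinearMap.smulRight_apply,
    LinearMap.BilinForm.flip_apply, hK, zero_smul, smul_zero, LinearEquiv.coe_coe, hck,
        Finset.sum_const,
    Finset.card_range] at h1
  rw [← Nat.cast_smul_eq_nsmul ℤ, smul_smul] at h1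
  exact (smul_eq_zero.1 h1).resolve_left (mul_ne_zero (by omega) (by omega))

theorem orderOf_coxeterElement {n : ℕ} (hn : 3 ≤ n) (hn8 : n ≤ 8) :
    orderOf (coxeterElement hn) = coxeterOrder n := by
  have h3 := hn
  revert hn
  interval_cases n <;> intro hn
  all_goals
    refine orderOf_eq_of_forall_single (by decide) ?_ ?_ <;> revert hn <;> decide +kernel

theorem isElliptic_coxeterElement {n : ℕ} (hn : 3 ≤ n) (hn8 : n ≤ 8) :
    IsElliptic (coxeterElement hn) := by
  refine isElliptic_of_forall_single (N := coxeterOrder n) hn8 ?_ ?_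
  · interval_cases n <;> decide
  · have h3 := hn
    revert hn
    interval_cases n <;> decide +kernel

/-! ### Elements of Coxeter order for `n ≤ 7` -/

/-- In this and the next four searches the terms are 1 − (9 − n)b, where b is a pairing of two
lines: −1 ≤ b ≤ 1, or b ≤ 2 for n = 7. The lists run over a full period up to t_N = t₀, and m is a
proper divisor of N. -/
theorem toeplitzSearch_three : ∀ l ∈ (toeplitzSearch [7, 1, -5] (lineConstraint 6 1 7) 7 6).map
    Prod.fst, l ∈ ([[7, -5, 1, 1, 1, -5, 7]] : List (List ℤ)) := by
  decide +kernel

theorem toeplitzSearch_four : ∀ l ∈ (toeplitzSearch [6, 1, -4] (lineConstraint 5 1 6) 6 5).map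
    Prod.fst, l ∈ ([[6, 1, -4, -4, 1, 6], [6, -4, 1, 1, -4, 6]] : List (List ℤ)) := by
  decide +kernel

theorem toeplitzSearch_five : ∀ l ∈ (toeplitzSearch [5, 1, -3] (lineConstraint 8 4 5) 5 8).map
    Prod.fst, l ∈ ([[5, 1, 1, -3, -3, -3, 1, 1, 5], [5, -3, 1, 1, -3, 1, 1, -3,
        5]] : List (List ℤ)) := by
  decide +kernel

theorem toeplitzSearch_six : ∀ l ∈ (toeplitzSearch [4, 1, -2] (lineConstraint 12 6 4) 4 12).map
    Prod.fst, l ∈ ([[4, 1, 1, 1, -2, -2, -2, -2, -2, 1, 1, 1, 4], [4, -2, 1, 1, -2, 1, -2, 1, -2,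
        1, 1, -2, 4]] : List (List ℤ)) := by
  decide +kernel

theorem toeplitzSearch_seven : ∀ l ∈
    (toeplitzSearch [3, 1, -1, -3] (lineConstraint 18 6 3) 3 18).map
    Prod.fst, l ∈ ([[3, 1, 1, 1, 1, -1, -1, -1, -1, -3, -1, -1, -1, -1, 1, 1, 1, 1, 3], [3, -1, 1,
        1, -1, 1, -1, -1, 1, -3, 1, -1, -1, 1, -1, 1, 1, -1, 3], [3, -1, -1, 1, 1, -1, -1, 1, 1,
        -3, 1, 1, -1, -1, 1, 1, -1, -1, 3], [3, -1, 1, -1, 1, -1, 1, -1, 1, -3, 1, -1, 1, -1, 1,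
        -1, 1, -1, 3]] : List (List ℤ)) := by
  decide +kernel

theorem map_defect_mem {n N m : ℕ} (hn8 : n ≤ 8) {w : ModGroup n} (hw : w ∈ weylGroup n)
    (hell : IsElliptic w) (hN : w ^ N = 1) {e : H₂ n} (he : IsLine e) (hm : w ^ m • e ≠ e)
    {R : List ℤ} (hR : ∀ k, defect w e k ∈ R) {t₀ : ℤ} (ht₀ : t₀ = 10 - n) :
    (List.range (N + 1)).map (defect w e) ∈
      (toeplitzSearch R (lineConstraint N m t₀) t₀ N).map Prod.fst := by
  have h0 : defect w e 0 = t₀ := by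
    rw [defect, pow_zero, one_smul, he.sq, he.deg, ht₀]; ring
  rw [← h0]
  exact mem_toeplitzSearch hR (lineConstraint_defect hn8 hw hell hN he hm)
    (toeplitzForm_defect_nonneg hn8 hw e) N

/-- Choose a line moved by w^m. Each sequence that survives the search, apart from one for n = 7, is
that of an explicit line y under the Coxeter element. The orbit of y contains a basis of the
lattice, as the inverse matrix `Y'` certifies. -/
theorem exists_conj_coxeterElement {n : ℕ} (hn : 3 ≤ n) (hn7 : n ≤ 7) {w : ModGroup n}
    (hw : w ∈ weylGroup n) (hell : IsElliptic w) (ho : orderOf w = coxeterOrder n) :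
    ∃ g ∈ ModPlus n, w = g * coxeterElement hn * g⁻¹ := by
  have hn8 : n ≤ 8 := by omega
  have hN : w ^ coxeterOrder n = 1 := ho ▸ pow_orderOf_eq_one w
  have hmoved : ∀ m, 0 < m → m < coxeterOrder n → ∃ e : H₂ n, IsLine e ∧ w ^ m • e ≠ e :=
    fun m h0 hm => exists_line_moved hw (pow_ne_one_of_lt_orderOf h0.ne' (ho ▸ hm))
  have h3 := hn
  revert hn
  interval_cases n <;> intro hn
  · obtain ⟨e, he, hm⟩ := hmoved 1 (by decide) (by decide)
    have hR : ∀ k, defect w e k ∈ ([7, 1, -5] : List ℤ) := by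
      intro k
      obtain ⟨b, h1, h2, h3⟩ := defect_mem_of_isLine hn8 hw he k
      rw [h3]
      have hb : b ≤ 1 := by norm_num at h2; omega
      interval_cases b <;> decide
    have hl := toeplitzSearch_three _ (map_defect_mem hn8 hw hell hN he hm hR (by norm_num))
    simp only [List.mem_cons, List.not_mem_nil, or_false] at hl
    exact exists_conj_of_map_eq (y := exc 2) hn8 (by decide) hl
        (he.deg.trans (by decide +kernel)) (by revert hn; decide +kernel)
        (Y' := !![1, 1, 0, 1; 1, 1, 0, 0; 1, 0, 1, 0; 0, -1, 0, 0])
        (by revert hn; decide +kernel)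
  · obtain ⟨e, he, hm⟩ := hmoved 1 (by decide) (by decide)
    have hR : ∀ k, defect w e k ∈ ([6, 1, -4] : List ℤ) := by
      intro k
      obtain ⟨b, h1, h2, h3⟩ := defect_mem_of_isLine hn8 hw he k
      rw [h3]
      have hb : b ≤ 1 := by norm_num at h2; omega
      interval_cases b <;> decide
    have hl := toeplitzSearch_four _ (map_defect_mem hn8 hw hell hN he hm hR (by norm_num))
    simp only [List.mem_cons, List.not_mem_nil, or_false] at hl
    rcases hl with hl | hl
    · exact exists_conj_of_map_eq (y := exc 3) hn8 (by decide) hl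
        (he.deg.trans (by decide +kernel)) (by revert hn; decide +kernel)
        (Y' := !![1, 0, 1, 0, 1; 0, 0, -1, 0, 0; 1, 1, 1, 0, 0; 0, -1, 0, 0, 0; 1, 1, 0, 1, 0])
        (by revert hn; decide +kernel)
    · exact exists_conj_of_map_eq (y := exc 1) hn8 (by decide) hl
        (he.deg.trans (by decide +kernel)) (by revert hn; decide +kernel)
        (Y' := !![1, 0, 1, 1, 0; 1, 0, 0, 1, 1; 1, 1, 0, 0, 1; 0, 0, 0, -1, 0; 0, 0, 0, 0, -1])
        (by revert hn; decide +kernel)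
  · obtain ⟨e, he, hm⟩ := hmoved 4 (by decide) (by decide)
    have hR : ∀ k, defect w e k ∈ ([5, 1, -3] : List ℤ) := by
      intro k
      obtain ⟨b, h1, h2, h3⟩ := defect_mem_of_isLine hn8 hw he k
      rw [h3]
      have hb : b ≤ 1 := by norm_num at h2; omega
      interval_cases b <;> decide
    have hl := toeplitzSearch_five _ (map_defect_mem hn8 hw hell hN he hm hR (by norm_num))
    simp only [List.mem_cons, List.not_mem_nil, or_false] at hl
    rcases hl with hl | hl
    · exact exists_conj_of_map_eq (y := exc 4) hn8 (by decide) hl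
        (he.deg.trans (by decide +kernel)) (by revert hn; decide +kernel)
        (Y' := !![1, 0, 0, 1, 0, 1; 1, 1, 0, 0, 1, 0; 0, 0, 1, -1, 0, 0; -1, -1, -1, 0, -1, 0; 1,
            1, 0, 1, 0, 0; 1, 0, 1, 0, 1, 0])
        (by revert hn; decide +kernel)
    · exact exists_conj_of_map_eq (y := exc 1) hn8 (by decide) hl
        (he.deg.trans (by decide +kernel)) (by revert hn; decide +kernel)
        (Y' := !![1, 0, 1, 1, 0, 0; 1, 0, 0, 1, 1, 0; 1, 1, 0, 0, 1, 1; 0, 0, 0, -1, 0, 1; 0, 0, 0,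
            0, -1, 0; 0, 0, 0, 0, 0, -1])
        (by revert hn; decide +kernel)
  · obtain ⟨e, he, hm⟩ := hmoved 6 (by decide) (by decide)
    have hR : ∀ k, defect w e k ∈ ([4, 1, -2] : List ℤ) := by
      intro k
      obtain ⟨b, h1, h2, h3⟩ := defect_mem_of_isLine hn8 hw he k
      rw [h3]
      have hb : b ≤ 1 := by norm_num at h2; omega
      interval_cases b <;> decide
    have hl := toeplitzSearch_six _ (map_defect_mem hn8 hw hell hN he hm hR (by norm_num))
    simp only [List.mem_cons, List.not_mem_nil, or_false] at hl
    rcases hl with hl | hl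
    · exact exists_conj_of_map_eq (y := exc 5) hn8 (by decide) hl
        (he.deg.trans (by decide +kernel)) (by revert hn; decide +kernel)
        (Y' := !![2, 1, 1, 1, 1, 0, 1; 1, 0, 0, 0, 1, 1, 0; 0, 0, 0, 0, -1, 1, 0; -2, -1, -1, -1,
            -1, -1, 0; 0, 1, 0, 0, 0, -1, 0; 1, 0, 1, 0, 1, 0, 0; 1, 0, 0, 1, 0, 1, 0])
        (by revert hn; decide +kernel)
    · exact exists_conj_of_map_eq (y := exc 1) hn8 (by decide) hl
        (he.deg.trans (by decide +kernel)) (by revert hn; decide +kernel)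
        (Y' := !![1, 0, 1, 1, 0, 0, 0; 1, 0, 0, 1, 1, 0, 0; 1, 1, 0, 0, 1, 1, 0; 0, 0, 0, -1, 0, 1,
            1; 0, 0, 0, 0, -1, 0, 1; 0, 0, 0, 0, 0, -1, 0; 0, 0, 0, 0, 0, 0, -1])
        (by revert hn; decide +kernel)
  · obtain ⟨e, he, hm⟩ := hmoved 6 (by decide) (by decide)
    have hR : ∀ k, defect w e k ∈ ([3, 1, -1, -3] : List ℤ) := by
      intro k
      obtain ⟨b, h1, h2, h3⟩ := defect_mem_of_isLine hn8 hw he k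
      rw [h3]
      have hb : b ≤ 2 := by norm_num at h2; omega
      interval_cases b <;> decide
    have hl := toeplitzSearch_seven _ (map_defect_mem hn8 hw hell hN he hm hR (by norm_num))
    simp only [List.mem_cons, List.not_mem_nil, or_false] at hl
    rcases hl with hl | hl | hl | hl
    · exact exists_conj_of_map_eq (y := exc 6) hn8 (by decide) hl
        (he.deg.trans (by decide +kernel)) (by revert hn; decide +kernel)
        (Y' := !![2, 0, 1, 1, 1, 1, 0, 1; 2, 1, 0, 1, 1, 1, 1, 0; 1, 1, 1, 0, 0, 0, 1, 0; -2, -1,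
            -1, -1, -1, -1, 0, 0; -2, 0, -1, -1, -1, -1, -1, 0; -1, -1, 0, -1, 0, 0, -1, 0; 1, 0,
            0, 1, 0, 1, 0, 0; 2, 1, 1, 1, 1, 0, 1, 0])
        (by revert hn; decide +kernel)
    · exact exists_conj_of_map_eq (y := exc 1) hn8 (by decide) hl
        (he.deg.trans (by decide +kernel)) (by revert hn; decide +kernel)
        (Y' := !![1, 0, 1, 1, 0, 0, 0, 0; 1, 0, 0, 1, 1, 0, 0, 0; 1, 1, 0, 0, 1, 1, 0, 0; 0, 0, 0,
            -1, 0, 1, 1, 0; 0, 0, 0, 0, -1, 0, 1, 1; 0, 0, 0, 0, 0, -1, 0, 1; 0, 0, 0, 0, 0, 0, -1,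
            0; 0, 0, 0, 0, 0, 0, 0, -1])
        (by revert hn; decide +kernel)
    · exact exists_conj_of_map_eq (y := ![1, -1, 0, 0, -1, 0, 0, 0]) hn8 (by decide) hl
        (he.deg.trans (by decide +kernel)) (by revert hn; decide +kernel)
        (Y' := !![2, 0, 1, 2, 1, 1, 0, 0; 3, 1, 1, 2, 2, 1, 1, 0; 2, 1, 1, 0, 1, 1, 1, 1; -1, 0,
            -1, -2, -1, 0, 1, 1; -2, 0, -1, -2, -2, -1, 0, 1; -2, -1, -1, -1, -1, -1, -1, 0; 0, 0,
            0, 1, 0, 0, -1, -1; 1, 0, 1, 1, 1, 0, 0, -1])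
        (by revert hn; decide +kernel)
    -- In this sequence the even powers w^{2i} e for i < 9 would be nine pairwise orthogonal vectors
    -- of square −1 in a lattice of rank 8.
    · change (List.range (18 + 1)).map (defect w e) = _ at hl
      refine absurd ?_ (gram_mul_ne (fun i : Fin 9 => w ^ (2 * (i : ℕ)) • e) 1
        (m := -1) (by norm_num))
      rw [Matrix.one_mul]
      ext i j
      rw [Matrix.of_apply, lorentzForm_pow_pow]
      have h1 : ∀ k ≤ 18, 1 - 2 * Q e (w ^ k • e) = ([3, -1, 1, -1, 1, -1, 1, -1, 1, -3, 1, -1, 1,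
          -1, 1, -1,
          1, -1, 3] : List ℤ).getD k 0 := by
        intro k hk
        rw [← hl]
        have : k < 18 + 1 := by omega
        simp [List.getD_eq_getElem?_getD, this, defect, he.deg]
      have h2 := h1 (2 * (j : ℕ) - 2 * (i : ℕ) + (2 * (i : ℕ) - 2 * (j : ℕ))) (by omega)
      have h3 : ∀ i j : Fin 9, ([3, -1, 1, -1, 1, -1, 1, -1, 1, -3, 1, -1, 1, -1, 1, -1, 1, -1, 3] :
          List ℤ).getD (2 * (j : ℕ) - 2 * (i : ℕ) + (2 * (i : ℕ) - 2 * (j : ℕ))) 0 =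
          1 - 2 * ((-1 : ℤ) • (1 : Matrix (Fin 9) (Fin 9) ℤ)) i j := by decide +kernel
      rw [h3] at h2
      omega

section

open Polynomial

/-! ### Annihilating polynomials of elliptic elements of order `30` -/

/-- The reduction of endomorphisms to rational matrices. -/
noncomputable def rationalMatrix (n : ℕ) :
    Module.End ℤ (H₂ n) →+* Matrix (Fin (n + 1)) (Fin (n + 1)) ℚ :=
  (Int.castRingHom ℚ).mapMatrix.comp
    (LinearMap.toMatrixAlgEquiv' : Module.End ℤ (H₂ n) ≃ₐ[ℤ] _).toRingEquiv.toRingHom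

theorem rationalMatrix_injective (n : ℕ) : Function.Injective (rationalMatrix n) := by
  intro f g h
  apply LinearMap.toMatrix'.injective
  ext i j
  have h1 : ((LinearMap.toMatrix' f i j : ℤ) : ℚ) = LinearMap.toMatrix' g i j :=
    congrFun (congrFun h i) j
  exact_mod_cast h1

theorem rationalMatrix_aeval {n : ℕ} (f : Module.End ℤ (H₂ n)) (p : ℤ[X]) :
    rationalMatrix n (aeval f p) = aeval (rationalMatrix n f) (p.map (algebraMap ℤ ℚ)) := by
  rw [aeval_map_algebraMap]
  exact (aeval_algHom_apply (rationalMatrix n).toIntAlgHom f p).symm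

/-- The endomorphism of `ℤ^{1,n}` given by a mapping class. -/
def toEnd {n : ℕ} (w : ModGroup n) : Module.End ℤ (H₂ n) := (w : H₂ n ≃ₗ[ℤ] H₂ n).toLinearMap

theorem toEnd_apply {n : ℕ} (w : ModGroup n) (x : H₂ n) : toEnd w x = w • x := rfl

theorem toEnd_pow_apply {n : ℕ} (w : ModGroup n) (k : ℕ) (x : H₂ n) :
    (toEnd w ^ k) x = w ^ k • x := by
  induction k generalizing x with
  | zero => simp
  | succ k ih => rw [pow_succ, Module.End.mul_apply, ih, toEnd_apply, pow_succ, mul_smul]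

/-- The cyclotomic polynomials dividing the minimal polynomial of an endomorphism of finite
order. -/
theorem exists_annihilating_cyclotomic {n N : ℕ} (hN : 0 < N) (f : Module.End ℤ (H₂ n))
    (hf : f ^ N = 1) {v : H₂ n} (hv : v ≠ 0) (hfv : f v = v) :
    ∃ D ∈ N.divisors.powerset, 1 ∈ D ∧ ∑ d ∈ D, d.totient ≤ n + 1 ∧
      ∀ D', D ⊆ D' → aeval f (∏ d ∈ D', cyclotomic d ℤ) = 0 := by
  classical
  set A := rationalMatrix n f with hA
  set μ := minpoly ℚ A with hμ
  have hdeg : μ.natDegree ≤ n + 1 := by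
    have h1 := Matrix.charpoly_natDegree_eq_dim A
    rw [Fintype.card_fin] at h1
    rw [← h1]
    exact natDegree_le_of_dvd (Matrix.minpoly_dvd_charpoly A) A.charpoly_monic.ne_zero
  have hμ0 : μ ≠ 0 := minpoly.ne_zero (Matrix.isIntegral A)
  have hdvd : μ ∣ X ^ N - 1 := by
    apply minpoly.dvd
    rw [map_sub, map_pow, aeval_X, map_one, hA, ← map_pow, hf, map_one, sub_self]
  -- μ divides X^N − 1, a product of distinct irreducible factors Φ_d, so it divides the product of
  -- those Φ_d that divide it. The eigenvector v puts 1 in the set, and deg μ ≤ n + 1 bounds the sum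
  -- of totients.
  refine ⟨N.divisors.filter fun d => cyclotomic d ℚ ∣ μ, Finset.mem_powerset.2
    (Finset.filter_subset _ _), ?_, ?_, ?_⟩
  · rw [Finset.mem_filter, cyclotomic_one]
    refine ⟨Nat.one_mem_divisors.2 hN.ne', ?_⟩
    rw [← C_1, dvd_iff_isRoot, IsRoot.def]
    have hAv : A.mulVec (fun i => (v i : ℚ)) = fun i => (v i : ℚ) := by
      ext i
      have h1 : (LinearMap.toMatrix' f).mulVec v = v := by
        rw [← Matrix.toLin'_apply, Matrix.toLin'_toMatrix', hfv]
      have h2 := congrFun h1 i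
      have h3 : ((((LinearMap.toMatrix' f).mulVec v) i : ℤ) : ℚ) = v i := by rw [h2]
      rw [← h3]
      simp only [Matrix.mulVec, dotProduct, Int.cast_sum, Int.cast_mul]
      rfl
    have hpv : ∀ p : ℚ[X], (aeval A p).mulVec (fun i => (v i : ℚ)) =
        p.eval 1 • fun i => (v i : ℚ) := by
      intro p
      induction p using Polynomial.induction_on' with
      | add p q hp hq => rw [map_add, Matrix.add_mulVec, hp, hq, eval_add, add_smul]
      | monomial k a =>
        have : ∀ k : ℕ, (A ^ k).mulVec (fun i => (v i : ℚ)) = fun i => (v i : ℚ) := by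
          intro k
          induction k with
          | zero => simp
          | succ k ih => rw [pow_succ, ← Matrix.mulVec_mulVec, hAv, ih]
        rw [aeval_monomial, eval_monomial, one_pow, mul_one, ← Matrix.mulVec_mulVec, this,
          Algebra.algebraMap_eq_smul_one, Matrix.smul_mulVec, Matrix.one_mulVec]
    have h1 := hpv μ
    rw [hμ, minpoly.aeval, Matrix.zero_mulVec] at h1
    refine (smul_eq_zero.1 h1.symm).resolve_right fun h2 => hv ?_
    ext i
    exact Int.cast_eq_zero.1 (congrFun h2 i)
  · have h1 : ∏ d ∈ N.divisors.filter (fun d => cyclotomic d ℚ ∣ μ), cyclotomic d ℚ ∣ μ :=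
      Finset.prod_dvd_of_coprime (fun a _ b _ hab => cyclotomic.isCoprime_rat hab)
        fun d hd => (Finset.mem_filter.1 hd).2
    have h2 := natDegree_le_of_dvd h1 hμ0
    rw [natDegree_prod _ _ fun d _ => cyclotomic_ne_zero d ℚ] at h2
    simp only [natDegree_cyclotomic] at h2
    exact h2.trans hdeg
  · intro D' hD'
    have h1 : μ ∣ ∏ d ∈ N.divisors.filter (fun d => cyclotomic d ℚ ∣ μ), cyclotomic d ℚ := by
      have h2 := hdvd
      rw [← prod_cyclotomic_eq_X_pow_sub_one hN ℚ,
        ← Finset.prod_filter_mul_prod_filter_not _ (fun d => cyclotomic d ℚ ∣ μ)] at h2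
      refine IsCoprime.dvd_of_dvd_mul_right (IsCoprime.prod_right fun d hd => ?_) h2
      rw [Finset.mem_filter, Nat.mem_divisors] at hd
      exact ((cyclotomic.irreducible_rat (Nat.pos_of_dvd_of_pos hd.1.1 hN)).coprime_iff_not_dvd.2
        hd.2).symm
    apply rationalMatrix_injective
    rw [rationalMatrix_aeval, map_zero, Polynomial.map_prod]
    simp only [map_cyclotomic]
    obtain ⟨q, hq⟩ := h1.trans (Finset.prod_dvd_prod_of_subset _ _ (fun d => cyclotomic d ℚ) hD')
    rw [hq, map_mul, ← hA, minpoly.aeval, zero_mul]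

/-- The three exclusions will express that w^6, w^10 and w^15 are nontrivial; the bound 9 is the
rank of the lattice. -/
theorem divisors_thirty_cases : ∀ D ∈ (Nat.divisors 30).powerset, 1 ∈ D →
    ∑ d ∈ D, d.totient ≤ 9 → ¬ (∀ d ∈ D, d ∣ 6) → ¬ (∀ d ∈ D, d ∣ 10) → ¬ (∀ d ∈ D, d ∣ 15) →
      ∃ D' ∈ ([{1, 30}, {1, 2, 6, 10}, {1, 3, 5, 6}, {1, 3, 6, 10}, {1, 2, 3, 5}, {1, 2, 5, 6},
        {1, 2, 3, 10}] : List (Finset ℕ)), D ⊆ D' := by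
  decide +kernel

/-- The polynomial with the given list of coefficients. -/
noncomputable def listPoly : List ℤ → ℤ[X]
  | [] => 0
  | a :: c => C a + X * listPoly c

theorem aeval_listPoly {n : ℕ} (w : ModGroup n) (x : H₂ n) (c : List ℤ) :
    aeval (toEnd w) (listPoly c) x = orbitSum w x c := by
  induction c with
  | nil => simp [listPoly, orbitSum]
  | cons a c ih =>
    rw [listPoly, map_add, map_mul, aeval_X, aeval_C, LinearMap.add_apply, Module.End.mul_apply, ih,
      orbitSum, toEnd_apply]
    simp

theorem cyclotomic_five' : cyclotomic 5 ℤ = X ^ 4 + X ^ 3 + X ^ 2 + X + 1 := by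
  have : Fact (Nat.Prime 5) := ⟨by norm_num⟩
  rw [cyclotomic_prime]
  simp [Finset.sum_range_succ]
  ring

theorem cyclotomic_ten : cyclotomic 10 ℤ = X ^ 4 - X ^ 3 + X ^ 2 - X + 1 := by
  have h := cyclotomic_expand_eq_cyclotomic_mul (p := 2) (n := 5) Nat.prime_two (by norm_num) ℤ
  rw [cyclotomic_five'] at h
  refine mul_right_cancel₀ (b := X ^ 4 + X ^ 3 + X ^ 2 + X + 1)
    (cyclotomic_five' ▸ cyclotomic_ne_zero 5 ℤ) ?_
  rw [show 10 = 5 * 2 by norm_num, ← h]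
  simp
  ring

theorem cyclotomic_thirty :
    cyclotomic 30 ℤ = X ^ 8 + X ^ 7 - X ^ 5 - X ^ 4 - X ^ 3 + X + 1 := by
  have h := cyclotomic_expand_eq_cyclotomic_mul (p := 3) (n := 10) Nat.prime_three (by norm_num) ℤ
  rw [cyclotomic_ten] at h
  refine mul_right_cancel₀ (b := X ^ 4 - X ^ 3 + X ^ 2 - X + 1)
    (cyclotomic_ten ▸ cyclotomic_ne_zero 10 ℤ) ?_
  rw [show 30 = 10 * 3 by norm_num, ← h]
  simp
  ring

/-- The possible annihilating polynomials on `K^⊥`: products of the cyclotomic polynomials of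
indices `30`; `2, 6, 10`; `3, 5, 6`; `3, 6, 10`; `2, 3, 5`; `2, 5, 6`; `2, 3, 10`. -/
def annihilators : List (List ℤ) :=
  [[1, 1, 0, -1, -1, -1, 0, 1, 1],
    [1, -1, 1, 0, 0, 1, -1, 1],
    [1, 1, 2, 2, 3, 2, 2, 1, 1],
    [1, -1, 2, -2, 3, -2, 2, -1, 1],
    [1, 3, 5, 6, 6, 5, 3, 1],
    [1, 1, 1, 2, 2, 1, 1, 1],
    [1, 1, 1, 0, 0, 1, 1, 1]]

/-- The product over D' is (X − 1)p. Hence p(w)x is fixed by w, and for x in K^⊥ it stays in K^⊥, so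
it vanishes by ellipticity. -/
theorem exists_annihilator {w : ModGroup 8} (hw : w ∈ weylGroup 8) (hell : IsElliptic w)
    (ho : orderOf w = 30) : ∃ p ∈ annihilators, ∀ x : H₂ 8, Q x (canonicalClass 8) = 0 →
      orbitSum w x p = 0 := by
  have hpow : ∀ k : ℕ, toEnd w ^ k = 1 ↔ w ^ k = 1 := by
    intro k
    refine ⟨fun h => ModGroup.ext fun x => ?_, fun h => LinearMap.ext fun x => ?_⟩
    · rw [← toEnd_pow_apply, h]; simp
    · rw [toEnd_pow_apply, h]; simp
  have hne : ∀ k, 0 < k → k < 30 → w ^ k ≠ 1 := fun k h0 hk =>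
    pow_ne_one_of_lt_orderOf h0.ne' (ho ▸ hk)
  obtain ⟨D, hD, h1, hsum, hann⟩ := exists_annihilating_cyclotomic (N := 30) (by norm_num) (toEnd w)
    ((hpow 30).2 (ho ▸ pow_orderOf_eq_one w)) (v := canonicalClass 8) (by decide +kernel)
    (mem_weylGroup.1 hw)
  have hdiv : ∀ k, 0 < k → k < 30 → ¬ ∀ d ∈ D, d ∣ k := by
    intro k h0 hk h
    have h2 := hann k.divisors fun d hd => Nat.mem_divisors.2 ⟨h d hd, h0.ne'⟩
    rw [prod_cyclotomic_eq_X_pow_sub_one h0, map_sub, map_pow, aeval_X, map_one, sub_eq_zero] at h2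
    exact hne k h0 hk ((hpow k).1 h2)
  obtain ⟨D', hD', hDD'⟩ := divisors_thirty_cases D hD h1 hsum (hdiv 6 (by norm_num) (by norm_num))
    (hdiv 10 (by norm_num) (by norm_num)) (hdiv 15 (by norm_num) (by norm_num))
  have key : ∃ p ∈ annihilators, ∏ d ∈ D', cyclotomic d ℤ = (X - 1) * listPoly p := by
    have hins : ∀ s : Finset ℕ, 1 ∉ s → ∏ d ∈ insert 1 s, cyclotomic d ℤ =
        (X - 1) * ∏ d ∈ s, cyclotomic d ℤ := by
      intro s hs
      rw [Finset.prod_insert hs, cyclotomic_one]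
    simp only [List.mem_cons, List.not_mem_nil, or_false] at hD'
    rcases hD' with rfl | rfl | rfl | rfl | rfl | rfl | rfl
    on_goal 1 => refine ⟨[1, 1, 0, -1, -1, -1, 0, 1, 1], by decide, ?_⟩
    on_goal 2 => refine ⟨[1, -1, 1, 0, 0, 1, -1, 1], by decide, ?_⟩
    on_goal 3 => refine ⟨[1, 1, 2, 2, 3, 2, 2, 1, 1], by decide, ?_⟩
    on_goal 4 => refine ⟨[1, -1, 2, -2, 3, -2, 2, -1, 1], by decide, ?_⟩
    on_goal 5 => refine ⟨[1, 3, 5, 6, 6, 5, 3, 1], by decide, ?_⟩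
    on_goal 6 => refine ⟨[1, 1, 1, 2, 2, 1, 1, 1], by decide, ?_⟩
    on_goal 7 => refine ⟨[1, 1, 1, 0, 0, 1, 1, 1], by decide, ?_⟩
    all_goals
      rw [hins _ (by decide)]
      congr 1
      simp [listPoly, Finset.prod_insert, cyclotomic_two, cyclotomic_three, cyclotomic_five',
        cyclotomic_six, cyclotomic_ten, cyclotomic_thirty]
      ring
  obtain ⟨p, hp, hpD⟩ := key
  refine ⟨p, hp, fun x hx => hell _ ?_ ?_⟩
  · have h2 := congrArg (fun f => f x) (hann D' hDD')
    rw [hpD, map_mul, map_sub, aeval_X, map_one] at h2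
    simp only [Module.End.mul_apply, LinearMap.sub_apply, aeval_listPoly, Module.End.one_apply,
      LinearMap.zero_apply, sub_eq_zero] at h2
    exact h2
  · rw [orbitSum_canonicalClass hw, hx, mul_zero]

end

/-! ### Roots -/

/-- A root: a class of square `-2` and degree `0`. -/
structure IsRoot {n : ℕ} (α : H₂ n) : Prop where
  sq : Q α α = -2
  deg : Q α (canonicalClass n) = 0

theorem IsRoot.smul {n : ℕ} {w : ModGroup n} (hw : w ∈ weylGroup n) {α : H₂ n} (h : IsRoot α) :
    IsRoot (w • α) :=
  ⟨by rw [lorentzForm_smul_smul, h.sq], by rw [← mem_weylGroup.1 hw, lorentzForm_smul_smul, h.deg]⟩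

theorem IsRoot.neg {n : ℕ} {α : H₂ n} (h : IsRoot α) : IsRoot (-α) :=
  ⟨by simp [h.sq], by simp [h.deg]⟩

/-- α − β lies in the negative definite K^⊥ and has square −4 − 2Q(α, β). -/
theorem IsRoot.neg_two_le {n : ℕ} (hn8 : n ≤ 8) {α β : H₂ n} (hα : IsRoot α) (hβ : IsRoot β) :
    -2 ≤ Q α β := by
  have h := mul_sq_le hn8 (α - β)
  simp only [map_sub, LinearMap.sub_apply, hα.sq, hβ.sq, hα.deg, hβ.deg, lorentzForm_comm β α] at h
  have hd : (0 : ℤ) < 9 - n := by omega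
  by_contra! h'
  have := mul_pos hd (show (0 : ℤ) < -2 - Q α β - (Q α β - -2) by linarith)
  linarith

theorem IsRoot.le_two {n : ℕ} (hn8 : n ≤ 8) {α β : H₂ n} (hα : IsRoot α) (hβ : IsRoot β) :
    Q α β ≤ 2 := by
  have := hα.neg_two_le hn8 hβ.neg
  rw [map_neg] at this
  linarith

theorem IsRoot.eq_of_pairing {n : ℕ} (hn8 : n ≤ 8) {α β : H₂ n} (hα : IsRoot α) (hβ : IsRoot β)
    (h : Q α β = -2) : α = β := by
  rw [← sub_eq_zero]
  apply eq_of_mul_sq_eq hn8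
  · rw [LinearMap.map_sub₂, hα.deg, hβ.deg, sub_self]
  · simp [hα.sq, hβ.sq, lorentzForm_comm β α, h]

theorem isRoot_exc_sub_exc {n : ℕ} {i j : Fin n} (h : i ≠ j) : IsRoot (exc i - exc j : H₂ n) := by
  refine ⟨?_, ?_⟩
  · simp [lorentzForm_exc_exc, h, h.symm]
  · rw [LinearMap.map_sub₂, (isLine_exc i).deg, (isLine_exc j).deg, sub_self]

theorem isRoot_hyp_sub {n : ℕ} {i j k : Fin n} (hij : i ≠ j) (hik : i ≠ k) (hjk : j ≠ k) :
    IsRoot (hyp n - exc i - exc j - exc k : H₂ n) := by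
  have h1 : ∀ l : Fin n, Q (exc l) (hyp n) = 0 := fun l => by rw [lorentzForm_hyp]; simp [exc]
  have h2 : Q (hyp n) (hyp n) = 1 := by rw [lorentzForm_hyp]; simp [hyp]
  refine ⟨?_, ?_⟩
  · simp [lorentzForm_exc_exc, hij, hij.symm, hik, hik.symm, hjk, hjk.symm, h1, h2,
      lorentzForm_comm (hyp n)]
  · simp only [LinearMap.map_sub₂, (isLine_exc _).deg]
    rw [lorentzForm_comm, lorentzForm_hyp, canonicalClass_zero]
    norm_num

/-- These roots and K generate the lattice, because K² = 1; the identity in the proof writes each Eᵢ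
in terms of them. -/
theorem eq_one_of_forall_root {u : ModGroup 8} (hu : u ∈ weylGroup 8)
    (h : ∀ i j : Fin 8, u • (exc i - exc j : H₂ 8) = exc i - exc j)
    (h' : u • (hyp 8 - exc 0 - exc 1 - exc 2 : H₂ 8) = hyp 8 - exc 0 - exc 1 - exc 2) : u = 1 := by
  have h0 : ∀ i : Fin 8, (exc i : H₂ 8) = (exc i - exc 0) + (∑ j : Fin 8, (exc j - exc 0) -
      canonicalClass 8 - (3 : ℤ) • (hyp 8 - exc 0 - exc 1 - exc 2) -
      (3 : ℤ) • (exc 1 - exc 0) - (3 : ℤ) • (exc 2 - exc 0)) := by decide +kernel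
  refine eq_one_of_forall_exc hu fun i => ?_
  have hS : u • ∑ j : Fin 8, (exc j - exc 0 : H₂ 8) = ∑ j : Fin 8, (exc j - exc 0) := by
    rw [smul_sum']; simp only [h]
  rw [h0 i, smul_add, h, smul_sub, smul_sub, smul_sub, smul_sub, smul_zsmul', smul_zsmul',
    smul_zsmul', h', h, h, mem_weylGroup.1 hu, hS]

/-- Two nontrivial elements of `W_8` move a common root. -/
theorem exists_root_moved {u t : ModGroup 8} (hu : u ∈ weylGroup 8) (ht : t ∈ weylGroup 8)
    (hu1 : u ≠ 1) (ht1 : t ≠ 1) : ∃ α : H₂ 8, IsRoot α ∧ u • α ≠ α ∧ t • α ≠ α := by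
  by_contra! hno
  have hno' : ∀ α : H₂ 8, IsRoot α → u • α = α ∨ t • α = α := fun α h =>
    or_iff_not_imp_left.2 (hno α h)
  have hadd : ∀ (v : ModGroup 8) (a b c : Fin 8), v • (exc a - exc b : H₂ 8) = exc a - exc b →
      v • (exc b - exc c : H₂ 8) = exc b - exc c → v • (exc a - exc c : H₂ 8) = exc a - exc c := by
    intro v a b c h1 h2
    rw [← sub_add_sub_cancel _ (exc b), smul_add, h1, h2]
  have hneg : ∀ (v : ModGroup 8) (a b : Fin 8), v • (exc a - exc b : H₂ 8) = exc a - exc b →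
      v • (exc b - exc a : H₂ 8) = exc b - exc a := by
    intro v a b h1
    rw [← neg_sub, smul_neg, h1]
  have hor : ∀ a b : Fin 8, u • (exc a - exc b : H₂ 8) = exc a - exc b ∨
      t • (exc a - exc b : H₂ 8) = exc a - exc b := by
    intro a b
    rcases eq_or_ne a b with rfl | h
    · left; simp
    · exact hno' _ (isRoot_exc_sub_exc h)
  -- If u fixed every E_a − E_b, it could fix no H − Eᵢ − Eⱼ − E_k without being trivial. Then t
  -- fixes all of those and hence their differences, so t = 1.
  have key : ∀ u t : ModGroup 8, u ∈ weylGroup 8 → t ∈ weylGroup 8 → u ≠ 1 → t ≠ 1 →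
      (∀ α : H₂ 8, IsRoot α → u • α = α ∨ t • α = α) →
      ¬ ∀ a b : Fin 8, u • (exc a - exc b : H₂ 8) = exc a - exc b := by
    intro u t hu ht hu1 ht1 hor h
    have h1 : ∀ i j k : Fin 8, i ≠ j → i ≠ k → j ≠ k →
        t • (hyp 8 - exc i - exc j - exc k : H₂ 8) = hyp 8 - exc i - exc j - exc k := by
      intro i j k hij hik hjk
      refine (hor _ (isRoot_hyp_sub hij hik hjk)).resolve_left fun h2 => hu1 ?_
      refine eq_one_of_forall_root hu h ?_
      have h3 : (hyp 8 - exc 0 - exc 1 - exc 2 : H₂ 8) = (hyp 8 - exc i - exc j - exc k) +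
          (exc i - exc 0) + (exc j - exc 1) + (exc k - exc 2) := by abel
      rw [h3, smul_add, smul_add, smul_add, h2, h, h, h]
    refine ht1 (eq_one_of_forall_root ht (fun i j => ?_) (h1 0 1 2 (by decide) (by decide)
      (by decide)))
    rcases eq_or_ne i j with rfl | hij
    · simp
    obtain ⟨k, l, hki, hkj, hli, hlj, hkl⟩ : ∃ k l : Fin 8, j ≠ k ∧ i ≠ k ∧ j ≠ l ∧ i ≠ l ∧
        k ≠ l := by
      revert i j; decide
    have h3 : (exc i - exc j : H₂ 8) = (hyp 8 - exc j - exc k - exc l) -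
        (hyp 8 - exc i - exc k - exc l) := by abel
    rw [h3, smul_sub, h1 j k l hki hli hkl, h1 i k l hkj hlj hkl]
  have h1 := key u t hu ht hu1 ht1 hno'
  have h2 := key t u ht hu ht1 hu1 fun α h => (hno' α h).symm
  push Not at h1 h2
  obtain ⟨a, b, hab⟩ := h1
  obtain ⟨c, d, hcd⟩ := h2
  -- The pairs (a, b) with E_a − E_b fixed by u form an equivalence relation, and so do those for t.
  -- Two equivalence relations that together contain all pairs cannot both be proper.
  rcases hor a c with h | h
  · have h3 : t • (exc b - exc c : H₂ 8) = exc b - exc c :=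
      (hor b c).resolve_left fun h' => hab (hadd u _ _ _ h (hneg u _ _ h'))
    have h4 : u • (exc a - exc d : H₂ 8) = exc a - exc d :=
      hadd u _ _ _ h ((hor c d).resolve_right hcd)
    have h5 : t • (exc b - exc d : H₂ 8) = exc b - exc d :=
      (hor b d).resolve_left fun h' => hab (hadd u _ _ _ h4 (hneg u _ _ h'))
    exact hcd (hadd t _ _ _ (hneg t _ _ h3) h5)
  · have h3 : t • (exc b - exc c : H₂ 8) = exc b - exc c :=
      hadd t _ _ _ (hneg t _ _ ((hor a b).resolve_left hab)) h
    have h4 : u • (exc a - exc d : H₂ 8) = exc a - exc d :=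
      (hor a d).resolve_right fun h' => hcd (hadd t _ _ _ (hneg t _ _ h) h')
    have h5 : u • (exc b - exc d : H₂ 8) = exc b - exc d :=
      (hor b d).resolve_right fun h' => hcd (hadd t _ _ _ (hneg t _ _ h3) h')
    exact hab (hadd u _ _ _ h4 (hneg u _ _ h5))

/-! ### Pairings of roots in their orbits -/

/-- The constraints on the sequence of defects of a root, fixed neither by `w ^ 6` nor by `w ^ 10`,
under an element `w` annihilated on `K^⊥` by the polynomial with coefficients `p`. -/
def rootConstraint (p : List ℤ) (l : List ℤ) : Bool :=
  let m := p.length - 1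
  let k := l.length - 1
  !(k == 6 && l.getD 6 0 == 2) && !(k == 10 && l.getD 10 0 == 2) &&
  -- The index is |i + k − m|. The sum comes from pairing w^k p(w)α = 0 with w^m α, and m ≤ 2k
  -- ensures that only the known terms t₀, …, t_k occur.
  !(Nat.ble m (2 * k) &&
    ((List.range (m + 1)).map fun i => p.getD i 0 *
        l.getD ((i + k - m) + (m - (i + k))) 0).sum != 0)

theorem defect_of_deg_zero {w : ModGroup 8} {x : H₂ 8} (h : Q x (canonicalClass 8) = 0) (k : ℕ) :
    defect w x k = -Q x (w ^ k • x) := by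
  rw [defect, h]; norm_num

theorem orbitSum_eq_sum {n : ℕ} (w : ModGroup n) (x : H₂ n) (p : List ℤ) :
    orbitSum w x p = ∑ i ∈ Finset.range p.length, p.getD i 0 • w ^ i • x := by
  induction p with
  | nil => rfl
  | cons a p ih =>
    rw [orbitSum, ih, List.length_cons, Finset.sum_range_succ', smul_sum', add_comm]
    simp only [smul_zsmul', pow_succ', mul_smul, List.getD_cons_succ, List.getD_cons_zero, pow_zero,
      one_smul]

theorem rootConstraint_defect {w : ModGroup 8} {α : H₂ 8} (hw : w ∈ weylGroup 8) (hα : IsRoot α)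
    (h6 : w ^ 6 • α ≠ α) (h10 : w ^ 10 • α ≠ α) {p : List ℤ} (hp : p ≠ [])
    (hpα : orbitSum w α p = 0) (k : ℕ) :
    rootConstraint p ((List.range (k + 1)).map (defect w α)) = true := by
  have hget : ∀ i a, i ≤ k → ((List.range (k + 1)).map (defect w α)).getD i a = defect w α i := by
    intro i a hi
    have : i < k + 1 := by omega
    simp [List.getD_eq_getElem?_getD, this]
  have hne : ∀ m, w ^ m • α ≠ α → defect w α m ≠ 2 := by
    intro m hm h
    rw [defect_of_deg_zero hα.deg] at h
    exact hm (hα.eq_of_pairing le_rfl (hα.smul (pow_mem hw m)) (by linarith)).symm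
  obtain ⟨m, hm⟩ : ∃ m, p.length = m + 1 :=
    Nat.exists_eq_succ_of_ne_zero (by rwa [Ne, List.length_eq_zero_iff])
  simp only [rootConstraint, List.length_map, List.length_range, Nat.add_sub_cancel, hm,
    Bool.and_eq_true, Bool.not_eq_true', Bool.and_eq_false_iff, list_sum_map_range]
  refine ⟨⟨?_, ?_⟩, ?_⟩
  · rcases eq_or_ne k 6 with rfl | hk
    · right
      rw [hget _ _ le_rfl, beq_eq_false_iff_ne]
      exact hne 6 h6
    · left
      simpa using hk
  · rcases eq_or_ne k 10 with rfl | hk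
    · right
      rw [hget _ _ le_rfl, beq_eq_false_iff_ne]
      exact hne 10 h10
    · left
      simpa using hk
  · rcases le_or_gt m (2 * k) with h | h
    · right
      rw [bne_eq_false_iff_eq]
      have h1 := congrArg (fun v => Q (w ^ m • α) (w ^ k • v)) hpα
      simp only [orbitSum_eq_sum, hm, smul_sum', map_sum, smul_zsmul', LinearMap.map_smul,
          smul_zero,
        map_zero, ← mul_smul, ← pow_add, lorentzForm_pow_pow] at h1
      refine neg_eq_zero.1 (Eq.trans ?_ h1)
      rw [← Finset.sum_neg_distrib]
      refine Finset.sum_congr rfl fun i hi => ?_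
      rw [Finset.mem_range] at hi
      rw [hget _ _ (by omega), defect_of_deg_zero hα.deg, smul_eq_mul]
      have : i + k - m + (m - (i + k)) = k + i - m + (m - (k + i)) := by omega
      rw [this, mul_neg, neg_neg]
    · left
      rw [Bool.eq_false_iff, Ne, Nat.ble_eq]
      omega

theorem map_defect_mem_root {w : ModGroup 8} {α : H₂ 8} (hw : w ∈ weylGroup 8) (hα : IsRoot α)
    (h6 : w ^ 6 • α ≠ α) (h10 : w ^ 10 • α ≠ α) {p : List ℤ} (hp : p ≠ [])
    (hpα : orbitSum w α p = 0) (k : ℕ) : (List.range (k + 1)).map (defect w α) ∈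
      (toeplitzSearch [2, 1, 0, -1, -2] (rootConstraint p) 2 k).map Prod.fst := by
  have h0 : defect w α 0 = 2 := by
    rw [defect_of_deg_zero hα.deg, pow_zero, one_smul, hα.sq]; rfl
  have hR : ∀ k, defect w α k ∈ ([2, 1, 0, -1, -2] : List ℤ) := by
    intro k
    have h1 := hα.neg_two_le le_rfl (hα.smul (pow_mem hw k))
    have h2 := hα.le_two le_rfl (hα.smul (pow_mem hw k))
    rw [defect_of_deg_zero hα.deg]
    generalize Q α (w ^ k • α) = a at h1 h2 ⊢
    interval_cases a <;> decide
  have h := mem_toeplitzSearch hR (rootConstraint_defect hw hα h6 h10 hp hpα)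
    (toeplitzForm_defect_nonneg le_rfl hw α) k
  rwa [h0] at h

/-- The entries after the first two are all annihilators other than Φ₃₀ and Φ₂Φ₆Φ₁₀. -/
theorem toeplitzSearch_root_empty : ∀ p ∈ annihilators.drop 2,
    (toeplitzSearch [2, 1, 0, -1, -2] (rootConstraint p) 2 15).map Prod.fst = [] := by
  decide +kernel

theorem toeplitzSearch_root_thirty : ∀ l ∈ (toeplitzSearch [2, 1, 0, -1, -2]
    (rootConstraint [1, 1, 0, -1, -1, -1, 0, 1, 1]) 2 15).map Prod.fst,
    l ∈ ([[2, 1, 1, 1, 1, 1, 0, 0, 0, 0, -1, -1, -1, -1, -1, -2],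
      [2, 0, 1, 1, 0, 1, 0, 0, 0, 0, -1, 0, -1, -1, 0, -2],
      [2, 0, 0, 1, 0, 1, 0, -1, 1, 0, -1, 0, -1, 0, 0, -2],
      [2, 0, 0, 0, 1, 1, -1, 0, 0, 1, -1, -1, 0, 0, 0, -2],
      [2, 0, -1, 0, 1, 1, -1, -1, 1, 1, -1, -1, 0, 1, 0, -2],
      [2, -1, 1, 0, 0, 1, -1, 1, -1, 1, -1, 0, 0, -1, 1, -2],
      [2, -1, 0, 1, -1, 1, 0, -1, 1, 0, -1, 1, -1, 0, 1, -2],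
      [2, -1, 0, 0, 0, 1, -1, 0, 0, 1, -1, 0, 0, 0, 1, -2]] : List (List ℤ)) := by
  decide +kernel

theorem toeplitzSearch_root_ten : ∀ l ∈ (toeplitzSearch [2, 1, 0, -1, -2]
    (rootConstraint [1, -1, 1, 0, 0, 1, -1, 1]) 2 15).map Prod.fst,
    l ∈ ([[2, 0, -1, 0, 0, -1, 1, 1, -1, -1, 1, 0, 0, 1, 0, -2],
      [2, 0, 0, -1, 0, -1, 1, 0, 0, -1, 1, 0, 1, 0, 0, -2],
      [2, 1, 0, -1, -1, -1, 0, 0, 0, 0, 1, 1, 1, 0, -1, -2]] : List (List ℤ)) := by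
  decide +kernel

/-- As K² = 1, subtracting K turns a root into a line with the same defects. The orbit of a root
stays in K^⊥, while that of the line can span the whole lattice. -/
theorem IsRoot.isLine_sub {α : H₂ 8} (hα : IsRoot α) : IsLine (α - canonicalClass 8) := by
  have h := canonicalClass_sq 8
  constructor <;> simp [hα.sq, hα.deg, h, lorentzForm_comm (canonicalClass 8) α]

theorem IsRoot.defect_sub {w : ModGroup 8} (hw : w ∈ weylGroup 8) {α : H₂ 8} (hα : IsRoot α)
    (k : ℕ) : defect w (α - canonicalClass 8) k = defect w α k := by
  have h := canonicalClass_sq 8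
  have h1 := (hα.smul (pow_mem hw k)).deg
  rw [defect, defect, smul_sub, mem_weylGroup.1 (pow_mem hw k)]
  simp [hα.deg, h, h1, lorentzForm_comm (canonicalClass 8)]

/-- All eight surviving sequences occur for the Coxeter element, each on an explicit line whose
orbit contains a basis. -/
theorem exists_conj_of_thirty {w : ModGroup 8} (hw : w ∈ weylGroup 8) {α : H₂ 8} (hα : IsRoot α)
    (h6 : w ^ 6 • α ≠ α) (h10 : w ^ 10 • α ≠ α)
    (hp : orbitSum w α [1, 1, 0, -1, -1, -1, 0, 1, 1] = 0) :
    ∃ g ∈ ModPlus 8, w = g * coxeterElement (n := 8) (by norm_num) * g⁻¹ := by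
  have hl := toeplitzSearch_root_thirty _ (map_defect_mem_root hw hα h6 h10 (by simp) hp 15)
  rw [← funext (hα.defect_sub hw)] at hl
  have hd := hα.isLine_sub.deg
  generalize α - canonicalClass 8 = e at hl hd
  simp only [List.mem_cons, List.not_mem_nil, or_false] at hl
  rcases hl with hl | hl | hl | hl | hl | hl | hl | hl
  · exact exists_conj_of_map_eq (y := exc 7) le_rfl (by decide) hl
      (hd.trans (by decide +kernel)) (by decide +kernel)
      (Y' := !![3, 1, 1, 2, 1, 1, 1, 0, 1;
        3, 1, 1, 1, 2, 1, 1, 1, 0;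
        1, 0, 1, 0, 0, 1, 0, 1, 0;
        -2, -1, -1, -1, -1, -1, 0, 0, 0;
        -2, 0, -1, -1, -1, -1, -1, 0, 0;
        -3, -1, -1, -2, -1, -1, -1, -1, 0;
        -1, 0, -1, 0, -1, 0, 0, -1, 0;
        2, 1, 1, 1, 1, 0, 1, 0, 0;
        2, 0, 1, 1, 1, 1, 0, 1, 0])
      (by decide +kernel)
  · exact exists_conj_of_map_eq (y := exc 1) le_rfl (by decide) hl
      (hd.trans (by decide +kernel)) (by decide +kernel)
      (Y' := !![1, 0, 1, 1, 0, 0, 0, 0, 0;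
        1, 0, 0, 1, 1, 0, 0, 0, 0;
        1, 1, 0, 0, 1, 1, 0, 0, 0;
        0, 0, 0, -1, 0, 1, 1, 0, 0;
        0, 0, 0, 0, -1, 0, 1, 1, 0;
        0, 0, 0, 0, 0, -1, 0, 1, 1;
        0, 0, 0, 0, 0, 0, -1, 0, 1;
        0, 0, 0, 0, 0, 0, 0, -1, 0;
        0, 0, 0, 0, 0, 0, 0, 0, -1])
      (by decide +kernel)
  · exact exists_conj_of_map_eq (y := ![1, -1, 0, 0, -1, 0, 0, 0, 0]) le_rfl (by decide) hl
      (hd.trans (by decide +kernel)) (by decide +kernel)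
      (Y' := !![2, 1, 1, 2, 0, 1, 0, 0, 0;
        2, 0, 1, 1, 2, 0, 1, 0, 0;
        1, 0, 0, 0, 1, 1, 0, 1, 0;
        0, 0, 0, -1, 0, 0, 1, 0, 1;
        -1, 0, -1, -1, -1, 0, 0, 1, 0;
        -1, 0, 0, -1, -1, -1, 0, 0, 1;
        -1, 0, -1, 0, -1, 0, -1, 0, 0;
        1, 1, 1, 1, 0, 0, 0, -1, 0;
        0, -1, 0, 0, 1, 0, 0, 0, -1])
      (by decide +kernel)
  · exact exists_conj_of_map_eq (y := ![1, -1, 0, 0, 0, -1, 0, 0, 0]) le_rfl (by decide) hl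
      (hd.trans (by decide +kernel)) (by decide +kernel)
      (Y' := !![0, -1, 0, 1, 0, 0, 0, -1, 0;
        1, 1, 0, 1, 1, 0, 0, 0, -1;
        2, 1, 2, 0, 1, 1, 0, 1, 0;
        1, 0, 0, 0, 0, 1, 1, 1, 1;
        1, 1, 0, 0, 0, 0, 1, 1, 1;
        0, 0, 0, -1, 0, 0, 0, 1, 1;
        -1, -1, -1, 0, -1, 0, 0, -1, 1;
        -1, 0, -1, 0, 0, -1, 0, -1, -1;
        0, 0, 1, 0, 0, 0, -1, 0, -1])
      (by decide +kernel)
  · exact exists_conj_of_map_eq (y := ![1, 0, 0, 0, 0, -1, -1, 0, 0]) le_rfl (by decide) hl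
      (hd.trans (by decide +kernel)) (by decide +kernel)
      (Y' := !![0, 0, 1, 1, 0, 0, -1, -1, -1;
        0, -1, 0, 1, 1, 0, 0, -1, -1;
        2, 1, 0, 1, 1, 1, 1, 1, 0;
        3, 1, 1, 0, 1, 1, 2, 2, 2;
        2, 1, 0, 0, 0, 1, 1, 2, 2;
        1, 1, 0, -1, 0, 0, 1, 1, 2;
        -1, 0, 0, -1, -1, 0, -1, 0, 0;
        -2, -1, 0, 0, -1, -1, -1, -2, -1;
        -2, -1, -1, 0, 0, -1, -1, -1, -2])
      (by decide +kernel)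
  · exact exists_conj_of_map_eq (y := ![1, 0, 0, 0, -1, 0, -1, 0, 0]) le_rfl (by decide) hl
      (hd.trans (by decide +kernel)) (by decide +kernel)
      (Y' := !![2, 0, 1, 2, 1, 1, 0, 0, 0;
        3, 1, 1, 2, 2, 1, 1, 0, 0;
        2, 1, 1, 0, 1, 1, 1, 1, 0;
        0, 0, 0, -1, -1, 0, 1, 1, 1;
        -1, 0, -1, -1, -1, -1, 0, 1, 1;
        -2, 0, -1, -2, -1, -1, -1, 0, 1;
        -2, -1, -1, -1, -1, 0, -1, -1, 0;
        0, 0, 0, 1, 0, 0, 0, -1, -1;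
        1, 0, 1, 1, 1, 0, 0, 0, -1])
      (by decide +kernel)
  · exact exists_conj_of_map_eq (y := ![2, -1, -1, 0, -1, -1, 0, -1, 0]) le_rfl (by decide) hl
      (hd.trans (by decide +kernel)) (by decide +kernel)
      (Y' := !![1, 0, 1, 2, 1, 0, 0, -1, -1;
        2, 0, 1, 2, 2, 1, 0, 0, -1;
        3, 1, 1, 1, 1, 2, 1, 1, 1;
        2, 1, 0, -1, 0, 1, 2, 2, 2;
        1, 1, 0, -1, -1, 0, 1, 2, 2;
        -1, 0, -1, -2, -1, -1, 0, 1, 2;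
        -2, 0, -1, -1, -1, -1, -1, -1, 0;
        -2, -1, 0, 0, 0, -1, -1, -2, -2;
        -1, -1, 0, 1, 0, 0, -1, -1, -2])
      (by decide +kernel)
  · exact exists_conj_of_map_eq (y := ![2, -1, 0, -1, 0, -1, -1, -1, 0]) le_rfl (by decide) hl
      (hd.trans (by decide +kernel)) (by decide +kernel)
      (Y' := !![-3, -2, 0, 1, 0, -1, -2, -3, -3;
        -1, -1, 0, 2, 1, 0, -1, -2, -3;
        5, 2, 2, 2, 2, 2, 2, 2, 1;
        8, 3, 2, 1, 2, 3, 4, 5, 5;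
        6, 3, 1, 0, 1, 2, 3, 4, 5;
        3, 2, 0, -2, 0, 1, 2, 3, 4;
        -3, -1, -1, -2, -2, -1, -1, -1, 0;
        -7, -3, -2, -1, -2, -3, -3, -4, -4;
        -5, -2, -1, 0, -1, -2, -3, -3, -4])
      (by decide +kernel)

/-! ### Sublattices of corank two -/

/-- Some nonzero z₀ is orthogonal to n given vectors, by rank. The generator of the ideal of values
Q(z₀, ·) divides the coordinates of z₀, and dividing it out makes z primitive. -/
theorem exists_primitive_orthogonal {n : ℕ} (x : Fin n → H₂ n) :
    ∃ z v : H₂ n, (∀ j, Q z (x j) = 0) ∧ Q v z = -1 := by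
  let f : H₂ n →ₗ[ℤ] (Fin n → ℤ) := LinearMap.pi fun j => (lorentzForm ℤ n).flip (x j)
  have hf : ¬ Function.Injective f := fun h => by
    have := LinearMap.finrank_le_finrank_of_injective h
    simp at this
  rw [← LinearMap.ker_eq_bot, Submodule.eq_bot_iff] at hf
  push Not at hf
  obtain ⟨z₀, hz₀, hne⟩ := hf
  let I : Ideal ℤ := LinearMap.range (lorentzForm ℤ n z₀)
  have hdvd : ∀ y, Submodule.IsPrincipal.generator I ∣ Q z₀ y := fun y =>
    (Submodule.IsPrincipal.mem_iff_generator_dvd I).1 ⟨y, rfl⟩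
  obtain ⟨v, hv⟩ : Submodule.IsPrincipal.generator I ∈ I := Submodule.IsPrincipal.generator_mem I
  rw [← hv] at hdvd
  have h0 : Q z₀ v ≠ 0 := fun h =>
    hne (eq_zero_of_forall_lorentzForm fun y => zero_dvd_iff.1 (h ▸ hdvd y))
  have hcoord : ∀ i, Q z₀ v ∣ z₀ i := by
    refine Fin.cases ?_ fun i => ?_
    · rw [← lorentzForm_hyp z₀]; exact hdvd _
    · rw [← dvd_neg, ← lorentzForm_exc z₀]; exact hdvd _
  choose z hz using hcoord
  have hz' : z₀ = Q z₀ v • z := funext hz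
  have hsmul : ∀ y, Q z₀ y = Q z₀ v * Q z y := fun y => by
    conv_lhs => rw [hz', LinearMap.map_smul₂, smul_eq_mul]
  refine ⟨z, -v, fun j => ?_, ?_⟩
  · have h : Q z₀ (x j) = 0 := congrFun hz₀ j
    rw [hsmul] at h
    exact (mul_eq_zero.1 h).resolve_left h0
  · have h := hsmul v
    rw [map_neg, LinearMap.neg_apply, lorentzForm_comm, neg_inj]
    exact mul_left_cancel₀ h0 (by rw [← h, mul_one])

section Corank

variable {x : Fin 7 → H₂ 8} {A : Matrix (Fin 7) (Fin 7) ℤ} {D : ℤ}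

/-- A vector orthogonal to a nondegenerate sublattice of rank `8`, and to a vector of its orthogonal
complement, vanishes. -/
theorem eq_zero_of_orthogonal (hD : D ≠ 0) (hx : ∀ i, Q (x i) (canonicalClass 8) = 0)
    (hA : A * (Matrix.of fun i j => -Q (x i) (x j)) = D • 1) {z u : H₂ 8} (hz0 : z ≠ 0)
    (hzK : Q z (canonicalClass 8) = 0) (hzx : ∀ i, Q z (x i) = 0)
    (huK : Q u (canonicalClass 8) = 0) (hux : ∀ i, Q u (x i) = 0) (huz : Q u z = 0) : u = 0 := by
  by_contra hu
  have hKK : Q (canonicalClass 8) (canonicalClass 8) = 1 := by rw [canonicalClass_sq]; rfl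
  have hneg : ∀ {v : H₂ 8}, v ≠ 0 → Q v (canonicalClass 8) = 0 → Q v v ≠ 0 := fun hv hvK h =>
    hv (eq_of_mul_sq_eq le_rfl hvK h.ge)
  -- Otherwise the seven x i, K, z and u would be ten independent vectors in rank 9.
  have hli : LinearIndependent ℤ (Sum.elim x ![canonicalClass 8, z, u]) := by
    rw [Fintype.linearIndependent_iff]
    intro c hc
    rw [Fintype.sum_sum_type, Fin.sum_univ_three] at hc
    simp only [Sum.elim_inl, Sum.elim_inr, Matrix.cons_val_zero, Matrix.cons_val_one,
      Matrix.cons_val] at hc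
    have hpair := fun y => congrArg (fun v => Q v y) hc
    simp only [map_add, map_sum, LinearMap.map_smul, LinearMap.add_apply, LinearMap.sum_apply,
      LinearMap.smul_apply, smul_eq_mul, map_zero, LinearMap.zero_apply] at hpair
    have h1 : c (Sum.inr 2) = 0 := by
      have := hpair u
      simp only [lorentzForm_comm _ u, hux, huK, huz, mul_zero, Finset.sum_const_zero, zero_add]
        at this
      exact (mul_eq_zero.1 this).resolve_right (hneg hu huK)
    have h2 : c (Sum.inr 1) = 0 := by
      have := hpair z
      simp only [lorentzForm_comm _ z, hzx, hzK, h1, zero_mul, mul_zero, Finset.sum_const_zero,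
        zero_add, add_zero] at this
      exact (mul_eq_zero.1 this).resolve_right (hneg hz0 hzK)
    have h3 : c (Sum.inr 0) = 0 := by
      have := hpair (canonicalClass 8)
      simpa only [hx, hKK, h1, h2, zero_mul, mul_zero, Finset.sum_const_zero,
        zero_add, add_zero, mul_one] using this
    have h4 : ∀ i, c (Sum.inl i) = 0 := by
      have h : (Matrix.of fun i j => -Q (x i) (x j)).mulVec (fun i => c (Sum.inl i)) = 0 := by
        ext j
        have := hpair (x j)
        simp only [h1, h2, h3, zero_mul, add_zero] at this
        rw [Matrix.mulVec, dotProduct, Pi.zero_apply, ← neg_eq_zero, ← Finset.sum_neg_distrib,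
          ← this]
        refine Finset.sum_congr rfl fun i _ => ?_
        rw [Matrix.of_apply, lorentzForm_comm (x i)]
        ring
      have h' : (D • (1 : Matrix (Fin 7) (Fin 7) ℤ)).mulVec (fun i => c (Sum.inl i)) = 0 := by
        rw [← hA, ← Matrix.mulVec_mulVec, h, Matrix.mulVec_zero]
      rw [Matrix.smul_mulVec, Matrix.one_mulVec] at h'
      exact fun i => congrFun ((smul_eq_zero.1 h').resolve_left hD) i
    rintro (i | i)
    · exact h4 i
    · fin_cases i
      exacts [h3, h2, h1]
  have := hli.fintype_card_le_finrank
  simp at this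

/-- The decomposition of a vector along a sublattice of rank `7` and a vector orthogonal to it. -/
theorem smul_eq_sum_add (hD : D ≠ 0) (hx : ∀ i, Q (x i) (canonicalClass 8) = 0)
    (hA : A * (Matrix.of fun i j => -Q (x i) (x j)) = D • 1) (hAs : A.IsSymm) {z : H₂ 8}
    (hz0 : z ≠ 0)
    (hzK : Q z (canonicalClass 8) = 0) (hzx : ∀ i, Q z (x i) = 0) {y : H₂ 8}
    (hy : Q y (canonicalClass 8) = 0) : (D * Q z z) • y =
      (-Q z z) • ∑ i, (∑ j, A i j * Q y (x j)) • x i + (D * Q y z) • z := by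
  rw [← sub_eq_zero]
  refine eq_zero_of_orthogonal hD hx hA hz0 hzK hzx ?_ (fun k => ?_) ?_
  · simp only [map_sub, map_add, map_sum, map_smul, LinearMap.sub_apply, LinearMap.add_apply,
      LinearMap.sum_apply, LinearMap.smul_apply, smul_eq_mul, hy, hx, hzK, mul_zero,
      Finset.sum_const_zero, add_zero, sub_zero]
  · have h : ∀ j, ∑ i, A i j * -Q (x i) (x k) = (D • (1 : Matrix (Fin 7) (Fin 7) ℤ)) j k := by
      intro j
      rw [← hA, Matrix.mul_apply]
      simp only [hAs.apply, Matrix.of_apply]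
    simp only [map_sub, map_add, map_sum, map_smul, LinearMap.sub_apply, LinearMap.add_apply,
      LinearMap.sum_apply, LinearMap.smul_apply, smul_eq_mul, hzx, mul_zero, add_zero]
    simp only [Finset.sum_mul]
    rw [Finset.sum_comm]
    have h2 : ∀ j, ∑ i, A i j * Q y (x j) * Q (x i) (x k) =
        -(Q y (x j) * (D • (1 : Matrix (Fin 7) (Fin 7) ℤ)) j k) := by
      intro j
      rw [← h, Finset.mul_sum, ← Finset.sum_neg_distrib]
      exact Finset.sum_congr rfl fun i _ => by ring
    simp only [h2, Matrix.smul_apply, Matrix.one_apply, smul_eq_mul, mul_ite, mul_one, mul_zero,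
      Finset.sum_neg_distrib, Finset.sum_ite_eq', Finset.mem_univ, if_true]
    ring
  · simp only [map_sub, map_add, map_sum, map_smul, LinearMap.sub_apply, LinearMap.add_apply,
      LinearMap.sum_apply, LinearMap.smul_apply, smul_eq_mul, lorentzForm_comm _ z, hzx, mul_zero,
      Finset.sum_const_zero]
    ring

/-- A vector completing a sublattice of rank `7` to one containing a given primitive vector. -/
theorem exists_completion (hD : 0 < D) (hx : ∀ i, Q (x i) (canonicalClass 8) = 0)
    (hA : A * (Matrix.of fun i j => -Q (x i) (x j)) = D • 1) (hAs : A.IsSymm) (l : Fin 7 → ℤ)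
    (g : Fin 7) {B : Matrix (Fin 7) (Fin 7) ℤ} (hB : ∀ i j, A i j = l j * A i g + D * B i j) :
    ∃ z v : H₂ 8, ∃ k : ℤ, 0 ≤ k ∧ 2 * k ≤ D ∧ Q z (canonicalClass 8) = 0 ∧
      (∀ j, Q z (x j) = 0) ∧ Q v z = -1 ∧ Q v (canonicalClass 8) = 0 ∧
      ∀ j, Q v (x j) = if j = g then -k else 0 := by
  have hKK : Q (canonicalClass 8) (canonicalClass 8) = 1 := by rw [canonicalClass_sq]; rfl
  obtain ⟨z, v₀, hz, hv₀⟩ := exists_primitive_orthogonal (n := 8) (Fin.cons (canonicalClass 8) x)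
  have hzK : Q z (canonicalClass 8) = 0 := hz 0
  have hzx : ∀ j, Q z (x j) = 0 := fun j => hz j.succ
  -- Adding ∑ cᵢ xᵢ to v₀ changes the pairings with the x j by the Gram matrix and leaves that with
  -- z alone. The component along K is removed integrally because K² = 1.
  have key : ∀ c : Fin 7 → ℤ, ∃ v : H₂ 8, Q v z = -1 ∧ Q v (canonicalClass 8) = 0 ∧
      ∀ j, Q v (x j) = Q v₀ (x j) + ∑ i, c i * Q (x i) (x j) := by
    intro c
    refine ⟨v₀ + ∑ i, c i • x i - Q v₀ (canonicalClass 8) • canonicalClass 8, ?_, ?_, fun j => ?_⟩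
    · simp only [map_sub, map_add, map_sum, map_smul, LinearMap.sub_apply, LinearMap.add_apply,
        LinearMap.sum_apply, LinearMap.smul_apply, smul_eq_mul, lorentzForm_comm _ z, hzx, hzK,
        mul_zero, Finset.sum_const_zero]
      rw [lorentzForm_comm, hv₀]
      rfl
    · simp only [map_sub, map_add, map_sum, map_smul, LinearMap.sub_apply, LinearMap.add_apply,
        LinearMap.sum_apply, LinearMap.smul_apply, smul_eq_mul, hx, hKK, mul_zero,
        Finset.sum_const_zero]
      ring
    · simp only [map_sub, map_add, map_sum, map_smul, LinearMap.sub_apply, LinearMap.add_apply,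
        LinearMap.sum_apply, LinearMap.smul_apply, smul_eq_mul, lorentzForm_comm (canonicalClass 8),
        hx, mul_zero, sub_zero]
  have hAG : ∀ i j, ∑ k, A k i * Q (x k) (x j) = if i = j then -D else 0 := by
    intro i j
    have h := congrFun (congrFun hA i) j
    simp only [Matrix.mul_apply, Matrix.of_apply, Matrix.smul_apply, Matrix.one_apply, smul_eq_mul,
      mul_neg, Finset.sum_neg_distrib, mul_ite, mul_one, mul_zero, neg_eq_iff_eq_neg] at h
    simp only [hAs.apply, h]
    split_ifs <;> simp
  set k₀ : ℤ := ∑ j, l j * Q v₀ (x j) with hk₀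
  -- q rounds k₀/D to a nearest integer, and e is the sign that makes the remainder −k with 0 ≤ k ≤
  -- D/2.
  obtain ⟨q, e, he, k, hk0, hk2, hk⟩ : ∃ q e : ℤ, (e = 1 ∨ e = -1) ∧ ∃ k, 0 ≤ k ∧ 2 * k ≤ D ∧
      e * (k₀ - q * D) = -k := by
    have h1 := Int.emod_nonneg k₀ hD.ne'
    have h2 := Int.emod_lt_of_pos k₀ hD
    have h3 := Int.mul_ediv_add_emod k₀ D
    rcases le_or_gt (2 * (k₀ % D)) D with h | h
    · exact ⟨k₀ / D, -1, Or.inr rfl, k₀ % D, h1, h, by linarith⟩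
    · exact ⟨k₀ / D + 1, 1, Or.inl rfl, D - k₀ % D, by linarith, by linarith, by linarith⟩
  -- The congruence of A with its column g modulo D makes B an integral correction that concentrates
  -- all pairings at index g, where k₀ remains; q then subtracts a multiple of D.
  obtain ⟨v, hvz, hvK, hv⟩ := key fun i => ∑ j, B i j * Q v₀ (x j) + q * A i g
  have hv' : ∀ j, Q v (x j) = if j = g then k₀ - q * D else 0 := by
    intro j
    have hD' : D ≠ 0 := hD.ne'
    refine mul_left_cancel₀ hD' ?_
    have h1 : ∀ i, D * ((∑ m, B i m * Q v₀ (x m) + q * A i g) * Q (x i) (x j)) =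
        ∑ m, (Q v₀ (x m) * (A i m * Q (x i) (x j)) -
          l m * Q v₀ (x m) * (A i g * Q (x i) (x j))) + D * q * (A i g * Q (x i) (x j)) := by
      intro i
      rw [add_mul, mul_add, Finset.sum_mul, Finset.mul_sum]
      congr 1
      · refine Finset.sum_congr rfl fun m _ => ?_
        rw [show D * (B i m * Q v₀ (x m) * Q (x i) (x j)) =
          (D * B i m) * (Q v₀ (x m) * Q (x i) (x j)) by ring,
          show D * B i m = A i m - l m * A i g by rw [hB i m]; ring]
        ring
      · ring
    rw [hv, mul_add, Finset.mul_sum, Finset.sum_congr rfl fun i _ => h1 i, Finset.sum_add_distrib,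
      ← Finset.mul_sum, hAG, Finset.sum_comm]
    simp only [Finset.sum_sub_distrib, ← Finset.mul_sum, hAG, mul_ite, mul_zero,
      Finset.sum_ite_eq', Finset.mem_univ, if_true, eq_comm (a := g)]
    split_ifs
    · rw [← Finset.sum_mul, ← hk₀]
      ring
    · simp only [Finset.sum_const_zero]
      ring
  have hee : e * e = 1 := by rcases he with rfl | rfl <;> rfl
  refine ⟨e • z, e • v, k, hk0, hk2, ?_, fun j => ?_, ?_, ?_, fun j => ?_⟩
  · rw [LinearMap.map_smul₂, hzK, smul_zero]
  · rw [LinearMap.map_smul₂, hzx, smul_zero]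
  · rw [LinearMap.map_smul₂, map_smul, hvz, smul_smul, hee, one_smul]
  · rw [LinearMap.map_smul₂, hvK, smul_zero]
  · rw [LinearMap.map_smul₂, hv', smul_eq_mul, mul_ite, mul_zero, hk]

end Corank

/-! ### Rank-7 orbits and conjugacy to `r` -/

/-- Conjugacy from a basis consisting of `K`, an orbit segment of length `7` and one more vector. -/
theorem exists_conj_of_orbit {w c : ModGroup 8} (hw : w ∈ weylGroup 8) (hc : c ∈ weylGroup 8)
    {α v β u : H₂ 8} (hα : Q α (canonicalClass 8) = 0) (hv : Q v (canonicalClass 8) = 0)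
    (hβ : Q β (canonicalClass 8) = 0) (hu : Q u (canonicalClass 8) = 0)
    (hαβ : ∀ k ≤ 7, Q α (w ^ k • α) = Q β (c ^ k • β))
    (hvu : ∀ k ≤ 7, Q v (w ^ k • α) = Q u (c ^ k • β)) (h₁ : Q (w • v) α = Q (c • u) β)
    (h₂ : Q (w • v) v = Q (c • u) u) (h₃ : Q v v = Q u u) {Y' : Matrix (Fin 9) (Fin 9) ℤ}
    (hY : (Matrix.of fun i j => (Fin.snoc (Fin.cons (canonicalClass 8) fun i : Fin 7 =>
      c ^ (i : ℕ) • β) u : Fin 9 → H₂ 8) j i) * Y' = 1) : ∃ g ∈ ModPlus 8, w = g * c * g⁻¹ := by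
  have hwK : ∀ {w : ModGroup 8}, w ∈ weylGroup 8 → ∀ y, Q (w • y) (canonicalClass 8) =
      Q y (canonicalClass 8) := fun hw y => by
    conv_lhs => rw [← mem_weylGroup.1 hw, lorentzForm_smul_smul]
  have hpow : ∀ {w : ModGroup 8} {α : H₂ 8}, w ∈ weylGroup 8 → Q α (canonicalClass 8) = 0 →
      ∀ k : ℕ, Q (w ^ k • α) (canonicalClass 8) = 0 := fun hw hα k => by
    rw [hwK (pow_mem hw k), hα]
  have hshift : ∀ (w : ModGroup 8) (v α : H₂ 8) (k : ℕ),
      Q (w • v) (w ^ (k + 1) • α) = Q v (w ^ k • α) := fun w v α k => by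
    rw [pow_succ', mul_smul, lorentzForm_smul_smul]
  refine exists_conj_of_basis (x := Fin.snoc (Fin.cons (canonicalClass 8) fun i : Fin 7 =>
      w ^ (i : ℕ) • α) v) (fun i j => ?_) (fun i j => ?_) hY
  · refine Fin.lastCases ?_ (Fin.cases ?_ fun i => ?_) i <;>
      refine Fin.lastCases ?_ (Fin.cases ?_ fun j => ?_) j <;>
      simp only [Fin.snoc_last, Fin.snoc_castSucc, Fin.cons_zero, Fin.cons_succ]
    · exact h₃
    · rw [hv, hu]
    · exact hvu _ (by omega)
    · rw [lorentzForm_comm, hv, lorentzForm_comm, hu]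
    · rw [lorentzForm_comm, hpow hw hα, lorentzForm_comm, hpow hc hβ]
    · rw [lorentzForm_comm, hvu _ (by omega), lorentzForm_comm]
    · rw [hpow hw hα, hpow hc hβ]
    · rw [lorentzForm_pow_pow, lorentzForm_pow_pow, hαβ _ (by omega)]
  · refine Fin.lastCases ?_ (Fin.cases ?_ fun i => ?_) i <;>
      refine Fin.lastCases ?_ (Fin.cases ?_ fun j => ?_) j <;>
      simp only [Fin.snoc_last, Fin.snoc_castSucc, Fin.cons_zero, Fin.cons_succ,
        mem_weylGroup.1 hw, mem_weylGroup.1 hc, ← mul_smul, ← pow_succ', hwK hw, hwK hc]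
    · exact h₂
    · rw [hv, hu]
    · obtain ⟨j, hj⟩ := j
      cases j with
      | zero => simpa using h₁
      | succ j => rw [hshift, hshift, hvu _ (by omega)]
    · rw [lorentzForm_comm, hv, lorentzForm_comm, hu]
    · rw [lorentzForm_comm, hpow hw hα, lorentzForm_comm, hpow hc hβ]
    · rw [lorentzForm_comm, hvu _ (by omega), lorentzForm_comm]
    · rw [hpow hw hα, hpow hc hβ]
    · rw [lorentzForm_pow_pow, lorentzForm_pow_pow, hαβ _ (by omega)]

/-- The completion of the sublattice spanned by the orbit of a vector annihilated by the product of
the cyclotomic polynomials of indices `2, 6, 10`. -/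
theorem exists_orbit_completion {w : ModGroup 8} (hw : w ∈ weylGroup 8) (hell : IsElliptic w)
    {α : H₂ 8} (hα : Q α (canonicalClass 8) = 0)
    (hp : orbitSum w α [1, -1, 1, 0, 0, 1, -1, 1] = 0) {s : List ℤ}
    (hs : ∀ k ≤ 7, Q α (w ^ k • α) = -s.getD k 0) {A B : Matrix (Fin 7) (Fin 7) ℤ} {D : ℤ}
    (hD : 0 < D) (hA : A * (Matrix.of fun i j : Fin 7 =>
      s.getD ((j : ℕ) - i + (i - j)) 0) = D • 1) (hAs : A.IsSymm) (l : Fin 7 → ℤ)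
    (g : Fin 6)
    (hB : (Matrix.of fun i j => A i j - l j * A i g.castSucc) = D • B) :
    ∃ z v : H₂ 8, ∃ k m a : ℤ, 0 ≤ k ∧ 2 * k ≤ D ∧ 0 < m ∧ Q z z = -(2 * m) ∧ Q v v = -(2 * a) ∧
      Q v z = -1 ∧ Q z (canonicalClass 8) = 0 ∧ Q v (canonicalClass 8) = 0 ∧
      (∀ j ≤ 6, Q z (w ^ j • α) = 0) ∧
      (∀ j ≤ 6, Q v (w ^ j • α) = if j = (g : ℕ) then -k else 0) ∧
      Q v (w ^ 7 • α) = k * ([1, -1, 1, 0, 0, 1, -1, 1] : List ℤ).getD g 0 ∧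
      Q (w • v) α = k * ([1, -1, 1, 0, 0, 1, -1, 1] : List ℤ).getD (g + 1) 0 ∧
      4 * D * m * a = 2 * m * k ^ 2 * A g.castSucc g.castSucc + D ∧
      2 * D * m * Q (w • v) v =
        2 * m * k ^ 2 * (([1, -1, 1, 0, 0, 1, -1, 1] : List ℤ).getD (g + 1) 0 *
        A 0 g.castSucc - A g.succ g.castSucc) + D ∧
      ∀ y, Q y (canonicalClass 8) = 0 → (D * Q z z) • y =
        (-Q z z) • ∑ i : Fin 7, (∑ j : Fin 7, A i j * Q y (w ^ (j : ℕ) • α)) • w ^ (i : ℕ) • α +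
          (D * Q y z) • z := by
  have hwK : ∀ y, Q (w • y) (canonicalClass 8) = Q y (canonicalClass 8) := fun y => by
    conv_lhs => rw [← mem_weylGroup.1 hw, lorentzForm_smul_smul]
  have hpow : ∀ k : ℕ, Q (w ^ k • α) (canonicalClass 8) = 0 := fun k => by
    rw [← mem_weylGroup.1 (pow_mem hw k), lorentzForm_smul_smul, hα]
  have hshift : ∀ (v : H₂ 8) (k : ℕ), Q (w • v) (w ^ (k + 1) • α) = Q v (w ^ k • α) := fun v k => by
    rw [pow_succ', mul_smul, lorentzForm_smul_smul]
  have heven : ∀ y : H₂ 8, Q y (canonicalClass 8) = 0 → ∃ a, Q y y = -(2 * a) := fun y hy => by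
    obtain ⟨a, ha⟩ := even_sq_add_canonicalClass y
    exact ⟨-a, by linarith⟩
  have hrel : w ^ 7 • α = -(α - w • α + w ^ 2 • α + w ^ 5 • α - w ^ 6 • α) := by
    rw [orbitSum_eq_sum] at hp
    simp [Finset.sum_range_succ] at hp
    rw [← sub_eq_zero, ← hp]
    abel
  have hx : ∀ i : Fin 7, Q (w ^ (i : ℕ) • α) (canonicalClass 8) = 0 := fun i => hpow i
  have hA' : A * (Matrix.of fun i j : Fin 7 => -Q (w ^ (i : ℕ) • α) (w ^ (j : ℕ) • α)) = D • 1 := by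
    rw [← hA]
    congr 2
    ext i j
    rw [lorentzForm_pow_pow, hs _ (by omega), neg_neg]
  obtain ⟨z, v, k, hk0, hkD, hzK, hzx, hvz, hvK, hvx⟩ := exists_completion hD hx hA' hAs l
    g.castSucc fun i j => sub_eq_iff_eq_add'.1 (congrFun (congrFun hB i) j)
  have hz0 : z ≠ 0 := by
    rintro rfl
    simp at hvz
  have hzx' : ∀ j ≤ 6, Q z (w ^ j • α) = 0 := fun j hj => hzx ⟨j, by omega⟩
  have hvx' : ∀ j ≤ 6, Q v (w ^ j • α) = if j = (g : ℕ) then -k else 0 := fun j hj => by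
    rw [hvx ⟨j, by omega⟩]
    simp [Fin.ext_iff]
  obtain ⟨m, hm⟩ := heven z hzK
  obtain ⟨a, ha⟩ := heven v hvK
  have hm0 : 0 < m := by
    have := lorentzForm_neg_of_orthogonal (x := z) (v := canonicalClass 8)
      (by rw [canonicalClass_sq]; norm_num) hzK hz0
    linarith
  have hx7 : ∀ y, Q y (w ^ 7 • α) = -(Q y (w ^ 0 • α) - Q y (w ^ 1 • α) + Q y (w ^ 2 • α) +
      Q y (w ^ 5 • α) - Q y (w ^ 6 • α)) := fun y => by
    rw [hrel, pow_zero, one_smul, pow_one]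
    simp only [map_neg, map_sub, map_add]
  have hx0 : ∀ y, Q (w • y) α = -(Q y (w ^ 6 • α) - Q y (w ^ 0 • α) + Q y (w ^ 1 • α) +
      Q y (w ^ 4 • α) - Q y (w ^ 5 • α)) := fun y => by
    have h := hx7 (w • y)
    rw [hshift y 0, hshift y 1, hshift y 4, hshift y 5, hshift y 6, pow_zero, one_smul] at h
    rw [pow_zero, one_smul]
    linarith
  have hv7 : Q v (w ^ 7 • α) = k * ([1, -1, 1, 0, 0, 1, -1, 1] : List ℤ).getD g 0 := by
    rw [hx7]
    simp only [hvx' _ (by norm_num : 0 ≤ 6), hvx' _ (by norm_num : 1 ≤ 6),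
      hvx' _ (by norm_num : 2 ≤ 6), hvx' _ (by norm_num : 5 ≤ 6), hvx' _ (by norm_num : 6 ≤ 6)]
    clear * -
    fin_cases g <;> simp
  have hwvα : Q (w • v) α = k * ([1, -1, 1, 0, 0, 1, -1, 1] : List ℤ).getD (g + 1) 0 := by
    rw [hx0]
    simp only [hvx' _ (by norm_num : 0 ≤ 6), hvx' _ (by norm_num : 1 ≤ 6),
      hvx' _ (by norm_num : 4 ≤ 6), hvx' _ (by norm_num : 5 ≤ 6), hvx' _ (by norm_num : 6 ≤ 6)]
    clear * -
    fin_cases g <;> simp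
  -- w z is again orthogonal to K and to the orbit segment, hence proportional to z with the same
  -- square. Ellipticity excludes w z = z.
  have hwz : w • z = -z := by
    have h1 : ∀ i : Fin 7, Q (w • z) (w ^ (i : ℕ) • α) = 0 := by
      refine Fin.cases ?_ fun i => ?_
      · rw [Fin.val_zero, pow_zero, one_smul, hx0]
        rw [hzx' 0 (by norm_num), hzx' 1 (by norm_num), hzx' 4 (by norm_num), hzx' 5 (by norm_num),
          hzx' 6 (by norm_num)]
        rfl
      · rw [Fin.val_succ, hshift, hzx' _ (by omega)]
    have h2 := smul_eq_sum_add hD.ne' hx hA' hAs hz0 hzK hzx (y := w • z) (by rw [hwK, hzK])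
    simp only [h1, mul_zero, Finset.sum_const_zero, zero_smul, smul_zero, zero_add, mul_smul] at h2
    have h3 := smul_right_injective _ hD.ne' h2
    have h4 := congrArg (fun y => Q (w • z) y) h3
    simp only [map_smul, smul_eq_mul, lorentzForm_smul_smul] at h4
    have h5 : Q z z ≠ 0 := by omega
    rcases mul_self_eq_mul_self_iff.1 h4 with h | h
    · rw [← h] at h3
      exact absurd (hell z (smul_right_injective _ h5 h3) hzK) hz0
    · rw [neg_eq_iff_eq_neg.1 h.symm, neg_smul, ← smul_neg] at h3
      exact smul_right_injective _ h5 h3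
  -- Decompose v along the orbit and z and pair with y. Taking y = v and y = w v gives the two
  -- numerical relations.
  have hdec : ∀ y, D * Q z z * Q y v =
      -Q z z * ∑ i, A i g.castSucc * -k * Q y (w ^ (i : ℕ) • α) - D * Q y z := fun y => by
    have h := congrArg (fun u => Q y u) (smul_eq_sum_add hD.ne' hx hA' hAs hz0 hzK hzx hvK)
    simp only [map_add, map_sum, map_smul, smul_eq_mul, hvx, mul_ite, mul_zero, Finset.sum_ite_eq',
      Finset.mem_univ, if_true, hvz] at h
    rw [h]
    ring
  refine ⟨z, v, k, m, a, hk0, hkD, hm0, hm, ha, hvz, hzK, hvK, hzx', hvx', hv7, hwvα, ?_, ?_,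
    fun y hy => smul_eq_sum_add hD.ne' hx hA' hAs hz0 hzK hzx hy⟩
  · have h := hdec v
    simp only [hvx, mul_ite, mul_zero, Finset.sum_ite_eq', Finset.mem_univ, if_true, hvz, ha,
      hm] at h
    linarith
  · have h := hdec (w • v)
    have h1 : Q (w • v) z = 1 := by
      rw [← neg_neg z, map_neg, ← hwz, lorentzForm_smul_smul, hvz]
      rfl
    rw [Fin.sum_univ_succ, h1, hm] at h
    have h2 : ∀ i : Fin 6, Q (w • v) (w ^ ((i.succ : Fin 7) : ℕ) • α) = if i = g then -k else 0 :=
      fun i => by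
        rw [Fin.val_succ, hshift, hvx' _ (by omega)]
        simp [Fin.ext_iff]
    simp only [h2, mul_ite, mul_zero, Finset.sum_ite_eq', Finset.mem_univ, if_true, Fin.val_zero,
      pow_zero, one_smul, hwvα] at h
    linarith

theorem lorentzForm_orbitSum {n : ℕ} (w : ModGroup n) (x : H₂ n) (a b : List ℤ) (k : ℕ) :
    Q (orbitSum w x a) (w ^ k • orbitSum w x b) =
      ∑ i ∈ Finset.range a.length, ∑ j ∈ Finset.range b.length,
        a.getD i 0 * b.getD j 0 * Q x (w ^ (k + j - i + (i - (k + j))) • x) := by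
  rw [orbitSum_eq_sum, orbitSum_eq_sum, map_sum, LinearMap.sum_apply]
  refine Finset.sum_congr rfl fun i _ => ?_
  rw [smul_sum', map_sum]
  refine Finset.sum_congr rfl fun j _ => ?_
  rw [smul_zsmul', ← mul_smul, ← pow_add, LinearMap.map_smul, LinearMap.map_smul₂,
    lorentzForm_pow_pow, smul_eq_mul, smul_eq_mul]
  ring

/-- Conjugacy to `r` from a vector whose pairings with its orbit start with `2, 0, -1`: the orbit
spans a lattice of discriminant `2`. -/
theorem exists_conj_r_of_zero_neg_one {w : ModGroup 8} (hw : w ∈ weylGroup 8)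
    (hell : IsElliptic w) {α : H₂ 8} (hα : Q α (canonicalClass 8) = 0)
    (hp : ∀ x, Q x (canonicalClass 8) = 0 → orbitSum w x [1, -1, 1, 0, 0, 1, -1, 1] = 0)
    (hs : ∀ k ≤ 7, Q α (w ^ k • α) = -([2, 0, -1, 0, 0, -1, 1, 1] : List ℤ).getD k 0) :
    ∃ g ∈ ModPlus 8, w = g * r * g⁻¹ := by
  obtain ⟨z, v, k, m, a, hk0, hkD, hm0, hzz, hvv, hvz, hzK, hvK, hzx, hvx, hv7, hwv, h₁, h₂, -⟩ :=
    exists_orbit_completion hw hell hα (hp α hα)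
      (s := [2, 0, -1, 0, 0, -1, 1, 1])
      hs (D := 2)
      -- A is D times the inverse of the Gram matrix of −Q on α, …, w⁶α. Modulo D each column j is
      -- l_j times the column of index g, and B is the quotient of the difference by D.
      (A := !![7, -2, 3, 1, -1, 4, -5;
        -2, 4, 0, 2, 2, 0, 4;
        3, 0, 3, 1, 1, 2, -1;
        1, 2, 1, 3, 1, 2, 1;
        -1, 2, 1, 1, 3, 0, 3;
        4, 0, 2, 2, 0, 4, -2;
        -5, 4, -1, 1, 3, -2, 7])
      (B := !![2, -1, 0, -1, -2, 2, -4;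
        -1, 2, 0, 1, 1, 0, 2;
        0, 0, 0, -1, -1, 1, -2;
        0, 1, 0, 1, 0, 1, 0;
        -1, 1, 0, 0, 1, 0, 1;
        1, 0, 0, 0, -1, 2, -2;
        -2, 2, 0, 1, 2, -1, 4])
      (by norm_num) (by decide +kernel) (by decide +kernel)
      ![1, 0, 1, 1, 1, 0, 1] 2 (by decide +kernel)
  have h₁' : 4 * 2 * m * a = 2 * m * k ^ 2 * 3 + 2 := h₁
  -- The relation reads m(4a − 3k²) = 1, with 0 ≤ k ≤ 1.
  obtain ⟨rfl, rfl, rfl⟩ : k = 1 ∧ m = 1 ∧ a = 1 := by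
    have hm : m ∣ 2 := (Dvd.intro (8 * a - 2 * k ^ 2 * 3) (by linarith))
    have hm2 := Int.le_of_dvd two_pos hm
    have hk2 : k ≤ 1 := by omega
    clear * - hk0 hm0 h₁' hm2 hk2
    interval_cases m <;> interval_cases k <;> omega
  have h₂' : 2 * 2 * 1 * Q (w • v) v = 2 * 1 * 1 ^ 2 * (0 * 3 - 1) + 2 := h₂
  have h₃ : Q (w • v) v = 0 := by linarith
  -- β and u are vectors of K^⊥ with the same pairings under r as α and v have under w.
  refine exists_conj_of_orbit hw r.2 (β := ![0, 0, 0, -1, 1, 0, 0, 0, 0])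
    (u := ![1, -1, 0, -1, -1, 0, 0, 0, 0]) hα hvK (by decide +kernel) (by decide +kernel)
    (fun k hk => ?_) (fun k hk => ?_) (hwv.trans (by decide +kernel)) (h₃.trans (by decide +kernel))
    (hvv.trans (by decide +kernel))
    (Y' := !![-3, -1, -1, -1, -1, -1, -1, -1, -1;
        1, 2, -1, -1, 0, 0, 1, 1, 1;
        -3, -1, -1, -1, -1, -1, -2, -1, -1;
        -1, 1, -2, -1, -1, 0, 0, 0, 0;
        -2, 0, -1, -1, -1, -1, -1, -1, 0;
        -3, -1, -2, -1, -1, -1, -1, -1, -1;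
        -1, 1, -1, -1, -1, -1, 0, 0, 0;
        -4, -2, -1, -1, -1, -1, -2, -2, -2;
        0, -1, 1, 0, 0, 0, 0, 0, 0])
    (by decide +kernel)
  · rw [hs k hk]
    revert k
    decide +kernel
  · interval_cases k
    on_goal 8 => exact hv7.trans (by decide +kernel)
    all_goals exact (hvx _ (by norm_num)).trans (by decide +kernel)

/-- Conjugacy to `r` from a vector whose pairings with its orbit start with `2, 1, 0`: the orbit
spans a lattice of discriminant `2`. -/
theorem exists_conj_r_of_one_zero {w : ModGroup 8} (hw : w ∈ weylGroup 8)
    (hell : IsElliptic w) {α : H₂ 8} (hα : Q α (canonicalClass 8) = 0)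
    (hp : ∀ x, Q x (canonicalClass 8) = 0 → orbitSum w x [1, -1, 1, 0, 0, 1, -1, 1] = 0)
    (hs : ∀ k ≤ 7, Q α (w ^ k • α) = -([2, 1, 0, -1, -1, -1, 0, 0] : List ℤ).getD k 0) :
    ∃ g ∈ ModPlus 8, w = g * r * g⁻¹ := by
  obtain ⟨z, v, k, m, a, hk0, hkD, hm0, hzz, hvv, hvz, hzK, hvK, hzx, hvx, hv7, hwv, h₁, h₂, -⟩ :=
    exists_orbit_completion hw hell hα (hp α hα)
      (s := [2, 1, 0, -1, -1, -1, 0, 0])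
      hs (D := 2)
      (A := !![3, -2, 1, 1, -1, 2, -1;
        -2, 4, -2, 0, 2, -2, 2;
        1, -2, 3, -1, -1, 2, -1;
        1, 0, -1, 3, -1, 0, 1;
        -1, 2, -1, -1, 3, -2, 1;
        2, -2, 2, 0, -2, 4, -2;
        -1, 2, -1, 1, 1, -2, 3])
      (B := !![0, -1, -1, -1, -2, 1, -2;
        0, 2, 0, 1, 2, -1, 2;
        0, -1, 1, -1, -1, 1, -1;
        0, 0, -1, 1, -1, 0, 0;
        0, 1, 0, 0, 2, -1, 1;
        0, -1, 0, -1, -2, 2, -2;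
        0, 1, 0, 1, 1, -1, 2])
      (by norm_num) (by decide +kernel) (by decide +kernel)
      ![1, 0, 1, 1, 1, 0, 1] 0 (by decide +kernel)
  have h₁' : 4 * 2 * m * a = 2 * m * k ^ 2 * 3 + 2 := h₁
  obtain ⟨rfl, rfl, rfl⟩ : k = 1 ∧ m = 1 ∧ a = 1 := by
    have hm : m ∣ 2 := (Dvd.intro (8 * a - 2 * k ^ 2 * 3) (by linarith))
    have hm2 := Int.le_of_dvd two_pos hm
    have hk2 : k ≤ 1 := by omega
    clear * - hk0 hm0 h₁' hm2 hk2
    interval_cases m <;> interval_cases k <;> omega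
  have h₂' : 2 * 2 * 1 * Q (w • v) v = 2 * 1 * 1 ^ 2 * (-1 * 3 - -2) + 2 := h₂
  have h₃ : Q (w • v) v = 0 := by linarith
  refine exists_conj_of_orbit hw r.2 (β := ![-1, 0, 0, 0, 0, 0, 1, 1, 1])
    (u := ![0, -1, 0, 0, 0, 0, 0, 0, 1]) hα hvK (by decide +kernel) (by decide +kernel)
    (fun k hk => ?_) (fun k hk => ?_) (hwv.trans (by decide +kernel)) (h₃.trans (by decide +kernel))
    (hvv.trans (by decide +kernel))
    (Y' := !![-3, -1, -1, -1, -1, -1, -1, -1, -1;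
        0, 1, -2, 0, 0, 0, 0, 0, 1;
        -1, -1, 1, 0, -1, -1, 0, 0, -1;
        -1, 0, -1, -1, 0, 0, 0, -1, 0;
        -1, 0, -1, 0, 0, -1, -1, 0, 0;
        -1, -1, 0, 0, -1, 0, 0, 0, -1;
        0, 1, -1, 0, 0, 0, 0, -1, 1;
        -1, -1, 0, 0, 0, -1, 0, 0, -1;
        0, -1, 1, 0, 0, 0, 0, 0, 0])
    (by decide +kernel)
  · rw [hs k hk]
    revert k
    decide +kernel
  · interval_cases k
    on_goal 8 => exact hv7.trans (by decide +kernel)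
    all_goals exact (hvx _ (by norm_num)).trans (by decide +kernel)

/-- Conjugacy to `r` from a vector whose pairings with its orbit start with `2, 0, 0`: the orbit
spans a lattice of discriminant `8`, either primitive or of index `2` in its saturation. -/
theorem exists_conj_r_of_zero_zero {w : ModGroup 8} (hw : w ∈ weylGroup 8)
    (hell : IsElliptic w) {α : H₂ 8} (hα : Q α (canonicalClass 8) = 0)
    (hp : ∀ x, Q x (canonicalClass 8) = 0 → orbitSum w x [1, -1, 1, 0, 0, 1, -1, 1] = 0)
    (hs : ∀ k ≤ 15, Q α (w ^ k • α) = -([2, 0, 0, -1, 0, -1, 1, 0, 0, -1, 1, 0, 1, 0, 0,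
        -2] : List ℤ).getD k 0) :
    ∃ g ∈ ModPlus 8, w = g * r * g⁻¹ := by
  have hs' : ∀ k ≤ 7, Q α (w ^ k • α) = -([2, 0, 0, -1, 0, -1, 1, 0] : List ℤ).getD k 0 := by
    intro k hk
    rw [hs k (by omega)]
    revert k
    decide +kernel
  obtain ⟨z, v, k, m, a, hk0, hkD, hm0, hzz, hvv, hvz, hzK, hvK, hzx, hvx, hv7, hwv, h₁, h₂, h₄⟩ :=
    exists_orbit_completion hw hell hα (hp α hα)
      (s := [2, 0, 0, -1, 0, -1, 1, 0])
      hs' (D := 8)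
      (A := !![15, -6, 5, 3, -3, 10, -9;
        -6, 12, -2, 2, 6, -4, 10;
        5, -2, 7, 1, -1, 6, -3;
        3, 2, 1, 7, 1, 2, 3;
        -3, 6, -1, 1, 7, -2, 5;
        10, -4, 6, 2, -2, 12, -6;
        -9, 10, -3, 3, 5, -6, 15])
      (B := !![0, 3, -5, 6, -6, 5, -3;
        0, 0, 2, -2, 3, -2, 2;
        0, 1, -1, 2, -2, 2, -1;
        0, 1, -1, 2, -1, 1, 0;
        0, 0, 1, -1, 2, -1, 1;
        0, 2, -3, 4, -4, 4, -2;
        0, -1, 3, -3, 4, -3, 3])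
      (by norm_num) (by decide +kernel) (by decide +kernel)
      ![1, -2, 3, -3, 3, -2, 1] 0 (by decide +kernel)
  have h₁' : 4 * 8 * m * a = 2 * m * k ^ 2 * 15 + 8 := h₁
  -- The relation reads m(16a − 15k²) = 4. The first solution belongs to a primitive orbit lattice,
  -- the second to one of index 2 in its saturation.
  obtain ⟨rfl, rfl, rfl⟩ | ⟨rfl, rfl, rfl⟩ : k = 1 ∧ m = 4 ∧ a = 1 ∨ k = 2 ∧ m = 1 ∧ a = 4 := by
    have hm : m ∣ 4 := (Dvd.intro (16 * a - k ^ 2 * 15) (by linarith))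
    have hm2 := Int.le_of_dvd four_pos hm
    have hk2 : k ≤ 4 := by omega
    clear * - hk0 hm0 h₁' hm2 hk2
    interval_cases m <;> interval_cases k <;> omega
  · have h₂' : 2 * 8 * 4 * Q (w • v) v = 2 * 4 * 1 ^ 2 * (-1 * 15 - -6) + 8 := h₂
    have h₃ : Q (w • v) v = -1 := by linarith
    refine exists_conj_of_orbit hw r.2 (β := ![-1, 0, 1, 0, 0, 0, 1, 0, 1])
      (u := ![0, 0, 0, 0, -1, 0, 0, 0, 1]) hα hvK (by decide +kernel) (by decide +kernel)
      (fun k hk => ?_) (fun k hk => ?_) (hwv.trans (by decide +kernel))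
      (h₃.trans (by decide +kernel))
      (hvv.trans (by decide +kernel))
      (Y' := !![-3, -1, -1, -1, -1, -1, -1, -1, -1;
          -2, -4, -2, -2, -1, 2, 2, 0, -1;
          -1, 1, 0, 0, 0, -2, -1, -1, 0;
          -2, -2, -1, -1, -1, 0, 0, 0, -1;
          -2, -1, -1, -1, -1, 0, 0, -1, -1;
          -1, 0, 0, 0, 0, -1, -1, -1, 0;
          -2, -3, -2, -1, -1, 1, 1, 0, -1;
          0, 2, 1, 1, 0, -2, -1, -1, 0;
          1, 2, 1, 1, 0, -1, -1, 0, 1])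
      (by decide +kernel)
    · rw [hs' k hk]
      revert k
      decide +kernel
    · interval_cases k
      on_goal 8 => exact hv7.trans (by decide +kernel)
      all_goals exact (hvx _ (by norm_num)).trans (by decide +kernel)
  -- Since z² = −2, the vector 2v − z is orthogonal to z, so it lies in the rational span of the
  -- orbit. An integral combination of the orbit reduces it to half of a combination with
  -- coefficients 0, ±1, whose own sequence starts with 2, 1, 0.
  · set u : H₂ 8 := (2 : ℤ) • v - z + orbitSum w α [-8, 3, -3, -2, 1, -5, 5] with hu
    have huK' : Q ((2 : ℤ) • v - z) (canonicalClass 8) = 0 := by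
      rw [LinearMap.map_sub₂, LinearMap.map_smul₂, hvK, hzK]
      rfl
    have h₅ : (2 : ℤ) • u = orbitSum w α [-1, 0, -1, -1, -1, 0, 1] := by
      have hux : ∀ j : Fin 7, Q ((2 : ℤ) • v - z) (w ^ (j : ℕ) • α) = if j = 0 then -4 else 0 := by
        intro j
        rw [LinearMap.map_sub₂, LinearMap.map_smul₂, hvx _ (by omega), hzx _ (by omega)]
        clear * -
        revert j
        decide
      have h := h₄ _ huK'
      simp only [hux, mul_ite, mul_zero, Finset.sum_ite_eq', Finset.mem_univ, if_true] at h
      rw [Fin.sum_univ_seven, LinearMap.map_sub₂, LinearMap.map_smul₂, hvz, hzz] at h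
      have h' : (8 * (-(2 * 1)) : ℤ) • ((2 : ℤ) • v - z) = (-(-(2 * 1)) : ℤ) •
          ((15 * -4 : ℤ) • w ^ 0 • α +
            (-6 * -4 : ℤ) • w ^ 1 • α +
            (5 * -4 : ℤ) • w ^ 2 • α +
            (3 * -4 : ℤ) • w ^ 3 • α +
            (-3 * -4 : ℤ) • w ^ 4 • α +
            (10 * -4 : ℤ) • w ^ 5 • α +
            (-9 * -4 : ℤ) • w ^ 6 • α) +
          (8 * ((2 : ℤ) • -1 - -(2 * 1)) : ℤ) • z := h
      have h'' : (8 : ℤ) • (2 : ℤ) • u = (8 : ℤ) • orbitSum w α [-1, 0, -1, -1, -1, 0, 1] := by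
        rw [hu, orbitSum_eq_sum, orbitSum_eq_sum]
        simp only [List.length_cons, List.length_nil, Finset.sum_range_succ, Finset.sum_range_zero,
          List.getD_cons_succ, List.getD_cons_zero]
        linear_combination (exp := 1) (-1 : ℤ) • h'
      exact smul_right_injective _ (by norm_num : (8 : ℤ) ≠ 0) h''
    have huK : Q u (canonicalClass 8) = 0 := by
      rw [hu, LinearMap.map_add₂, orbitSum_canonicalClass hw, hα, huK', mul_zero, add_zero]
    refine exists_conj_r_of_one_zero hw hell huK hp fun k hk => ?_
    have h₆ : 4 * Q u (w ^ k • u) = Q ((2 : ℤ) • u) (w ^ k • (2 : ℤ) • u) := by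
      rw [smul_zsmul', LinearMap.map_smul, LinearMap.map_smul₂, smul_eq_mul, smul_eq_mul]
      ring
    have h₇ : 4 * Q u (w ^ k • u) = 4 * -([2, 1, 0, -1, -1, -1, 0, 0] : List ℤ).getD k 0 := by
      rw [h₆, h₅, lorentzForm_orbitSum]
      have h₈ : ∀ i ∈ Finset.range 7, ∀ j ∈ Finset.range 7,
          Q α (w ^ (k + j - i + (i - (k + j))) • α) =
            -([2, 0, 0, -1, 0, -1, 1, 0, 0, -1, 1, 0, 1, 0, 0, -2] : List ℤ).getD
              (k + j - i + (i - (k + j))) 0 := fun i hi j hj => by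
        rw [Finset.mem_range] at hi hj
        exact hs _ (by omega)
      refine (Finset.sum_congr rfl fun i hi => Finset.sum_congr rfl fun j hj => by
        rw [h₈ i hi j hj]).trans ?_
      clear * - hk
      revert k
      decide +kernel
    linarith

section

open Polynomial

/-! ### Elements of order 30 -/

theorem exists_conj_r_of_ten {w : ModGroup 8} (hw : w ∈ weylGroup 8) (hell : IsElliptic w)
    (hp : ∀ x, Q x (canonicalClass 8) = 0 → orbitSum w x [1, -1, 1, 0, 0, 1, -1, 1] = 0)
    {α : H₂ 8} (hα : IsRoot α) (h6 : w ^ 6 • α ≠ α) (h10 : w ^ 10 • α ≠ α) :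
    ∃ g ∈ ModPlus 8, w = g * r * g⁻¹ := by
  have hl := toeplitzSearch_root_ten _ (map_defect_mem_root hw hα h6 h10 (by simp) (hp α hα.deg) 15)
  have hs : ∀ k ≤ 15, Q α (w ^ k • α) = -((List.range (15 + 1)).map (defect w α)).getD k 0 := by
    intro k hk
    have : k < 15 + 1 := by omega
    simp [List.getD_eq_getElem?_getD, this, defect_of_deg_zero hα.deg]
  simp only [List.mem_cons, List.not_mem_nil, or_false] at hl
  rcases hl with hl | hl | hl <;> rw [hl] at hs
  · refine exists_conj_r_of_zero_neg_one hw hell hα.deg hp fun k hk => ?_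
    rw [hs k (by omega)]
    revert k
    decide +kernel
  · exact exists_conj_r_of_zero_zero hw hell hα.deg hp hs
  · refine exists_conj_r_of_one_zero hw hell hα.deg hp fun k hk => ?_
    rw [hs k (by omega)]
    revert k
    decide +kernel

/-- A root moved by both w^6 and w^10 has a sequence that passes the search, which leaves only the
first two annihilators. -/
theorem exists_conj_of_orderOf_thirty {w : ModGroup 8} (hw : w ∈ weylGroup 8) (hell : IsElliptic w)
    (ho : orderOf w = 30) :
    (∃ g ∈ ModPlus 8, w = g * coxeterElement (n := 8) (by norm_num) * g⁻¹) ∨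
      ∃ g ∈ ModPlus 8, w = g * r * g⁻¹ := by
  obtain ⟨p, hp, hann⟩ := exists_annihilator hw hell ho
  obtain ⟨α, hα, h6, h10⟩ := exists_root_moved (pow_mem hw 6) (pow_mem hw 10)
    (pow_ne_one_of_lt_orderOf (by norm_num) (by omega))
    (pow_ne_one_of_lt_orderOf (by norm_num) (by omega))
  rw [← List.take_append_drop 2 annihilators, List.mem_append] at hp
  rcases hp with hp | hp
  · simp only [annihilators, List.take_succ_cons, List.take_zero, List.mem_cons, List.not_mem_nil,
      or_false] at hp
    rcases hp with rfl | rfl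
    · exact Or.inl (exists_conj_of_thirty hw hα h6 h10 (hann α hα.deg))
    · exact Or.inr (exists_conj_r_of_ten hw hell hann hα h6 h10)
  · have hp0 : p ≠ [] := by
      rintro rfl
      revert hp
      decide
    have h := map_defect_mem_root hw hα h6 h10 hp0 (hann α hα.deg) 15
    rw [toeplitzSearch_root_empty p hp] at h
    simp at h

theorem orderOf_r : orderOf (r : ModGroup 8) = 30 :=
  orderOf_eq_of_forall_single (by norm_num) (by decide +kernel) (by decide +kernel)

theorem isElliptic_r : IsElliptic (r : ModGroup 8) :=
  isElliptic_of_forall_single le_rfl (N := 30) (by norm_num) (by decide +kernel)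

/-! ### The characteristic polynomial of `r` -/

/-- A basis of `𝔼_8` in which `r` is block triangular. -/
def rBasisMatrix : Matrix (Fin 9) (Fin 8) ℤ :=
  !![2, 2, 1, 0, 0, 1, 2, 0;
    -1, -1, 0, 0, -1, 0, -1, -1;
    -1, -1, 0, 0, 0, -1, 0, 1;
    -1, 0, 0, 0, 0, 0, -1, 0;
    0, -1, -1, 1, 0, -1, -1, 0;
    -1, -1, 0, 0, 0, -1, -1, 0;
    -1, -1, 0, 0, 0, 0, 0, 0;
    -1, 0, -1, -1, 0, 0, -1, 0;
    0, -1, -1, 0, 1, 0, -1, 0]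

/-- The coordinates in the basis `rBasisMatrix` of `𝔼_8`. -/
def rCoordMatrix : Matrix (Fin 8) (Fin 9) ℤ :=
  !![-2, 0, 0, -1, -1, -1, -2, -1, 0;
    -1, -1, -1, 0, 0, 0, 0, 0, -1;
    -1, 0, 0, 0, -1, 0, -1, -1, 0;
    1, 0, 0, 1, 1, 0, 1, 0, 0;
    0, -1, -1, 0, 0, 1, 1, 0, 0;
    1, 1, 1, 1, 0, -1, 0, 0, 1;
    -1, -1, -1, -1, 0, 0, 1, 0, -1;
    1, 1, 2, 1, 0, -1, -1, 0, 1]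

/-- The equivalence `ℤ^8 ≃ 𝔼_8` given by the basis `rBasisMatrix`. -/
def rBasisEquiv : (Fin 8 → ℤ) ≃ₗ[ℤ] rootLattice 8 where
  toFun c := ⟨rBasisMatrix.mulVec c, by
    have h : (lorentzForm ℤ 8).flip (canonicalClass 8) ∘ₗ rBasisMatrix.mulVecLin = 0 := by
      apply LinearMap.pi_ext'
      intro i
      ext
      revert i
      decide +kernel
    exact congrArg (fun f => f c) h⟩
  map_add' x y := Subtype.ext (Matrix.mulVec_add _ x y)
  map_smul' a x := Subtype.ext (Matrix.mulVec_smul _ a x)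
  invFun v := rCoordMatrix.mulVec v
  left_inv c := by
    change rCoordMatrix.mulVec (rBasisMatrix.mulVec c) = c
    rw [Matrix.mulVec_mulVec, show rCoordMatrix * rBasisMatrix = 1 by decide +kernel,
      Matrix.one_mulVec]
  right_inv v := by
    apply Subtype.ext
    change rBasisMatrix.mulVec (rCoordMatrix.mulVec v) = v
    -- As K² = 1, every x is the sum of its projection to 𝔼₈ and Q(x, K)K, and the product of the
    -- two matrices is that projection.
    have h : rBasisMatrix.mulVecLin ∘ₗ rCoordMatrix.mulVecLin +
        LinearMap.smulRight ((lorentzForm ℤ 8).flip (canonicalClass 8)) (canonicalClass 8) =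
          LinearMap.id := by
      apply LinearMap.pi_ext'
      intro i
      ext1
      revert i
      decide +kernel
    have h1 := congrArg (fun f => f (v : H₂ 8)) h
    have h2 : (lorentzForm ℤ 8).flip (canonicalClass 8) v = 0 := v.2
    simpa [h2] using h1

theorem charpoly_rootLatticeAction_r : (rootLatticeAction r).charpoly =
    (X + 1) ^ 2 * (X ^ 2 - X + 1) * (X ^ 4 - X ^ 3 + X ^ 2 - X + 1) := by
  -- C is the companion matrix of Φ₁₀; E consists of the companion matrix of t³ + 1 and the entry
  -- −1; B couples the two blocks.
  set C : Matrix (Fin 4) (Fin 4) ℤ := !![0, 0, 0, -1; 1, 0, 0, 1; 0, 1, 0, -1; 0, 0, 1, 1] with hC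
  set E : Matrix (Fin 4) (Fin 4) ℤ := !![0, 0, -1, 0; 1, 0, 0, 0; 0, 1, 0, 0; 0, 0, 0, -1] with hE
  set B : Matrix (Fin 4) (Fin 4) ℤ := !![0, 0, 1, 0; 0, 0, 0, 0; 0, 0, 0, 0; 0, 0, 0, 0] with hB
  set A : Matrix (Fin 8) (Fin 8) ℤ :=
    Matrix.reindex finSumFinEquiv finSumFinEquiv (Matrix.fromBlocks C B 0 E) with hA
  have h : rootLatticeAction r = rBasisEquiv.conj A.mulVecLin := by
    have h1 : rMatrix * rBasisMatrix = rBasisMatrix * A := by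
      rw [hA, hB, hC, hE]
      decide +kernel
    ext1 v
    obtain ⟨c, rfl⟩ := rBasisEquiv.surjective v
    rw [LinearEquiv.conj_apply_apply, LinearEquiv.symm_apply_apply]
    apply Subtype.ext
    change rMatrix.mulVec (rBasisMatrix.mulVec c) = rBasisMatrix.mulVec (A.mulVec c)
    rw [Matrix.mulVec_mulVec, Matrix.mulVec_mulVec, h1]
  have hCp : C.charpoly = X ^ 4 - X ^ 3 + X ^ 2 - X + 1 := by
    rw [hC, Matrix.charpoly, Matrix.det_succ_row_zero]
    simp [Matrix.charmatrix, Fin.sum_univ_succ, Matrix.det_fin_three,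
      show (3 : Fin 4).succAbove (2 : Fin 3) = 2 by decide]
    ring
  have hEp : E.charpoly = (X ^ 3 + 1) * (X + 1) := by
    rw [hE, Matrix.charpoly, Matrix.det_succ_row_zero]
    simp [Matrix.charmatrix, Fin.sum_univ_succ, Matrix.det_fin_three,
      show (2 : Fin 4).succAbove (2 : Fin 3) = 3 by decide]
    ring
  rw [h, LinearEquiv.charpoly_conj, Matrix.charpoly_mulVecLin, hA, Matrix.charpoly_reindex,
    Matrix.charpoly_fromBlocks_zero₂₁, hCp, hEp]
  ring

end

/-! ### Proof of the classification -/

theorem coxeterNumber_eq {n : ℕ} (hn : 3 ≤ n) (hn8 : n ≤ 8) : coxeterNumber hn = coxeterOrder n :=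
  orderOf_coxeterElement hn hn8

theorem orderOf_conj {n : ℕ} (g c : ModGroup n) : orderOf (g * c * g⁻¹) = orderOf c :=
  MulAut.conj g |>.orderOf_eq c

theorem isIrreducible_coxeterElement {n : ℕ} (hn : 3 ≤ n) (hn8 : n ≤ 8) :
    IsIrreducible (coxeterElement hn) :=
  (isElliptic_coxeterElement hn hn8).isIrreducible hn8 (coxeterElement_mem hn)
    (orderOf_pos_iff.1 (by
      rw [orderOf_coxeterElement hn hn8]
      interval_cases n <;> decide))

/-- An irreducible element of `Mod⁺` of the order of a Coxeter element is conjugate to an elliptic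
element of the Weyl group. -/
theorem exists_conj_isElliptic {n : ℕ} (hn : 3 ≤ n) (hn8 : n ≤ 8) {w : ModGroup n}
    (hw : w ∈ ModPlus n) (hirr : IsIrreducible w) (ho : orderOf w = coxeterOrder n) :
    ∃ g ∈ ModPlus n, g * w * g⁻¹ ∈ weylGroup n ∧ IsElliptic (g * w * g⁻¹) ∧
      orderOf (g * w * g⁻¹) = coxeterOrder n := by
  have hfin : IsOfFinOrder w := orderOf_pos_iff.1 (by
    rw [ho]
    interval_cases n <;> decide)
  obtain ⟨g, hg, hgw⟩ := exists_conj_mem_weylGroup hn hn8 hw hfin hirr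
  have ho' : orderOf (g * w * g⁻¹) = coxeterOrder n := by rw [orderOf_conj, ho]
  exact ⟨g, hg, hgw, isElliptic_of_orderOf_eq hn hn8 hgw (hirr.conj g) ho', ho'⟩

theorem eq_conj_of_conj_eq_conj {n : ℕ} {g h w c : ModGroup n} (e : g * w * g⁻¹ = h * c * h⁻¹) :
    w = (g⁻¹ * h) * c * (g⁻¹ * h)⁻¹ := by
  rw [mul_inv_rev, inv_inv, mul_assoc g⁻¹, mul_assoc g⁻¹, ← mul_assoc (h * c), ← e]
  group

end DelPezzo

open Polynomial in
theorem theorem6p3 :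
    -- the case `3 ≤ n ≤ 7`
    (∀ (n : ℕ) (hn : 3 ≤ n), n ≤ 7 → ∀ w ∈ DelPezzo.ModPlus n,
      ((DelPezzo.IsIrreducible w ∧ orderOf w = DelPezzo.coxeterNumber hn) ↔
        ∃ c, DelPezzo.IsCoxeterElement hn c ∧
          ∃ g ∈ DelPezzo.ModPlus n, w = g * c * g⁻¹)) ∧
    -- the case `n = 8`
    DelPezzo.coxeterNumber (n := 8) (by norm_num) = 30 ∧
    (∀ w ∈ DelPezzo.ModPlus 8,
      ((DelPezzo.IsIrreducible w ∧ orderOf w = 30) ↔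
        (∃ c, DelPezzo.IsCoxeterElement (n := 8) (by norm_num) c ∧ IsConj w c) ∨
          IsConj w (DelPezzo.r : DelPezzo.ModGroup 8))) ∧
    -- the characteristic polynomial of `r` on `𝔼_8`
    (DelPezzo.rootLatticeAction DelPezzo.r).charpoly =
      (X + 1) ^ 2 * (X ^ 2 - X + 1) * (X ^ 4 - X ^ 3 + X ^ 2 - X + 1) := by
  refine ⟨fun n hn hn7 w hw => ⟨?_, ?_⟩, DelPezzo.coxeterNumber_eq _ le_rfl, fun w hw => ⟨?_, ?_⟩,
    DelPezzo.charpoly_rootLatticeAction_r⟩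
  · rintro ⟨hirr, ho⟩
    have hn8 : n ≤ 8 := by omega
    rw [DelPezzo.coxeterNumber_eq hn hn8] at ho
    obtain ⟨g, hg, hgw, hell, ho'⟩ := DelPezzo.exists_conj_isElliptic hn hn8 hw hirr ho
    obtain ⟨h, hh, e⟩ := DelPezzo.exists_conj_coxeterElement hn hn7 hgw hell ho'
    exact ⟨_, DelPezzo.isCoxeterElement_coxeterElement hn, g⁻¹ * h, mul_mem (inv_mem hg) hh,
      DelPezzo.eq_conj_of_conj_eq_conj e⟩
  · rintro ⟨c, hc, g, hg, rfl⟩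
    have hn8 : n ≤ 8 := by omega
    obtain ⟨h, -, rfl⟩ := DelPezzo.exists_conj_of_isCoxeterElement hn hn8 hc
    refine ⟨((DelPezzo.isIrreducible_coxeterElement hn hn8).conj h).conj g, ?_⟩
    rw [DelPezzo.orderOf_conj, DelPezzo.orderOf_conj]
    rfl
  · rintro ⟨hirr, ho⟩
    obtain ⟨g, -, hgw, hell, ho'⟩ := DelPezzo.exists_conj_isElliptic (by norm_num) le_rfl hw hirr ho
    rcases DelPezzo.exists_conj_of_orderOf_thirty hgw hell ho' with ⟨h, -, e⟩ | ⟨h, -, e⟩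
    · exact Or.inl ⟨_, DelPezzo.isCoxeterElement_coxeterElement _,
        (isConj_iff.2 ⟨_, (DelPezzo.eq_conj_of_conj_eq_conj e).symm⟩).symm⟩
    · exact Or.inr (isConj_iff.2 ⟨_, (DelPezzo.eq_conj_of_conj_eq_conj e).symm⟩).symm
  · rintro (⟨c, hc, hwc⟩ | hwr)
    · obtain ⟨h, -, rfl⟩ := DelPezzo.exists_conj_of_isCoxeterElement (by norm_num) le_rfl hc
      obtain ⟨g, rfl⟩ := isConj_iff.1 hwc.symm
      refine ⟨((DelPezzo.isIrreducible_coxeterElement _ le_rfl).conj h).conj g, ?_⟩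
      rw [DelPezzo.orderOf_conj, DelPezzo.orderOf_conj]
      exact DelPezzo.orderOf_coxeterElement (by norm_num) le_rfl
    · obtain ⟨g, rfl⟩ := isConj_iff.1 hwr.symm
      refine ⟨DelPezzo.IsIrreducible.conj (DelPezzo.isElliptic_r.isIrreducible le_rfl DelPezzo.r.2
        (orderOf_pos_iff.1 (by rw [DelPezzo.orderOf_r]; norm_num))) g, ?_⟩
      rw [DelPezzo.orderOf_conj, DelPezzo.orderOf_r]
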